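/- **Setup.** Let $q_1,q_2,q_3,q_4\in\mathbb C^\times$ with $q_1q_2q_3q_4=1$ and $q_1,q_2,q_3$ multiplicatively independent (no nontrivial integer monomial in them equals $1$); fix logarithms $\log q_a$ with $\sum_a\log q_a=0$ and put $\log(-q_4)=\log q_4+\pi i$. For $S\subseteq\{1,2,3,4\}$ put $\mathbf P_S=\prod_{a\in S}(1-q_a)$ and $\mathbf P_S^{[n]}=\prod_{a\in S}(1-q_a^n)$. For a Laurent polynomial character $\mathbf X=\sum_i n_ix_i$ (monomials $x_i$ in $q_1,q_2,q_3$) put $\mathbf X^\vee=\sum_i n_ix_i^{-1}$ and $\mathbb I[\mathbf X]=\prod_i(1-x_i^{-1})^{n_i}$. Let $\mathsf a_n$ ($n\ne0$) be oscillators with $[\mathsf a_n,\mathsf a_m]=-\frac1n\mathbf P_{1234}^{[n]}\delta_{n+m,0}$, acting on the Fock space in which $\mathsf a_n$, $n>0$, annihilate the vacuum, and let $t_0,\tilde t_0,\partial_t,\tilde\partial_t$ be zero modes with $[\partial_t,t_0]=[\tilde\partial_t,\tilde t_0]=1$, all other commutators being $0$; the zero modes act on functions of $(t,\tilde t)$.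 Normal ordering puts $\mathsf a_n$ ($n>0$), $\partial_t,\tilde\partial_t$ to the right. Define $$\mathsf A(x)=e^{t_0}{:}e^{\sum_{n\ne0}\mathsf a_nx^{-n}}{:},\qquad \mathsf S_a(x)=\mathsf s_{a,0}(x)\,{:}e^{\sum_{n\neq 0} \mathsf a_nx^{-n}/(1-q_a^{-n})}{:},\qquad \mathsf s_{a,0}(x)=x^{-t_0/\log q_a}e^{-\tilde\partial_t/\log q_a},$$ $$\mathsf X_{12}(x)=e^{\log q_3\log q_4\,\tilde t_0}\,{:}e^{\sum_{n\neq 0}\mathsf a_nx^{-n}/\mathbf P_{12}^{[-n]}}{:},\qquad \mathsf W_{\bar4}(x)=x^{-\log q_4\tilde t_0}e^{-\log q_4\log(-q_4)\tilde t_0}e^{-\log q_4\partial_t}\,{:}e^{\sum_{n\neq 0}\mathsf a_nx^{-n}/\mathbf P_{123}^{[-n]}}{:}.$$ Thus $\mathsf A(x)={:}\mathsf S_a(x)/\mathsf S_a(q_ax){:}$ and $\mathsf X_{12}(x)={:}\mathsf W_{\bar4}(x)/\mathsf W_{\bar4}(q_3x){:}$. Every spectral parameter comes with a logarithm; multiplying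 it by $q_a$ adds $\log q_a$. **D4 $qq$-character.** For a Young diagram $\rho$ let $\mathbf K_\rho=\sum_{(i,j)\in\rho}q_1^{i-1}q_2^{j-1}$ and $$\mathsf T_{12}(x)=\sum_\rho\mathfrak q^{|\rho|}\,\mathbb I\big[-\mathbf P_{34}^\vee\mathbf K_\rho+\mathbf P_{123}^\vee\mathbf K_\rho^\vee\mathbf K_\rho\big]\;{:}\mathsf X_{12}(x)\prod_{(i,j)\in\rho}\mathsf A^{-1}(xq_1^{i-1}q_2^{j-1}){:}$$ **Two-leg D6 $qq$-character.** Let $\lambda,\mu$ be Young diagrams, let $\lambda^{\mathrm T}$ be the transpose of $\lambda$, and put $\mathcal B_\lambda=\{(a,b,c)\in\mathbb Z_{>0}^3: c\le\lambda_b\}$ (leg along axis 1), $\mathcal B_\mu=\{(a,b,c): a\le\mu_c\}$ (leg along axis 2), $\mathcal B=\mathcal B_\lambda\cup\mathcal B_\mu$. Let $\mathcal{PP}_{\lambda\mu\emptyset}$ be the set of finite sets $\pi$ of boxes disjoint from $\mathcal B$ such that $\mathcal B\cup\pi$ is a (down-closed) plane partition. Let $\mathbf K_\pi=\sum_{(a,b,c)\in\pi}q_1^{a-1}q_2^{b-1}q_3^{c-1}$,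 and let $\mathbf N_{\lambda\mu\emptyset}$ be the same sum over $\mathcal B$, computed by inclusion–exclusion with each rod summed to a rational function, $\sum_{a\ge1}q_i^{a-1}=1/(1-q_i)$, so that $\mathbf P_{1234}\mathbf N_{\lambda\mu\emptyset}^\vee$ is a Laurent polynomial. Then $$\mathsf T_{\bar4,\lambda\mu\emptyset}(x)=\sum_{\pi\in\mathcal{PP}_{\lambda\mu\emptyset}}\mathfrak q^{|\pi|}\,\mathbb I\big[-\mathbf P_4^\vee\mathbf K_\pi+\mathbf P_{1234}\mathbf N_{\lambda\mu\emptyset}^\vee\mathbf K_\pi+\mathbf P_{123}^\vee\mathbf K_\pi^\vee\mathbf K_\pi\big]\;{:}\mathsf W_{\bar4}(x)\,\mathsf B_{\lambda\mu}(x)\prod_{(a,b,c)\in\pi}\mathsf A^{-1}(xq_1^{a-1}q_2^{b-1}q_3^{c-1}){:}$$ where $\mathsf B_{\lambda\mu}(x)$ is the regularization of ${:}\prod_{(a,b,c)\in\mathcal B}\mathsf A^{-1}(xq_1^{a-1}q_2^{b-1}q_3^{c-1}){:}$ obtained by inclusion–exclusion and ${:}\prod_{j\ge1}\mathsf A^{-1}(q_i^{j-1}y){:}=\mathsf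 S_i(y)^{-1}$: $$\mathsf B_{\lambda\mu}(x)={:}\prod_{(b,c):\,c\le\lambda_b}\mathsf S_1(xq_2^{b-1}q_3^{c-1})^{-1}\prod_{(a,c):\,a\le\mu_c}\mathsf S_2(xq_1^{a-1}q_3^{c-1})^{-1}\prod_{(a,b,c)\in\mathcal B_\lambda\cap\mathcal B_\mu}\mathsf A(xq_1^{a-1}q_2^{b-1}q_3^{c-1}){:}$$ Let $\mathsf b_0$ be the zero-mode factor of $\mathsf B_{\lambda\mu}(x)$; it does not depend on $\pi$. **Infinite ordered product.** Let $x_k=xq_3^{k-1}q_1^{\mu_k}q_2^{\lambda^{\mathrm T}_k}$ for $k\ge1$, where $\lambda_k^{\mathrm T}=\#\{b:\lambda_b\ge k\}$. For large $N$ the layers $k>N$, taken in their vacuum state, contribute ${:}\prod_{k>N}\mathsf X_{12}(xq_3^{k-1}){:}$, regularized as $\mathsf W_{\bar4}(xq_3^N)$. So the product of the first $N$ factors, completed by this tail, is $$\mathsf M_N=\mathsf W_{\bar4}(xq_3^N)\,\mathsf T_{12}(x_N)\cdots\mathsf T_{12}(x_2)\,\mathsf T_{12}(x_1).$$ Its matrix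 elements are understood by radial ordering and analytic continuation: put $s^{L_0}$ to the right of each factor ($L_0$ is the oscillator degree, $s$ a formal variable) and expand in $s$. Let $$\mathcal Z_N(s)=\prod_{1\le i<j\le N}\exp\Big(-\sum_{n\ge1}\frac1n\frac{\mathbf P_{34}^{[n]}\mathbf P_{34}^{[-n]}}{\mathbf P_{1234}^{[n]}}\Big(\frac{s^{j-i}x_i}{x_j}\Big)^n\Big)\prod_{i=1}^N\exp\Big(-\sum_{n\ge1}\frac1n\frac{\mathbf P_{34}^{[n]}\mathbf P_{4}^{[-n]}}{\mathbf P_{1234}^{[n]}}\Big(\frac{s^{N+1-i}x_i}{xq_3^N}\Big)^n\Big)$$ be the one-loop factor, the contraction of the highest weight operators $\mathsf X_{12}(x_1),\dots,\mathsf X_{12}(x_N)$ and $\mathsf W_{\bar4}(xq_3^N)$. **Theorem (D6 two-leg decomposition into D4 $qq$-characters).** For all $\lambda,\mu$ and $x\neq 0$, $$\overleftarrow{\prod_{k=1}^{\infty}}\mathsf T_{12}\big(xq_3^{k-1}q_1^{\mu_k}q_2^{\lambda^{\mathrm T}_k}\big)\simeq\mathsf T_{\bar4,\lambda\mu\emptyset}(x)$$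 up to one-loop factors and the zero-mode factor $\mathsf b_0$. Precisely: for every $n\ge0$ there is $N_0$ such that for all $N\ge N_0$ and every matrix element, the coefficient of $\mathfrak q^n$ in the matrix element of $\mathsf M_N$ (a power series in $s$), divided by $\mathcal Z_N(s)$, is the expansion of a rational function of $s$ that is regular at $s=1$, and its value at $s=1$ is the coefficient of $\mathfrak q^n$ in the matrix element of ${:}\mathsf b_0^{-1}\,\mathsf T_{\bar4,\lambda\mu\emptyset}(x){:}$. -/

import Mathlib

/-!
# D4 and D6 qq-characters as vertex operators

Indices: the directions `1,2,3,4` are `0,1,2,3 : Fin 4`, and boxes and layers are counted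
from `0`. The parameters are given by their logarithms: `q_a = exp (ε a)` with `∑ a, ε a = 0`, and
a spectral parameter `x = exp u` is given by `u : ℂ`, so that `x q_1^i q_2^j q_3^k` is given by
`u + i ε_1 + j ε_2 + k ε_3`.
-/

namespace QQ

open Finset

noncomputable section

/-! ### Parameters -/

/-- `q_a ^ n`. -/
def qpow (ε : Fin 4 → ℂ) (a : Fin 4) (n : ℤ) : ℂ := Complex.exp (n * ε a)

/-- `P_S^{[n]} = ∏_{a ∈ S} (1 - q_a^n)`. -/
def P (ε : Fin 4 → ℂ) (S : Finset (Fin 4)) (n : ℤ) : ℂ := ∏ a ∈ S, (1 - qpow ε a n)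

/-- Generic parameters: `q_1 q_2 q_3 q_4 = 1`, and `q_1, q_2, q_3` are multiplicatively
independent. -/
def Generic (ε : Fin 4 → ℂ) : Prop :=
  ∑ a, ε a = 0 ∧
    ∀ a b c : ℤ, Complex.exp (a * ε 0 + b * ε 1 + c * ε 2) = 1 → a = 0 ∧ b = 0 ∧ c = 0

/-! ### Fock space and normal ordered exponentials -/

/-- The coefficients of an expression `∑_{n ≠ 0} e_n a_n + α t₀ + α' t̃₀ + β ∂_t + β' ∂̃_t`
linear in the modes: `e.1 n = e_n` (the value at `0` is not used) and `e.2 = ![α, α', β, β']`.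
It stands for the normal ordered exponential of that expression; the normal ordered product of two
exponentials is given by the sum of the exponents. -/
abbrev Exponent : Type := (ℤ → ℂ) × (Fin 4 → ℂ)

/-- Functions of the zero modes `(t, t̃)`: here `t₀`, `t̃₀` are multiplication by `t`, `t̃`, and
`∂_t`, `∂̃_t` are the partial derivatives. -/
abbrev ZeroModeFun : Type := ℂ × ℂ → ℂ

/-- The Fock space: polynomials in `p_1, p_2, …` (the variable `X i` is `p_{i+1}`) over the
functions of the zero modes. For `n > 0` the mode `a_{-n}` is multiplication by `p_n` and
`a_n = -(1/n) P_{1234}^{[n]} ∂/∂p_n`, so `[a_n, a_m] = -(1/n) P_{1234}^{[n]} δ_{n+m,0}`. -/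
abbrev Fock : Type := MvPolynomial ℕ ZeroModeFun

/-- The completion of the Fock space, in which vertex operators take values. -/
abbrev FockHat : Type := MvPowerSeries ℕ ZeroModeFun

/-- The translation `exp (β ∂_t + β' ∂̃_t)` of functions of the zero modes. -/
def zeroModeShift (β β' : ℂ) : ZeroModeFun →+* ZeroModeFun :=
  RingHom.pi fun z : ℂ × ℂ => Pi.evalRingHom (fun _ : ℂ × ℂ => ℂ) (z.1 + β, z.2 + β')

/-- The scalar `-(1/n) P_{1234}^{[n]}`. -/
def heis (ε : Fin 4 → ℂ) (n : ℤ) : ℂ := -(1 / (n : ℂ)) * P ε univ n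

/-- The annihilation half `exp (∑_{n>0} e_n a_n + β ∂_t + β' ∂̃_t)`; as the exponential of a first
order differential operator with constant coefficients it is the translation
`p_n ↦ p_n - (1/n) P_{1234}^{[n]} e_n`, `t ↦ t + β`, `t̃ ↦ t̃ + β'`. -/
def annihilationPart (ε : Fin 4 → ℂ) (e : Exponent) : Fock →+* Fock :=
  MvPolynomial.eval₂Hom (MvPolynomial.C.comp (zeroModeShift (e.2 2) (e.2 3)))
    (fun i => MvPolynomial.X i +
      MvPolynomial.C (fun _ => e.1 ((i : ℤ) + 1) * heis ε ((i : ℤ) + 1)))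

/-- The creation half `exp (∑_{n>0} e_{-n} a_{-n} + α t₀ + α' t̃₀)`, a multiplication operator. -/
def creationPart (e : Exponent) : FockHat :=
  fun m z => Complex.exp (e.2 0 * z.1 + e.2 1 * z.2) *
    m.prod fun i k => e.1 (-((i : ℤ) + 1)) ^ k / (k.factorial : ℂ)

/-- The normal ordered exponential with exponent `e`, as an operator on the Fock space. -/
def vertexOp (ε : Fin 4 → ℂ) (e : Exponent) (v : Fock) : FockHat :=
  creationPart e * (annihilationPart ε e v : FockHat)

/-- Finite linear combinations of normal ordered exponentials. The product of this algebra is the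
normal ordered product. -/
abbrev Symbol : Type := AddMonoidAlgebra ℂ Exponent

/-- The operator on the Fock space given by a linear combination of normal ordered exponentials. -/
def symbolOp (ε : Fin 4 → ℂ) (Ψ : Symbol) (v : Fock) : FockHat :=
  Ψ.coeff.sum fun e c => MvPowerSeries.C (fun _ => c) * vertexOp ε e v

/-! ### The vertex operators -/

/-- The modes `v_n x^{-n}`, `n ≠ 0`, expressed through `a_n = P_S^{[-n]} v_n`. -/
def osc (ε : Fin 4 → ℂ) (S : Finset (Fin 4)) (u : ℂ) : ℤ → ℂ :=
  fun n => if n = 0 then 0 else Complex.exp (-(n * u)) / P ε S (-n)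

/-- The root current `A(x)`. -/
def currentA (ε : Fin 4 → ℂ) (u : ℂ) : Exponent :=
  (osc ε ∅ u, ![1, 0, 0, 0])

/-- The screening current `S_a(x)`. -/
def currentS (ε : Fin 4 → ℂ) (a : Fin 4) (u : ℂ) : Exponent :=
  (osc ε {a} u, ![-(u / ε a), 0, 0, -(1 / ε a)])

/-- The D4 vertex operator `X_{12}(x)`. -/
def currentX (ε : Fin 4 → ℂ) (u : ℂ) : Exponent :=
  (osc ε {0, 1} u, ![0, ε 2 * ε 3, 0, 0])

/-- The D6 vertex operator `W_{123}(x)`, with `log (-q_4) = log q_4 + π i`. -/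
def currentW (ε : Fin 4 → ℂ) (u : ℂ) : Exponent :=
  (osc ε {0, 1, 2} u,
    ![0, -(ε 3 * u) - ε 3 * (ε 3 + Real.pi * Complex.I), -ε 3, 0])

/-- `X_{12}(x) = :W_{123}(x) / W_{123}(q_3 x):`, including zero modes. -/
theorem currentX_eq (ε : Fin 4 → ℂ) (h : Generic ε) (u : ℂ) :
    currentX ε u = currentW ε u - currentW ε (u + ε 2) := by
  refine Prod.ext ?_ ?_
  · funext n
    by_cases hn : n = 0
    · simp [currentX, currentW, osc, hn]
    have h3 : (1 : ℂ) - qpow ε 2 (-n) ≠ 0 := by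
      intro h0
      have := (h.2 0 0 (-n) (by simpa [qpow] using (sub_eq_zero.1 h0).symm)).2.2
      omega
    have hP : P ε {0, 1, 2} (-n) = P ε {0, 1} (-n) * (1 - qpow ε 2 (-n)) := by
      simp [P, mul_assoc]
    have he : Complex.exp (-(n * (u + ε 2))) = Complex.exp (-(n * u)) * qpow ε 2 (-n) := by
      rw [qpow, ← Complex.exp_add]; congr 1; push_cast; ring
    simp only [currentX, currentW, osc, hn, if_false, Prod.fst_sub, Pi.sub_apply, hP, he]
    by_cases h12 : P ε {0, 1} (-n) = 0
    · simp [h12]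
    · field_simp
  · funext i
    fin_cases i <;> simp [currentX, currentW]
    ring

/-! ### Characters and the equivariant index -/

/-- Characters: Laurent polynomials in `q_1, q_2, q_3` with integer coefficients. -/
abbrev Character : Type := AddMonoidAlgebra ℤ (ℤ × ℤ × ℤ)

/-- The monomial `q_1^i q_2^j q_3^k`. -/
def mon (i j k : ℤ) : Character := AddMonoidAlgebra.single (i, j, k) 1

/-- `q_a` as a character, with `q_4 = q_1⁻¹ q_2⁻¹ q_3⁻¹`. -/
def chq : Fin 4 → Character := ![mon 1 0 0, mon 0 1 0, mon 0 0 1, mon (-1) (-1) (-1)]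

/-- `P_S = ∏_{a ∈ S} (1 - q_a)` as a character. -/
def chP (S : Finset (Fin 4)) : Character := ∏ a ∈ S, (1 - chq a)

/-- The dual character, all weights inverted. -/
def dual (X : Character) : Character := AddMonoidAlgebra.mapDomain (fun m => -m) X

/-- The index `𝕀[∑ n_i x_i] = ∏ (1 - x_i⁻¹)^{n_i}`. -/
def index (ε : Fin 4 → ℂ) (X : Character) : ℂ :=
  X.coeff.prod fun m k =>
    (1 - Complex.exp (-(m.1 * ε 0 + m.2.1 * ε 1 + m.2.2 * ε 2))) ^ k

/-! ### The D4 qq-character -/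

theorem finite_youngDiagrams (n : ℕ) : {lam : YoungDiagram | lam.card = n}.Finite := by
  have hinj : Function.Injective YoungDiagram.cells := fun a b h => YoungDiagram.ext h
  refine Set.Finite.of_finite_image (f := YoungDiagram.cells) ?_ hinj.injOn
  refine (Finset.finite_toSet (Finset.range n ×ˢ Finset.range n).powerset).subset ?_
  rintro _ ⟨lam, hl, rfl⟩
  simp only [Set.mem_ofPred_eq] at hl
  simp only [Finset.coe_powerset, Set.mem_preimage, Set.mem_powerset_iff, Finset.coe_subset]
  rintro ⟨i, j⟩ hij
  have hij' : (i, j) ∈ lam := hij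
  have hc : lam.colLen j ≤ n := by
    rw [← hl, YoungDiagram.colLen_eq_card]
    exact Finset.card_le_card (Finset.filter_subset _ _)
  have hr : lam.rowLen i ≤ n := by
    rw [← hl, YoungDiagram.rowLen_eq_card]
    exact Finset.card_le_card (Finset.filter_subset _ _)
  have h1 := YoungDiagram.mem_iff_lt_colLen.1 hij'
  have h2 := YoungDiagram.mem_iff_lt_rowLen.1 hij'
  simp only [Finset.mem_product, Finset.mem_range]
  omega

/-- The Young diagrams with `n` boxes. -/
def youngDiagrams (n : ℕ) : Finset YoungDiagram := (finite_youngDiagrams n).toFinset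

/-- `K = ∑_{(i,j) ∈ lam} q_1^i q_2^j` (with the spectral parameter, which drops out, set to `1`). -/
def chK4 (lam : YoungDiagram) : Character := ∑ b ∈ lam.cells, mon b.1 b.2 0

/-- The D4 partition function `𝕀[-P_{34}^∨ N^∨ K + P_{123}^∨ K^∨ K]`. -/
def Z4 (ε : Fin 4 → ℂ) (lam : YoungDiagram) : ℂ :=
  index ε (-(dual (chP {2, 3}) * chK4 lam)
    + dual (chP {0, 1, 2}) * dual (chK4 lam) * chK4 lam)

/-- The monomial `:X_{12}(x) ∏_{(i,j) ∈ lam} A⁻¹(x q_1^i q_2^j):`. -/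
def Lambda4 (ε : Fin 4 → ℂ) (u : ℂ) (lam : YoungDiagram) : Exponent :=
  currentX ε u - ∑ b ∈ lam.cells, currentA ε (u + b.1 * ε 0 + b.2 * ε 1)

/-- The D4 qq-character `T_{12}(x)`, a formal power series in the topological counting
parameter. -/
def T4 (ε : Fin 4 → ℂ) (u : ℂ) : PowerSeries Symbol :=
  PowerSeries.mk fun n => ∑ lam ∈ youngDiagrams n,
    AddMonoidAlgebra.single (Lambda4 ε u lam) (Z4 ε lam)

/-! ### The two-leg D6 qq-character -/

/-- The box `(a, b, c)` has coordinates along directions `1, 2, 3`. The leg along axis `1` has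
cross section `lam` (cells `(b, c)`), the leg along axis `2` has cross section `mu`
(cells `(c, a)`). So `lam.colLen c` is the extent of the first leg in direction `2` at height `c`,
and `mu.rowLen c` is the extent of the second leg in direction `1` at height `c`. -/
def boundaryBoxes (lam mu : YoungDiagram) : Set (ℕ × ℕ × ℕ) :=
  {x | (x.2.1, x.2.2) ∈ lam ∨ (x.2.2, x.1) ∈ mu}

/-- Finite sets of boxes disjoint from the legs which together with the legs form a (down-closed)
plane partition. -/
def IsLegConfig (lam mu : YoungDiagram) (π : Finset (ℕ × ℕ × ℕ)) : Prop :=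
  (∀ x ∈ π, x ∉ boundaryBoxes lam mu) ∧
    IsLowerSet (boundaryBoxes lam mu ∪ (π : Set (ℕ × ℕ × ℕ)))

theorem finite_legConfigs (lam mu : YoungDiagram) (n : ℕ) :
    {π : Finset (ℕ × ℕ × ℕ) | IsLegConfig lam mu π ∧ π.card = n}.Finite := by
  set M := n + lam.rowLen 0 + lam.colLen 0 + mu.rowLen 0 + mu.colLen 0 with hM
  refine (Finset.finite_toSet
    (Finset.range M ×ˢ Finset.range M ×ˢ Finset.range M).powerset).subset ?_
  rintro π ⟨⟨hd, hl⟩, hn⟩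
  simp only [Finset.coe_powerset, Set.mem_preimage, Set.mem_powerset_iff, Finset.coe_subset]
  rintro ⟨a, b, c⟩ hx
  have hout : ∀ a' b' c', a' ≤ a → b' ≤ b → c' ≤ c →
      ¬ (b', c') ∈ lam → ¬ (c', a') ∈ mu → (a', b', c') ∈ π := by
    intro a' b' c' ha hb hc h1 h2
    have := hl (show (a', b', c') ≤ (a, b, c) from ⟨ha, hb, hc⟩) (Or.inr hx)
    rcases this with (h | h) | h
    · exact absurd h h1
    · exact absurd h h2
    · exact h
  have hab := hd _ hx
  simp only [boundaryBoxes, Set.mem_ofPred_eq, not_or] at hab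
  have key : ∀ (f : ℕ → ℕ × ℕ × ℕ) (p r : ℕ), Function.Injective f →
      (∀ i, p ≤ i → i ≤ r → f i ∈ π) → r < n + p := by
    intro f p r hf hmem
    have : (Finset.Icc p r).card ≤ π.card :=
      Finset.card_le_card_of_injOn f (fun i hi => hmem i (Finset.mem_Icc.1 hi).1
        (Finset.mem_Icc.1 hi).2) hf.injOn
    rw [Nat.card_Icc, hn] at this
    omega
  have hA : a < n + mu.rowLen 0 := by
    refine key (fun i => (i, b, c)) _ a (fun i j h => by simpa using h) fun i h1 h2 => ?_
    refine hout _ _ _ h2 le_rfl le_rfl hab.1 fun h => ?_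
    have := YoungDiagram.mem_iff_lt_rowLen.1 h
    have := mu.rowLen_anti 0 c (Nat.zero_le _)
    omega
  have hB : b < n + lam.colLen 0 := by
    refine key (fun i => (a, i, c)) _ b (fun i j h => by simpa using h) fun i h1 h2 => ?_
    refine hout _ _ _ le_rfl h2 le_rfl (fun h => ?_) hab.2
    have := YoungDiagram.mem_iff_lt_colLen.1 h
    have := lam.colLen_anti 0 c (Nat.zero_le _)
    omega
  have hC : c < n + (lam.rowLen 0 + mu.colLen 0) := by
    refine key (fun i => (a, b, i)) _ c (fun i j h => by simpa using h) fun i h1 h2 => ?_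
    refine hout _ _ _ le_rfl le_rfl h2 (fun h => ?_) fun h => ?_
    · have := YoungDiagram.mem_iff_lt_rowLen.1 h
      have := lam.rowLen_anti 0 b (Nat.zero_le _)
      omega
    · have := YoungDiagram.mem_iff_lt_colLen.1 h
      have := mu.colLen_anti 0 a (Nat.zero_le _)
      omega
  simp only [Finset.mem_product, Finset.mem_range]
  omega

/-- The configurations with `n` boxes outside the legs. -/
def legConfigs (lam mu : YoungDiagram) (n : ℕ) : Finset (Finset (ℕ × ℕ × ℕ)) :=
  (finite_legConfigs lam mu n).toFinset

/-- The finitely many boxes `(a, b, c)` that lie on both legs. -/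
def legIntersection (lam mu : YoungDiagram) : Finset (ℕ × ℕ × ℕ) :=
  ((lam.cells ×ˢ mu.cells).filter fun p => p.1.2 = p.2.1).image
    fun p => (p.2.2, p.1.1, p.1.2)

/-- `P_{12} N_{lam mu ∅}`, where `N_{lam mu ∅}` is the sum of `q_1^a q_2^b q_3^c` over the boxes
of the two legs (inclusion-exclusion), each rod being summed as `∑_a q_1^a = 1 / (1 - q_1)` or
`∑_b q_2^b = 1 / (1 - q_2)`. -/
def chP12N (lam mu : YoungDiagram) : Character :=
  chP {1} * ∑ b ∈ lam.cells, mon 0 b.1 b.2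
    + chP {0} * ∑ b ∈ mu.cells, mon b.2 0 b.1
    - chP {0, 1} * ∑ x ∈ legIntersection lam mu, mon x.1 x.2.1 x.2.2

/-- `K = ∑_{(a,b,c) ∈ π} q_1^a q_2^b q_3^c`. -/
def chK6 (π : Finset (ℕ × ℕ × ℕ)) : Character := ∑ x ∈ π, mon x.1 x.2.1 x.2.2

/-- The D6 partition function `𝕀[-P_4^∨ N^∨ K + P_{1234} N_{lam mu ∅}^∨ K + P_{123}^∨ K^∨ K]`;
here `P_{1234} = P_{1234}^∨`, so `P_{1234} N_{lam mu ∅}^∨ = (P_{34} P_{12} N_{lam mu ∅})^∨`. -/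
def Z6 (ε : Fin 4 → ℂ) (lam mu : YoungDiagram) (π : Finset (ℕ × ℕ × ℕ)) : ℂ :=
  index ε (-(dual (chP {3}) * chK6 π)
    + dual (chP {2, 3} * chP12N lam mu) * chK6 π
    + dual (chP {0, 1, 2}) * dual (chK6 π) * chK6 π)

/-- `:∏ A⁻¹(x q_1^a q_2^b q_3^c):` over the boxes of the two legs (inclusion-exclusion), each rod
being regularized by `:∏_{a ≥ 0} A⁻¹(q_i^a x): = S_i(x)⁻¹`. -/
def boundaryExp (ε : Fin 4 → ℂ) (u : ℂ) (lam mu : YoungDiagram) : Exponent :=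
  -(∑ b ∈ lam.cells, currentS ε 0 (u + b.1 * ε 1 + b.2 * ε 2))
    - ∑ b ∈ mu.cells, currentS ε 1 (u + b.2 * ε 0 + b.1 * ε 2)
    + ∑ x ∈ legIntersection lam mu, currentA ε (u + x.1 * ε 0 + x.2.1 * ε 1 + x.2.2 * ε 2)

/-- The zero mode part of a normal ordered exponential. -/
def zeroModePart (e : Exponent) : Exponent := (0, e.2)

/-- The monomial `:W_{123}(x) ∏_{legs} A⁻¹ ∏_{(a,b,c) ∈ π} A⁻¹(x q_1^a q_2^b q_3^c):`. -/
def Lambda6 (ε : Fin 4 → ℂ) (u : ℂ) (lam mu : YoungDiagram) (π : Finset (ℕ × ℕ × ℕ)) :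
    Exponent :=
  currentW ε u + boundaryExp ε u lam mu
    - ∑ x ∈ π, currentA ε (u + x.1 * ε 0 + x.2.1 * ε 1 + x.2.2 * ε 2)

/-- The two-leg D6 qq-character `T_{123, lam mu ∅}(x)`. -/
def T6 (ε : Fin 4 → ℂ) (u : ℂ) (lam mu : YoungDiagram) : PowerSeries Symbol :=
  PowerSeries.mk fun n => ∑ π ∈ legConfigs lam mu n,
    AddMonoidAlgebra.single (Lambda6 ε u lam mu π) (Z6 ε lam mu π)

/-! ### Radially ordered products -/

/-- The degree of the monomial `∏ p_{i+1}^{m_i}`, with `p_n` in degree `n`. -/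
def stateDegree (m : ℕ →₀ ℕ) : ℕ := m.sum fun i k => (i + 1) * k

/-- The monomials of degree `d`. -/
def states (d : ℕ) : Finset (ℕ →₀ ℕ) :=
  ((range d).finsupp fun _ => range (d + 1)).filter fun m => stateDegree m = d

theorem mem_states (d : ℕ) (m : ℕ →₀ ℕ) : m ∈ states d ↔ stateDegree m = d := by
  simp only [states, mem_filter, and_iff_right_iff_imp]
  intro h
  have hle : ∀ i ∈ m.support, (i + 1) * m i ≤ d := fun i hi => by
    rw [← h]
    exact Finset.single_le_sum (f := fun i => (i + 1) * m i) (fun _ _ => Nat.zero_le _) hi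
  rw [Finset.mem_finsupp_iff]
  refine ⟨fun i hi => ?_, fun i hi => ?_⟩
  · have h1 := hle i hi
    have h2 : 0 < m i := Nat.pos_of_ne_zero (Finsupp.mem_support_iff.1 hi)
    exact Finset.mem_range.2 (by nlinarith)
  · by_cases h0 : m i = 0
    · simp [h0]
    · have h1 := hle i (Finsupp.mem_support_iff.2 h0)
      exact Finset.mem_range.2 (by nlinarith)

/-- The component of degree `d` of an element of the completed Fock space. -/
def degreePart (d : ℕ) (f : FockHat) : Fock :=
  ∑ m ∈ states d, MvPolynomial.monomial m (MvPowerSeries.coeff m f)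

/-- Vectors with two formal parameters: `M n d` is the coefficient of `𝔮^n s^d`. -/
abbrev Vec : Type := ℕ → ℕ → FockHat

/-- Apply `T · s^{L₀}` to a vector, where `L₀` is the degree operator. -/
def applyOp (ε : Fin 4 → ℂ) (T : PowerSeries Symbol) (M : Vec) : Vec := fun n d =>
  ∑ i ∈ antidiagonal n, ∑ j ∈ antidiagonal d,
    symbolOp ε (PowerSeries.coeff i.1 T) (degreePart j.2 (M i.2 j.1))

/-- `T_{12}(x_{N-1}) s^{L₀} ⋯ T_{12}(x_1) s^{L₀} T_{12}(x_0) s^{L₀} v`, where `x_k = exp (y k)`.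
Up to the factor `s^{L₀}` on the right and on the left this is the product of the
`T_{12}(s^{-k} x_k)`, and an expansion in `s` is an expansion in the region
`|x_{N-1}| ≫ ⋯ ≫ |x_0|`. -/
def orderedProduct (ε : Fin 4 → ℂ) (y : ℕ → ℂ) (v : Fock) : ℕ → Vec
  | 0 => fun n d => if n = 0 ∧ d = 0 then (v : FockHat) else 0
  | N + 1 => applyOp ε (T4 ε (y N)) (orderedProduct ε y v N)

/-- The product of the first `N` factors, completed on the left by the vertex operator of the
remaining layers in their vacuum state, `:∏_{k ≥ N} X_{12}(x q_3^k): = W_{123}(x q_3^N)`. -/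
def completedProduct (ε : Fin 4 → ℂ) (u : ℂ) (y : ℕ → ℂ) (N : ℕ) (v : Fock) : Vec :=
  applyOp ε (PowerSeries.C (AddMonoidAlgebra.single (currentW ε (u + N * ε 2)) 1))
    (orderedProduct ε y v N)

/-! ### One-loop factors and analytic continuation -/

/-- The coefficient of degree `n` in the logarithm of the one-loop factor
`exp (-∑_{n>0} (1/n) P_{Sᶜ}^{[n]} P_{S'ᶜ}^{[-n]} / P_{1234}^{[n]} (x / x')^n)` of the contraction
of the highest weight at `x'` spanning the directions `S'` with the one at `x` spanning the
directions `S`, where `x = exp u` and `x' = exp u'`. -/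
def loopLog (ε : Fin 4 → ℂ) (S S' : Finset (Fin 4)) (u u' : ℂ) (n : ℕ) : ℂ :=
  -(1 / (n : ℂ)) * (P ε Sᶜ n * P ε S'ᶜ (-n) / P ε univ n) * Complex.exp (n * (u - u'))

/-- The series `∑_{n>0} c_n s^{r n}`. -/
def spread (r : ℕ) (c : ℕ → ℂ) : PowerSeries ℂ :=
  PowerSeries.mk fun m => if m ≠ 0 ∧ r ∣ m then c (m / r) else 0

/-- The one-loop factor of `completedProduct`: the product of the one-loop factors of all pairs
among the `N` layers `X_{12}(x_k)` and the tail `W_{123}(x q_3^N)`. -/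
def oneLoop (ε : Fin 4 → ℂ) (u : ℂ) (y : ℕ → ℂ) (N : ℕ) : PowerSeries ℂ :=
  (PowerSeries.exp ℂ).subst
    ((∑ j ∈ range N, ∑ i ∈ range j, spread (j - i) (loopLog ε {0, 1} {0, 1} (y i) (y j)))
      + ∑ i ∈ range N, spread (N - i) (loopLog ε {0, 1} {0, 1, 2} (y i) (u + N * ε 2)))

/-- `f` is the expansion at `s = 0` of a rational function of `s` that is regular at `s = 1` and
takes there the value `a`. -/
def ContinuesTo (f : PowerSeries ℂ) (a : ℂ) : Prop :=
  ∃ p r : Polynomial ℂ, r.eval 1 ≠ 0 ∧ (r : PowerSeries ℂ) * f = (p : PowerSeries ℂ) ∧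
    a = p.eval 1 / r.eval 1

/-- The infinite radially ordered product `⋯ T_{12}(x_2) T_{12}(x_1) T_{12}(x_0)`, where
`x_k = exp (y k)` is equal to `x q_3^k` for all large `k`, equals `T` up to the one-loop factors:
for each `n`, all matrix elements at order `𝔮^n` of the completed products of `N` factors, divided
by their one-loop factor and continued to `s = 1`, are those of `T` as soon as `N` is large. -/
def InfiniteProductEq (ε : Fin 4 → ℂ) (u : ℂ) (y : ℕ → ℂ) (T : PowerSeries Symbol) : Prop :=
  ∀ n : ℕ, ∃ N₀ : ℕ, ∀ N ≥ N₀, ∀ (v : Fock) (m : ℕ →₀ ℕ) (z : ℂ × ℂ),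
    ContinuesTo
      (PowerSeries.mk (fun d => MvPowerSeries.coeff m (completedProduct ε u y N v n d) z)
        * (oneLoop ε u y N)⁻¹)
      (MvPowerSeries.coeff m (symbolOp ε (PowerSeries.coeff n T) v) z)

end

end QQ

namespace QQ

open Finset

noncomputable section

/-! ### Exponentials of linear forms -/

section ExpLin

variable {A : Type*} [CommRing A] [Algebra ℂ A]

/-! Cut a plane partition with two legs into horizontal layers. At height `k` the legs occupy
everything outside a quadrant with corner `(μ_k, λᵀ_k)`, and the remaining boxes form a Young
diagram at that corner. A choice of one term in each D4 factor is therefore a sequence of Young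
diagrams. The claim is that the contractions between factors kill the sequences that do not stack
into a plane partition, and give the others the D6 weight.

Operators. A radially ordered product of normal ordered exponentials obeys Wick's theorem
(`generatingSeries_vertexChain`): it is a product of pairwise contractions, a zero-mode constant,
and an expression whose coefficients are polynomial in `s` and which becomes the normal ordered
product at `s = 1` (`coeff_vertexChain`). The work is to move `s ^ L₀` and a translation past an
exponential (`gradedTranslate_expLin`). This is done with differential equations, each series in the
modes being truncated modulo powers of `s`.

Contractions. The highest weight parts of two layers contract to the one-loop factor. What remains
is `∏ (1 - x⁻¹ s ^ r) ^ n_x` over the weights `x` of a character `pairChar`, or of the dual of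
`tailChar` for the contraction with the tail (`contraction_Lambda4`, `contraction_currentW`,
`hasLog_index`). For generic parameters only the trivial weight can give a zero or a pole at `s =
1`, so everything depends on its multiplicity (`continuesTo_vertexChain`).

Vanishing. This multiplicity is zero for the tail and for non-adjacent layers. For adjacent layers
it is `interlacing`, a sum of nonnegative terms which vanishes exactly when the upper layer rests on
the lower one (`interlacing_eq`, `interlacing_eq_zero_iff`). So all factors are regular at `s = 1`,
and a sequence that does not stack acquires a zero (`layeringWeight_eq_zero`).

Weights. For a stacked sequence all factors combine into the index of one character, after half of
the terms in the pairs and all tail terms are dualized. Dualizing changes an index by a signed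
determinant, which is `1` for pairs of layers and `q_4⁻¹` per box for the tail. The zero modes of
the tail supply exactly `q_4` per box (`layeringWeight_eq_reducedIndex`). The resulting character is
the D6 character, since `P_12 N = ∑_k (q_3^k - corner_k)` and the sum of the `q_3^k` telescopes
against the tail (`Z6_character_eq`). The same telescoping identifies the normal ordered
exponentials (`sum_layerExponent`), and `bijOn_fromLayers` matches stacked sequences with
configurations. -/

theorem isAddTorsionFree_of_algebra_complex (A : Type*) [CommRing A] [Algebra ℂ A] :
    IsAddTorsionFree A where
  nsmul_right_injective n hn a b hab := by
    have h : (n : ℂ) ≠ 0 := by exact_mod_cast hn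
    have key : ∀ a : A, a = (n : ℂ)⁻¹ • (n • a) := fun a => by
      rw [← Nat.cast_smul_eq_nsmul ℂ n a, smul_smul, inv_mul_cancel₀ h, one_smul]
    rw [key a, key b]
    exact congrArg _ hab

/-- The exponential of the linear form `∑ c_i p_{i+1}`. -/
def expLin (c : ℕ → A) : MvPowerSeries ℕ A :=
  fun m => m.prod fun i k => ((k.factorial : ℂ)⁻¹) • c i ^ k

theorem coeff_expLin (c : ℕ → A) (m : ℕ →₀ ℕ) :
    MvPowerSeries.coeff m (expLin c) = m.prod fun i k => ((k.factorial : ℂ)⁻¹) • c i ^ k := rfl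

theorem coeff_expLin_add_single (c : ℕ → A) (m : ℕ →₀ ℕ) (i : ℕ) :
    MvPowerSeries.coeff (m + Finsupp.single i 1) (expLin c) * ((m i : A) + 1)
      = c i * MvPowerSeries.coeff m (expLin c) := by
  rw [coeff_expLin, coeff_expLin, ← Finsupp.mul_prod_erase' m i _ (by simp),
    ← Finsupp.mul_prod_erase' (m + Finsupp.single i 1) i _ (by simp)]
  have he : (m + Finsupp.single i 1).erase i = m.erase i := by
    ext j; by_cases h : j = i <;> simp [h, Finsupp.erase]
  rw [he]
  have hf : (((m i + 1).factorial : ℂ)⁻¹) * ((m i : ℂ) + 1) = ((m i).factorial : ℂ)⁻¹ := by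
    have h1 : ((m i : ℂ) + 1) ≠ 0 := by exact_mod_cast Nat.succ_ne_zero (m i)
    have h2 : ((m i).factorial : ℂ) ≠ 0 := by exact_mod_cast Nat.factorial_ne_zero _
    rw [Nat.factorial_succ]; push_cast; field_simp
  have hc : ((m i : A) + 1) = algebraMap ℂ A ((m i : ℂ) + 1) := by simp
  simp only [Finsupp.add_apply, Finsupp.single_eq_same, hc, ← hf, Algebra.smul_def, map_mul,
    pow_succ]
  ring

theorem pderiv_expLin (c : ℕ → A) (i : ℕ) :
    MvPowerSeries.pderiv A i (expLin c) = MvPowerSeries.C (c i) * expLin c := by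
  ext m
  rw [MvPowerSeries.coeff_pderiv, MvPowerSeries.coeff_C_mul]
  simpa using coeff_expLin_add_single c m i

theorem constantCoeff_expLin (c : ℕ → A) : MvPowerSeries.constantCoeff (expLin c) = 1 := by
  rw [← MvPowerSeries.coeff_zero_eq_constantCoeff_apply, coeff_expLin, Finsupp.prod_zero_index]

/-- A power series over a torsion-free ring is determined by its partial derivatives and constant
term. Multiplying by the exponential of the opposite form turns each claim into the vanishing of all
derivatives of a product. -/
theorem expLin_add (c c' : ℕ → A) :
    expLin (c + c') = expLin c * expLin c' := by
  have := isAddTorsionFree_of_algebra_complex A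
  have key : ∀ c : ℕ → A, expLin (-c) * expLin c = 1 := fun c => by
    refine MvPowerSeries.pderiv.ext (fun i => ?_) (by simp [constantCoeff_expLin])
    simp [Derivation.leibniz, pderiv_expLin]; ring
  have h : expLin (-(c + c')) * (expLin c * expLin c') = 1 := by
    refine MvPowerSeries.pderiv.ext (fun i => ?_) (by simp [constantCoeff_expLin])
    simp [Derivation.leibniz, pderiv_expLin]; ring
  calc expLin (c + c') = expLin (c + c') * (expLin (-(c + c')) * (expLin c * expLin c')) := by
        rw [h, mul_one]
    _ = (expLin (-(c + c')) * expLin (c + c')) * (expLin c * expLin c') := by ring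
    _ = _ := by rw [key, one_mul]

/-- A solution of the differential equation of the exponential is a multiple of it. -/
theorem eq_C_mul_expLin (c : ℕ → A) (F : MvPowerSeries ℕ A)
    (h : ∀ i, MvPowerSeries.pderiv A i F = MvPowerSeries.C (c i) * F) :
    F = MvPowerSeries.C (MvPowerSeries.constantCoeff F) * expLin c := by
  have := isAddTorsionFree_of_algebra_complex A
  have h1 : F * expLin (-c) = MvPowerSeries.C (MvPowerSeries.constantCoeff F) := by
    refine MvPowerSeries.pderiv.ext (fun i => ?_) (by simp [constantCoeff_expLin])
    simp [Derivation.leibniz, pderiv_expLin, h]; ring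
  have h2 : expLin (-c) * expLin c = 1 := by
    rw [← expLin_add]
    refine MvPowerSeries.pderiv.ext (fun i => ?_) (by simp [constantCoeff_expLin])
    simp [pderiv_expLin]
  rw [← h1, mul_assoc, h2, mul_one]

theorem map_expLin {B : Type*} [CommRing B] [Algebra ℂ B] (f : A →ₐ[ℂ] B) (c : ℕ → A) :
    MvPowerSeries.map (f : A →+* B) (expLin c) = expLin fun i => f (c i) := by
  ext m
  simp [coeff_expLin, Finsupp.prod, map_prod]

end ExpLin

/-! ### Translations of polynomials -/

/-- The translation `p_{i+1} ↦ p_{i+1} + h_i`. -/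
def translate (h : ℕ → ℂ) : MvPolynomial ℕ ℂ →ₐ[ℂ] MvPolynomial ℕ ℂ :=
  MvPolynomial.aeval fun i => MvPolynomial.X i + MvPolynomial.C (h i)

/-- The matrix elements of a translation. -/
def translateCoeff (h : ℕ → ℂ) (m k : ℕ →₀ ℕ) : ℂ :=
  MvPolynomial.coeff m (translate h (MvPolynomial.monomial k 1))

theorem translate_monomial (h : ℕ → ℂ) (m : ℕ →₀ ℕ) (a : ℂ) :
    translate h (MvPolynomial.monomial m a)
      = MvPolynomial.C a * translate h (MvPolynomial.monomial m 1) := by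
  rw [← MvPolynomial.algebraMap_eq, ← Algebra.smul_def, ← map_smul, MvPolynomial.smul_monomial]
  simp

/-- The matrix form of `translate (p_i f) = (p_i + h_i) translate f`; it feeds
`gradedTranslate_X_mul`. -/
theorem translateCoeff_add_single (h : ℕ → ℂ) (m k : ℕ →₀ ℕ) (i : ℕ) :
    translateCoeff h m (k + Finsupp.single i 1)
      = (if i ∈ m.support then translateCoeff h (m - Finsupp.single i 1) k else 0)
        + h i * translateCoeff h m k := by
  have : MvPolynomial.monomial (k + Finsupp.single i 1) (1 : ℂ)
      = MvPolynomial.X i * MvPolynomial.monomial k 1 := by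
    rw [MvPolynomial.X, MvPolynomial.monomial_mul, add_comm, one_mul]
  rw [translateCoeff, this, map_mul]
  have hx : translate h (MvPolynomial.X i) = MvPolynomial.X i + MvPolynomial.C (h i) := by
    simp [translate]
  rw [hx, add_mul, MvPolynomial.coeff_add, MvPolynomial.coeff_X_mul', MvPolynomial.coeff_C_mul]
  rfl

theorem pderiv_translate (h : ℕ → ℂ) (i : ℕ) (p : MvPolynomial ℕ ℂ) :
    MvPolynomial.pderiv i (translate h p) = translate h (MvPolynomial.pderiv i p) := by
  induction p using MvPolynomial.induction_on with
  | C a => simp [translate]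
  | add p q hp hq => simp [hp, hq]
  | mul_X p j hp =>
    have hx : translate h (MvPolynomial.X j) = MvPolynomial.X j + MvPolynomial.C (h j) := by
      simp [translate]
    simp only [map_mul, Derivation.leibniz, hp, hx, map_add, MvPolynomial.pderiv_C, smul_eq_mul,
      MvPolynomial.pderiv_X, add_zero]
    by_cases hij : j = i
    · subst hij; simp
    · simp [Ne.symm hij]

/-- Translations commute with derivatives. The truncated subtraction on the right is harmless
because of the factor `k i`. -/
theorem translateCoeff_derivative (h : ℕ → ℂ) (m k : ℕ →₀ ℕ) (i : ℕ) :
    translateCoeff h (m + Finsupp.single i 1) k * ((m i : ℂ) + 1)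
      = k i * translateCoeff h m (k - Finsupp.single i 1) := by
  have h1 := congrArg (MvPolynomial.coeff m)
    (pderiv_translate h i (MvPolynomial.monomial k 1))
  rw [MvPolynomial.coeff_pderiv, MvPolynomial.pderiv_monomial, translate_monomial h _ (1 * _),
    MvPolynomial.coeff_C_mul, one_mul] at h1
  exact h1

theorem translateCoeff_zero_left (h : ℕ → ℂ) (k : ℕ →₀ ℕ) :
    translateCoeff h 0 k = k.prod fun i n => h i ^ n := by
  rw [translateCoeff, ← MvPolynomial.constantCoeff_eq, translate, MvPolynomial.aeval_monomial]
  simp [Finsupp.prod, map_prod]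

/-! ### Power series modulo `X ^ D` -/

/-- The states of degree less than `D`. -/
def statesBelow (D : ℕ) : Finset (ℕ →₀ ℕ) := (range D).biUnion states

theorem mem_statesBelow (D : ℕ) (m : ℕ →₀ ℕ) : m ∈ statesBelow D ↔ stateDegree m < D := by
  simp [statesBelow, mem_states]

theorem stateDegree_zero : stateDegree 0 = 0 := by simp [stateDegree]

theorem stateDegree_add (m k : ℕ →₀ ℕ) : stateDegree (m + k) = stateDegree m + stateDegree k :=
  Finsupp.sum_add_index' (by simp) (by intros; ring)

theorem stateDegree_single (i n : ℕ) : stateDegree (Finsupp.single i n) = (i + 1) * n := by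
  simp [stateDegree]

/-- Only states containing the mode `i` contribute, and removing one quantum of it lowers the degree
by `i + 1`. -/
theorem sum_statesBelow_shift {M : Type*} [AddCommMonoid M] (D i : ℕ) (G : (ℕ →₀ ℕ) → M)
    (hG : ∀ m, m i = 0 → G m = 0) :
    ∑ m ∈ statesBelow (D + (i + 1)), G m
      = ∑ m ∈ statesBelow D, G (m + Finsupp.single i 1) := by
  symm
  refine Finset.sum_of_injOn (fun m => m + Finsupp.single i 1)
    (fun a _ b _ h => add_right_cancel h) ?_ ?_ (fun _ _ => rfl)
  · intro m hm
    simp only [Finset.mem_coe, mem_statesBelow] at hm ⊢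
    rw [stateDegree_add, stateDegree_single]; omega
  · intro m hm hm'
    by_contra h0
    have hi : m i ≠ 0 := fun h => h0 (hG m h)
    apply hm'
    have hle : Finsupp.single i 1 ≤ m := by
      rw [Finsupp.single_le_iff]; omega
    refine ⟨m - Finsupp.single i 1, ?_, tsub_add_cancel_of_le hle⟩
    have := congrArg stateDegree (tsub_add_cancel_of_le hle)
    rw [stateDegree_add, stateDegree_single] at this
    simp only [Finset.mem_coe, mem_statesBelow] at hm ⊢
    omega

theorem eq_of_forall_X_pow_dvd {f g : PowerSeries ℂ}
    (h : ∀ D, (PowerSeries.X : PowerSeries ℂ) ^ D ∣ f - g) : f = g := by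
  ext d
  have := PowerSeries.X_pow_dvd_iff.1 (h (d + 1)) d (Nat.lt_succ_self d)
  rwa [map_sub, sub_eq_zero] at this
/-! ### Translations of power series, with the degree counted by `X` -/

/-- The composition of the degree operator `X ^ L₀` with the translation by `h`, on power series
with coefficients in `ℂ⟦X⟧`. -/
def gradedTranslate (h : ℕ → ℂ) (F : MvPowerSeries ℕ (PowerSeries ℂ)) :
    MvPowerSeries ℕ (PowerSeries ℂ) := fun m => PowerSeries.mk fun d =>
  ∑ p ∈ antidiagonal d, ∑ k ∈ states p.2,
    PowerSeries.coeff p.1 (MvPowerSeries.coeff k F) * translateCoeff h m k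

theorem coeff_gradedTranslate (h : ℕ → ℂ) (F : MvPowerSeries ℕ (PowerSeries ℂ)) (m : ℕ →₀ ℕ)
    (d : ℕ) : PowerSeries.coeff d (MvPowerSeries.coeff m (gradedTranslate h F))
      = ∑ p ∈ antidiagonal d, ∑ k ∈ states p.2,
        PowerSeries.coeff p.1 (MvPowerSeries.coeff k F) * translateCoeff h m k :=
  PowerSeries.coeff_mk (R := ℂ) d fun d => ∑ p ∈ antidiagonal d, ∑ k ∈ states p.2,
    PowerSeries.coeff p.1 (MvPowerSeries.coeff k F) * translateCoeff h m k

/-- `gradedTranslate` modulo `X ^ D`. -/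
def gradedTranslateBelow (D : ℕ) (h : ℕ → ℂ) (F : MvPowerSeries ℕ (PowerSeries ℂ))
    (m : ℕ →₀ ℕ) : PowerSeries ℂ :=
  ∑ k ∈ statesBelow D, PowerSeries.X ^ stateDegree k
    * (PowerSeries.C (translateCoeff h m k) * MvPowerSeries.coeff k F)

theorem sum_statesBelow {M : Type*} [AddCommMonoid M] (D : ℕ) (G : (ℕ →₀ ℕ) → M) :
    ∑ k ∈ statesBelow D, G k = ∑ b ∈ range D, ∑ k ∈ states b, G k := by
  rw [statesBelow, Finset.sum_biUnion]
  intro a _ b _ hab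
  rw [Function.onFun, Finset.disjoint_left]
  intro k hk hk'
  rw [mem_states] at hk hk'
  exact hab (hk.symm.trans hk')

/-- A state of degree at least `D` enters with a factor `X ^ D`. Modulo `X ^ D` the infinite matrix
product is thus a finite sum, which can be manipulated freely. -/
theorem gradedTranslate_congr (D : ℕ) (h : ℕ → ℂ) (F : MvPowerSeries ℕ (PowerSeries ℂ))
    (m : ℕ →₀ ℕ) : (PowerSeries.X : PowerSeries ℂ) ^ D ∣
      MvPowerSeries.coeff m (gradedTranslate h F) - gradedTranslateBelow D h F m := by
  rw [PowerSeries.X_pow_dvd_iff]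
  intro d hd
  rw [map_sub, sub_eq_zero]
  rw [coeff_gradedTranslate, gradedTranslateBelow, sum_statesBelow, map_sum,
    ← Finset.Nat.sum_antidiagonal_swap, Finset.Nat.sum_antidiagonal_eq_sum_range_succ_mk]
  have hsub : range d.succ ⊆ range D := fun b hb => by
    rw [Finset.mem_range] at hb ⊢; omega
  rw [← Finset.sum_subset hsub]
  · refine Finset.sum_congr rfl fun b hb => ?_
    rw [map_sum]
    refine Finset.sum_congr rfl fun k hk => ?_
    rw [mem_states] at hk
    rw [PowerSeries.coeff_X_pow_mul', hk, if_pos (by rw [Finset.mem_range] at hb; omega),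
      PowerSeries.coeff_C_mul]
    exact mul_comm _ _
  · intro b _ hb
    rw [map_sum]
    refine Finset.sum_eq_zero fun k hk => ?_
    rw [mem_states] at hk
    rw [PowerSeries.coeff_X_pow_mul', hk, if_neg (by rw [Finset.mem_range] at hb; omega)]

/-- Identities for `gradedTranslate` may be checked modulo all powers of `X`. -/
theorem gradedTranslate_coeff_eq (h : ℕ → ℂ) (F : MvPowerSeries ℕ (PowerSeries ℂ))
    (m : ℕ →₀ ℕ) (f : PowerSeries ℂ)
    (hf : ∀ D, (PowerSeries.X : PowerSeries ℂ) ^ D ∣ gradedTranslateBelow D h F m - f) :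
    MvPowerSeries.coeff m (gradedTranslate h F) = f := by
  refine eq_of_forall_X_pow_dvd fun D => ?_
  have := dvd_add (gradedTranslate_congr D h F m) (hf D)
  rwa [sub_add_sub_cancel] at this

theorem gradedTranslate_add (h : ℕ → ℂ) (F G : MvPowerSeries ℕ (PowerSeries ℂ)) :
    gradedTranslate h (F + G) = gradedTranslate h F + gradedTranslate h G := by
  ext1 m
  refine gradedTranslate_coeff_eq h _ m _ fun D => ?_
  have := dvd_add (gradedTranslate_congr D h F m) (gradedTranslate_congr D h G m)
  rw [← dvd_neg] at this
  convert this using 1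
  simp only [gradedTranslateBelow, map_add, mul_add, Finset.sum_add_distrib]
  ring

theorem gradedTranslate_C_mul (h : ℕ → ℂ) (a : PowerSeries ℂ)
    (F : MvPowerSeries ℕ (PowerSeries ℂ)) :
    gradedTranslate h (MvPowerSeries.C a * F) = MvPowerSeries.C a * gradedTranslate h F := by
  ext1 m
  refine gradedTranslate_coeff_eq h _ m _ fun D => ?_
  have := (gradedTranslate_congr D h F m).mul_left a
  rw [← dvd_neg] at this
  convert this using 1
  simp only [gradedTranslateBelow, MvPowerSeries.coeff_C_mul, mul_sub, neg_sub, Finset.mul_sum]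
  congr 1
  exact Finset.sum_congr rfl fun k _ => by ring

theorem coeff_X_mul_eq {A : Type*} [CommRing A] (i : ℕ) (F : MvPowerSeries ℕ A) (m : ℕ →₀ ℕ) :
    MvPowerSeries.coeff m (MvPowerSeries.X i * F)
      = if i ∈ m.support then MvPowerSeries.coeff (m - Finsupp.single i 1) F else 0 := by
  rw [MvPowerSeries.X, MvPowerSeries.coeff_monomial_mul]
  have : Finsupp.single i 1 ≤ m ↔ i ∈ m.support := by
    rw [Finsupp.single_le_iff, Finsupp.mem_support_iff]; omega
  simp [this]

/-- The degree operator moves past `p_{i+1}` at the cost of `X ^ (i + 1)`, and the translation then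
adds `h i`. Truncating at `D + (i + 1)` on the left matches truncation at `D` on the right. -/
theorem gradedTranslate_X_mul (h : ℕ → ℂ) (i : ℕ) (F : MvPowerSeries ℕ (PowerSeries ℂ)) :
    gradedTranslate h (MvPowerSeries.X i * F)
      = MvPowerSeries.C (PowerSeries.X ^ (i + 1))
        * ((MvPowerSeries.X i + MvPowerSeries.C (PowerSeries.C (h i))) * gradedTranslate h F) := by
  ext1 m
  refine eq_of_forall_X_pow_dvd fun D => ?_
  have h0 := gradedTranslate_congr (D + (i + 1)) h (MvPowerSeries.X i * F) m
  have h1 := gradedTranslate_congr D h F m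
  have h2 : (PowerSeries.X : PowerSeries ℂ) ^ D ∣
      MvPowerSeries.coeff m (MvPowerSeries.X i * gradedTranslate h F)
        - if i ∈ m.support then gradedTranslateBelow D h F (m - Finsupp.single i 1) else 0 := by
    rw [coeff_X_mul_eq]
    split_ifs
    · exact gradedTranslate_congr D h F _
    · simp
  have h3 := (pow_dvd_pow (PowerSeries.X : PowerSeries ℂ) (Nat.le_add_right D (i + 1))).trans h0
  have h4 := ((h1.mul_left (PowerSeries.C (h i))).add h2).mul_left
    ((PowerSeries.X : PowerSeries ℂ) ^ (i + 1))
  have key : gradedTranslateBelow (D + (i + 1)) h (MvPowerSeries.X i * F) m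
      = PowerSeries.X ^ (i + 1) * (PowerSeries.C (h i) * gradedTranslateBelow D h F m
        + if i ∈ m.support then gradedTranslateBelow D h F (m - Finsupp.single i 1) else 0) := by
    rw [gradedTranslateBelow, sum_statesBelow_shift]
    · have : (if i ∈ m.support then gradedTranslateBelow D h F (m - Finsupp.single i 1) else 0)
          = ∑ k ∈ statesBelow D, PowerSeries.X ^ stateDegree k * (PowerSeries.C
            (if i ∈ m.support then translateCoeff h (m - Finsupp.single i 1) k else 0)
              * MvPowerSeries.coeff k F) := by
        split_ifs
        · rfl
        · simp
      rw [this, gradedTranslateBelow, Finset.mul_sum, ← Finset.sum_add_distrib, Finset.mul_sum]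
      refine Finset.sum_congr rfl fun k _ => ?_
      rw [coeff_X_mul_eq, if_pos (by simp), add_tsub_cancel_right, translateCoeff_add_single,
        stateDegree_add, stateDegree_single, map_add, map_mul, mul_one, pow_add]
      ring
    · intro k hk
      rw [coeff_X_mul_eq, if_neg (by simp [hk])]; simp
  have h5 := dvd_sub h3 h4
  convert h5 using 1
  rw [key, MvPowerSeries.coeff_C_mul, add_mul, map_add, MvPowerSeries.coeff_C_mul]
  ring

/-- The derivative commutes with the translation and picks up `X ^ (i + 1)` from the degree
operator. This transports the differential equation of an exponential through `gradedTranslate`. -/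
theorem pderiv_gradedTranslate (h : ℕ → ℂ) (i : ℕ) (F : MvPowerSeries ℕ (PowerSeries ℂ)) :
    MvPowerSeries.pderiv (PowerSeries ℂ) i (gradedTranslate h F)
      = MvPowerSeries.C (PowerSeries.X ^ (i + 1))
        * gradedTranslate h (MvPowerSeries.pderiv (PowerSeries ℂ) i F) := by
  ext1 m
  refine eq_of_forall_X_pow_dvd fun D => ?_
  rw [MvPowerSeries.coeff_pderiv, MvPowerSeries.coeff_C_mul]
  have h0 := (pow_dvd_pow (PowerSeries.X : PowerSeries ℂ) (Nat.le_add_right D (i + 1))).trans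
    (gradedTranslate_congr (D + (i + 1)) h F (m + Finsupp.single i 1))
  have h1 := gradedTranslate_congr D h (MvPowerSeries.pderiv (PowerSeries ℂ) i F) m
  have key : gradedTranslateBelow (D + (i + 1)) h F (m + Finsupp.single i 1)
        * ((m i : PowerSeries ℂ) + 1)
      = PowerSeries.X ^ (i + 1)
        * gradedTranslateBelow D h (MvPowerSeries.pderiv (PowerSeries ℂ) i F) m := by
    have hc : ((m i : PowerSeries ℂ) + 1) = PowerSeries.C ((m i : ℂ) + 1) := by simp
    have : gradedTranslateBelow (D + (i + 1)) h F (m + Finsupp.single i 1)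
        * ((m i : PowerSeries ℂ) + 1)
        = ∑ k ∈ statesBelow (D + (i + 1)), PowerSeries.X ^ stateDegree k
          * (PowerSeries.C (k i * translateCoeff h m (k - Finsupp.single i 1))
            * MvPowerSeries.coeff k F) := by
      rw [gradedTranslateBelow, Finset.sum_mul]
      refine Finset.sum_congr rfl fun k _ => ?_
      rw [← translateCoeff_derivative, hc, map_mul]; ring
    rw [this, sum_statesBelow_shift]
    · rw [gradedTranslateBelow, Finset.mul_sum]
      refine Finset.sum_congr rfl fun k _ => ?_
      rw [MvPowerSeries.coeff_pderiv, stateDegree_add, stateDegree_single, add_tsub_cancel_right,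
        mul_one, pow_add, map_mul]
      simp
      ring
    · intro k hk
      simp [hk]
  have h5 := dvd_sub (h0.mul_right ((m i : PowerSeries ℂ) + 1))
    (h1.mul_left (PowerSeries.X ^ (i + 1)))
  convert h5 using 1
  rw [mul_sub, ← key]
  ring

/-! ### Logarithms of power series -/

/-- `f = exp g`, expressed by the differential equation of the exponential. -/
def HasLog (f g : PowerSeries ℂ) : Prop :=
  PowerSeries.constantCoeff f = 1 ∧
    PowerSeries.derivative ℂ f = PowerSeries.derivative ℂ g * f

theorem HasLog.one : HasLog 1 0 := ⟨by simp, by simp⟩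

theorem HasLog.mul {f g f' g' : PowerSeries ℂ} (h : HasLog f g) (h' : HasLog f' g') :
    HasLog (f * f') (g + g') := by
  refine ⟨by simp [h.1, h'.1], ?_⟩
  rw [Derivation.leibniz, h.2, h'.2, map_add, smul_eq_mul, smul_eq_mul]; ring

theorem HasLog.pow {f g : PowerSeries ℂ} (h : HasLog f g) (n : ℕ) :
    HasLog (f ^ n) ((n : ℂ) • g) := by
  induction n with
  | zero => simpa using HasLog.one
  | succ n ih =>
    rw [pow_succ, Nat.cast_succ, add_smul, one_smul]
    exact ih.mul h

theorem HasLog.prod {ι : Type*} (s : Finset ι) (f g : ι → PowerSeries ℂ)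
    (h : ∀ i ∈ s, HasLog (f i) (g i)) : HasLog (∏ i ∈ s, f i) (∑ i ∈ s, g i) := by
  classical
  induction s using Finset.induction_on with
  | empty => simpa using HasLog.one
  | insert a s ha ih =>
    rw [Finset.prod_insert ha, Finset.sum_insert ha]
    exact (h a (Finset.mem_insert_self _ _)).mul
      (ih fun i hi => h i (Finset.mem_insert_of_mem hi))

/-- The logarithmic derivative of `f / f'` vanishes and its constant term is `1`. All later
identities between contractions are comparisons of logarithms through this lemma. -/
theorem HasLog.unique {f f' g : PowerSeries ℂ} (h : HasLog f g) (h' : HasLog f' g) : f = f' := by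
  have hc : PowerSeries.constantCoeff f' ≠ 0 := by rw [h'.1]; exact one_ne_zero
  have h1 : f * f'⁻¹ = 1 := by
    refine PowerSeries.derivative.ext ?_ (by simp [h.1, h'.1])
    rw [Derivation.leibniz, PowerSeries.derivative_inv', h.2, h'.2, Derivation.map_one_eq_zero]
    have := PowerSeries.mul_inv_cancel f' hc
    simp only [smul_eq_mul]
    linear_combination (-f * f'⁻¹ * PowerSeries.derivative ℂ g) * this
  calc f = f * (f' * f'⁻¹) := by rw [PowerSeries.mul_inv_cancel f' hc, mul_one]
    _ = f' * (f * f'⁻¹) := by ring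
    _ = f' := by rw [h1, mul_one]

theorem hasLog_exp_subst {g : PowerSeries ℂ} (hg : PowerSeries.constantCoeff g = 0) :
    HasLog ((PowerSeries.exp ℂ).subst g) g := by
  have hs : PowerSeries.HasSubst g := PowerSeries.HasSubst.of_constantCoeff_zero' hg
  refine ⟨?_, ?_⟩
  · rw [← PowerSeries.coeff_zero_eq_constantCoeff_apply, PowerSeries.coeff_subst' hs,
      finsum_eq_single _ 0]
    · simp
    · intro n hn
      simp [hg, hn]
  · rw [PowerSeries.derivative_subst hs, PowerSeries.derivative_exp, mul_comm]
/-! ### The translation of an exponential -/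

/-- The sum of a family of power series with `X ^ (i + 1) ∣ f i`. -/
def familySum (f : ℕ → PowerSeries ℂ) : PowerSeries ℂ :=
  PowerSeries.mk fun d => ∑ i ∈ range d, PowerSeries.coeff d (f i)

theorem derivative_prod {ι : Type*} [DecidableEq ι] (s : Finset ι) (g : ι → PowerSeries ℂ) :
    PowerSeries.derivative ℂ (∏ i ∈ s, g i)
      = ∑ i ∈ s, PowerSeries.derivative ℂ (g i) * ∏ j ∈ s.erase i, g j := by
  induction s using Finset.induction_on with
  | empty => simp
  | insert a s ha ih =>
    rw [Finset.prod_insert ha, Finset.sum_insert ha, Finset.erase_insert ha, Derivation.leibniz, ih,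
      smul_eq_mul, smul_eq_mul, add_comm, mul_comm (∏ i ∈ s, g i), Finset.mul_sum]
    congr 1
    refine Finset.sum_congr rfl fun i hi => ?_
    have hne : i ≠ a := fun h => ha (h ▸ hi)
    rw [Finset.erase_insert_of_ne hne.symm, Finset.prod_insert (by simp [ha])]
    ring

theorem mem_range_of_stateDegree_lt {m : ℕ →₀ ℕ} {D : ℕ} (h : stateDegree m < D) {i : ℕ}
    (hi : i ∈ m.support) : i ∈ range D := by
  have h1 : (i + 1) * m i ≤ stateDegree m :=
    Finset.single_le_sum (f := fun i => (i + 1) * m i) (fun _ _ => Nat.zero_le _) hi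
  have h2 : 0 < m i := Nat.pos_of_ne_zero (Finsupp.mem_support_iff.1 hi)
  rw [Finset.mem_range]
  nlinarith

/-- The divided power `f ^ k / k!` has derivative `f' f ^ (k - 1) / (k - 1)!`. The range `D` serves
all states of degree below `D` at once. -/
theorem derivative_coeff_expLin (f : ℕ → PowerSeries ℂ) (D : ℕ) (m : ℕ →₀ ℕ)
    (hm : stateDegree m < D) :
    PowerSeries.derivative ℂ (MvPowerSeries.coeff m (expLin f))
      = ∑ i ∈ range D, if m i = 0 then 0 else PowerSeries.derivative ℂ (f i)
          * MvPowerSeries.coeff (m - Finsupp.single i 1) (expLin f) := by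
  have hprod : ∀ k : ℕ →₀ ℕ, k.support ⊆ range D → MvPowerSeries.coeff k (expLin f)
      = ∏ i ∈ range D, (((k i).factorial : ℂ)⁻¹) • f i ^ k i := fun k hk => by
    rw [coeff_expLin, Finsupp.prod_of_support_subset _ hk _ (by simp)]
  have hsup : m.support ⊆ range D := fun i hi => mem_range_of_stateDegree_lt hm hi
  rw [hprod m hsup, derivative_prod]
  refine Finset.sum_congr rfl fun i hi => ?_
  split_ifs with h0
  · simp [h0]
  · rw [hprod (m - Finsupp.single i 1) (Finsupp.support_tsub.trans hsup),
      ← Finset.mul_prod_erase _ _ hi]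
    have he : ∏ j ∈ (range D).erase i, ((((m - Finsupp.single i 1 : ℕ →₀ ℕ) j).factorial : ℂ)⁻¹)
          • f j ^ (m - Finsupp.single i 1 : ℕ →₀ ℕ) j
        = ∏ j ∈ (range D).erase i, (((m j).factorial : ℂ)⁻¹) • f j ^ m j := by
      refine Finset.prod_congr rfl fun j hj => ?_
      have : (m - Finsupp.single i 1 : ℕ →₀ ℕ) j = m j := by
        simp [(Finset.ne_of_mem_erase hj).symm]
      rw [this]
    rw [he, ← mul_assoc]
    congr 1
    obtain ⟨n, hn⟩ := Nat.exists_eq_succ_of_ne_zero h0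
    simp only [Finsupp.tsub_apply, Finsupp.single_eq_same, hn, Nat.succ_sub_one,
      Derivation.map_smul, PowerSeries.derivative_pow, Nat.succ_eq_add_one]
    have h1 : ((n : ℂ) + 1) ≠ 0 := by exact_mod_cast Nat.succ_ne_zero n
    have h2 : (n.factorial : ℂ) ≠ 0 := by exact_mod_cast Nat.factorial_ne_zero n
    have h3 : (((n + 1).factorial : ℂ)⁻¹) * ((n : ℂ) + 1) = (n.factorial : ℂ)⁻¹ := by
      rw [Nat.factorial_succ]; push_cast; field_simp
    have hc : (((n + 1 : ℕ) : PowerSeries ℂ)) = PowerSeries.C ((n : ℂ) + 1) := by simp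
    rw [← h3, hc, PowerSeries.smul_eq_C_mul, PowerSeries.smul_eq_C_mul, map_mul]
    ring

theorem X_pow_dvd_derivative {f : PowerSeries ℂ} {D : ℕ}
    (h : (PowerSeries.X : PowerSeries ℂ) ^ (D + 1) ∣ f) :
    (PowerSeries.X : PowerSeries ℂ) ^ D ∣ PowerSeries.derivative ℂ f := by
  rw [PowerSeries.X_pow_dvd_iff] at h ⊢
  intro d hd
  rw [PowerSeries.coeff_derivative, h _ (by omega), zero_mul]

/-- Summing all coefficients of `∏ exp (f_i p_{i+1})` amounts to setting every variable to `1`,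
which gives `exp (∑ f_i)`. The divisibility of `f i` makes both sums converge in the `X`-adic
topology. -/
theorem hasLog_of_expLin (f : ℕ → PowerSeries ℂ)
    (hf : ∀ i, (PowerSeries.X : PowerSeries ℂ) ^ (i + 1) ∣ f i) (Z : PowerSeries ℂ)
    (hZ : ∀ D, (PowerSeries.X : PowerSeries ℂ) ^ D ∣
      Z - ∑ k ∈ statesBelow D, MvPowerSeries.coeff k (expLin f)) :
    HasLog Z (familySum f) := by
  have hconst : PowerSeries.constantCoeff Z = 1 := by
    have h1 := PowerSeries.X_pow_dvd_iff.1 (hZ 1) 0 one_pos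
    have h2 : statesBelow 1 = {0} := by
      ext m
      rw [mem_statesBelow, Finset.mem_singleton]
      refine ⟨fun h => ?_, fun h => by simp [h, stateDegree_zero]⟩
      by_contra h0
      obtain ⟨i, hi⟩ := Finsupp.support_nonempty_iff.2 h0
      have := Finset.mem_range.1 (mem_range_of_stateDegree_lt (Nat.lt_succ_self _) hi)
      have h3 : (i + 1) * m i ≤ stateDegree m :=
        Finset.single_le_sum (f := fun i => (i + 1) * m i) (fun _ _ => Nat.zero_le _) hi
      have h4 : 0 < m i := Nat.pos_of_ne_zero (Finsupp.mem_support_iff.1 hi)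
      nlinarith
    rw [h2, Finset.sum_singleton, MvPowerSeries.coeff_zero_eq_constantCoeff_apply,
      constantCoeff_expLin, map_sub, sub_eq_zero] at h1
    simpa using h1
  refine ⟨hconst, eq_of_forall_X_pow_dvd fun D => ?_⟩
  have h1 := X_pow_dvd_derivative (hZ (D + 1))
  rw [map_sub] at h1
  have h2 : PowerSeries.derivative ℂ
        (∑ k ∈ statesBelow (D + 1), MvPowerSeries.coeff k (expLin f))
      = ∑ i ∈ range (D + 1), PowerSeries.derivative ℂ (f i)
          * ∑ k ∈ statesBelow (D - i), MvPowerSeries.coeff k (expLin f) := by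
    rw [map_sum, Finset.sum_congr rfl fun k hk =>
      derivative_coeff_expLin f (D + 1) k ((mem_statesBelow _ _).1 hk), Finset.sum_comm]
    refine Finset.sum_congr rfl fun i hi => ?_
    have hD : D + 1 = (D - i) + (i + 1) := by
      have := Finset.mem_range.1 hi; omega
    rw [hD, sum_statesBelow_shift _ _ _ (fun m hm => by simp [hm]), Finset.mul_sum]
    exact Finset.sum_congr rfl fun k _ => by simp
  -- The shift of states leaves the inner sum with precision only `X ^ (D - i)`; the derivative of
  -- `f i` supplies the missing `X ^ i`.
  have h3 : (PowerSeries.X : PowerSeries ℂ) ^ D ∣ ∑ i ∈ range (D + 1),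
      PowerSeries.derivative ℂ (f i)
        * (Z - ∑ k ∈ statesBelow (D - i), MvPowerSeries.coeff k (expLin f)) := by
    refine Finset.dvd_sum fun i hi => ?_
    have := mul_dvd_mul (X_pow_dvd_derivative (hf i)) (hZ (D - i))
    rwa [← pow_add, Nat.add_sub_cancel' (by have := Finset.mem_range.1 hi; omega)] at this
  have h4 : (PowerSeries.X : PowerSeries ℂ) ^ D ∣ PowerSeries.derivative ℂ (familySum f)
      - ∑ i ∈ range (D + 1), PowerSeries.derivative ℂ (f i) := by
    rw [← map_sum, ← map_sub]
    refine X_pow_dvd_derivative ?_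
    rw [PowerSeries.X_pow_dvd_iff]
    intro d hd
    rw [map_sub, familySum, PowerSeries.coeff_mk, map_sum, sub_eq_zero]
    refine Finset.sum_subset (fun i hi => ?_) fun i _ hi => ?_
    · rw [Finset.mem_range] at hi ⊢; omega
    · exact PowerSeries.X_pow_dvd_iff.1 (hf i) d (by rw [Finset.mem_range] at hi; omega)
  have h5 := dvd_sub (dvd_sub h1 h3) (h4.mul_right Z)
  convert h5 using 1
  rw [h2]
  simp only [mul_sub, Finset.sum_sub_distrib, ← Finset.sum_mul]
  ring

/-- The translation of an exponential is a multiple of an exponential. -/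
theorem gradedTranslate_expLin (h : ℕ → ℂ) (c : ℕ → PowerSeries ℂ) :
    ∃ Z, HasLog Z (familySum fun i => PowerSeries.C (h i) * (PowerSeries.X ^ (i + 1) * c i)) ∧
      gradedTranslate h (expLin c)
        = MvPowerSeries.C Z * expLin fun i => PowerSeries.X ^ (i + 1) * c i := by
  -- The differential equation determines the result up to its constant term. That term is the
  -- damped exponential evaluated at the point `h`, hence again an exponential.
  refine ⟨_, ?_, eq_C_mul_expLin _ _ fun i => ?_⟩
  · refine hasLog_of_expLin _ (fun i => ((dvd_mul_right _ _).mul_left _)) _ fun D => ?_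
    have := gradedTranslate_congr D h (expLin c) 0
    rw [MvPowerSeries.coeff_zero_eq_constantCoeff_apply] at this
    convert this using 2
    refine Finset.sum_congr rfl fun k _ => ?_
    rw [translateCoeff_zero_left, coeff_expLin, coeff_expLin, stateDegree]
    simp only [Finsupp.prod, Finsupp.sum, map_prod, ← Finset.prod_pow_eq_pow_sum,
      ← Finset.prod_mul_distrib]
    refine Finset.prod_congr rfl fun i _ => ?_
    simp only [PowerSeries.smul_eq_C_mul, mul_pow, map_pow, pow_mul]
    ring
  · rw [pderiv_gradedTranslate, pderiv_expLin, gradedTranslate_C_mul, map_mul, mul_assoc]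
/-! ### Radially ordered products of normal ordered exponentials -/

/-- The coefficients of the creation modes. -/
def creationCoeff (e : Exponent) (i : ℕ) : ℂ := e.1 (-((i : ℤ) + 1))

/-- The translation performed by the annihilation modes. -/
def annihilationShift (ε : Fin 4 → ℂ) (e : Exponent) (i : ℕ) : ℂ :=
  e.1 ((i : ℤ) + 1) * heis ε ((i : ℤ) + 1)

/-- The exponent of the zero mode factor of the creation half. -/
def zeroModePairing (e : Exponent) (z : ℂ × ℂ) : ℂ := e.2 0 * z.1 + e.2 1 * z.2

/-- The translation of the zero modes. -/
def zeroModeVector (e : Exponent) : ℂ × ℂ := (e.2 2, e.2 3)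

/-- Evaluation of functions of the zero modes. -/
abbrev evalZeroMode (z : ℂ × ℂ) : ZeroModeFun →+* ℂ := Pi.evalRingHom (fun _ : ℂ × ℂ => ℂ) z

theorem map_evalZeroMode_annihilationPart (ε : Fin 4 → ℂ) (e : Exponent) (v : Fock)
    (z : ℂ × ℂ) : MvPolynomial.map (evalZeroMode z) (annihilationPart ε e v)
      = translate (annihilationShift ε e)
        (MvPolynomial.map (evalZeroMode (z + zeroModeVector e)) v) := by
  induction v using MvPolynomial.induction_on with
  | C a =>
    simp [annihilationPart, translate, zeroModeShift, zeroModeVector]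
    rfl
  | add p q hp hq => simp only [map_add, hp, hq]
  | mul_X p i hp =>
    rw [map_mul, map_mul, hp, map_mul, map_mul]
    congr 1
    simp [annihilationPart, translate, annihilationShift]

theorem map_evalZeroMode_creationPart (e : Exponent) (z : ℂ × ℂ) :
    MvPowerSeries.map (evalZeroMode z) (creationPart e)
      = MvPowerSeries.C (Complex.exp (zeroModePairing e z)) * expLin (creationCoeff e) := by
  ext m
  rw [MvPowerSeries.coeff_map, MvPowerSeries.coeff_C_mul, coeff_expLin]
  change Complex.exp _ * m.prod _ = Complex.exp _ * m.prod _
  congr 1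
  refine Finset.prod_congr rfl fun i _ => ?_
  simp only [creationCoeff, smul_eq_mul, div_eq_inv_mul]

theorem map_evalZeroMode_coe (v : Fock) (z : ℂ × ℂ) :
    MvPowerSeries.map (evalZeroMode z) (v : FockHat)
      = (MvPolynomial.map (evalZeroMode z) v : MvPolynomial ℕ ℂ) := by
  ext m
  rw [MvPowerSeries.coeff_map, MvPolynomial.coeff_coe, MvPolynomial.coeff_coe,
    MvPolynomial.coeff_map]

theorem map_evalZeroMode_vertexOp (ε : Fin 4 → ℂ) (e : Exponent) (v : Fock) (z : ℂ × ℂ) :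
    MvPowerSeries.map (evalZeroMode z) (vertexOp ε e v)
      = MvPowerSeries.C (Complex.exp (zeroModePairing e z)) * expLin (creationCoeff e)
        * ((translate (annihilationShift ε e) (MvPolynomial.map
          (evalZeroMode (z + zeroModeVector e)) v) : MvPolynomial ℕ ℂ) : MvPowerSeries ℕ ℂ) := by
  rw [vertexOp, map_mul, map_evalZeroMode_creationPart, map_evalZeroMode_coe,
    map_evalZeroMode_annihilationPart]

/-- The product of the normal ordered exponentials with exponents `e (N - 1), …, e 0`, each
followed by `s ^ L₀`; the argument is the power of `s`. -/
def vertexChain (ε : Fin 4 → ℂ) (e : ℕ → Exponent) (v : Fock) : ℕ → ℕ → FockHat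
  | 0 => fun d => if d = 0 then (v : FockHat) else 0
  | N + 1 => fun d => ∑ j ∈ antidiagonal d,
      vertexOp ε (e N) (degreePart j.2 (vertexChain ε e v N j.1))

/-- The generating series in `s` of a sequence of vectors, at a given point of the space of zero
modes. -/
def generatingSeries (M : ℕ → FockHat) (z : ℂ × ℂ) : MvPowerSeries ℕ (PowerSeries ℂ) :=
  fun m => PowerSeries.mk fun d => MvPowerSeries.coeff m (M d) z

theorem coeff_generatingSeries (M : ℕ → FockHat) (z : ℂ × ℂ) (m : ℕ →₀ ℕ) :
    MvPowerSeries.coeff m (generatingSeries M z)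
      = PowerSeries.mk fun d => MvPowerSeries.coeff m (M d) z := rfl

theorem coeff_C_coeff_mul (E : MvPowerSeries ℕ ℂ) (G : MvPowerSeries ℕ (PowerSeries ℂ))
    (m : ℕ →₀ ℕ) (d : ℕ) :
    PowerSeries.coeff d (MvPowerSeries.coeff m
        (MvPowerSeries.map (PowerSeries.C : ℂ →+* PowerSeries ℂ) E * G))
      = ∑ p ∈ antidiagonal m, MvPowerSeries.coeff p.1 E
        * PowerSeries.coeff d (MvPowerSeries.coeff p.2 G) := by
  rw [MvPowerSeries.coeff_mul, map_sum]
  refine Finset.sum_congr rfl fun p _ => ?_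
  rw [MvPowerSeries.coeff_map, PowerSeries.coeff_C_mul]

theorem map_C_expLin (c : ℕ → ℂ) :
    MvPowerSeries.map (PowerSeries.C : ℂ →+* PowerSeries ℂ) (expLin c)
      = expLin fun i => PowerSeries.C (c i) := by
  have := map_expLin (Algebra.ofId ℂ (PowerSeries ℂ)) c
  exact this

theorem translate_map_degreePart (h : ℕ → ℂ) (z : ℂ × ℂ) (b : ℕ) (f : FockHat) (m : ℕ →₀ ℕ) :
    MvPolynomial.coeff m (translate h (MvPolynomial.map (evalZeroMode z) (degreePart b f)))
      = ∑ k ∈ states b, MvPowerSeries.coeff k f z * translateCoeff h m k := by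
  rw [degreePart, map_sum, map_sum, MvPolynomial.coeff_sum]
  refine Finset.sum_congr rfl fun k _ => ?_
  rw [MvPolynomial.map_monomial, translate_monomial, MvPolynomial.coeff_C_mul]
  rfl

/-- Evaluating at a point of the zero-mode space reduces one more operator to oscillators alone. The
price is that the remaining chain is evaluated at the translated point. -/
theorem generatingSeries_vertexChain_succ (ε : Fin 4 → ℂ) (e : ℕ → Exponent) (v : Fock) (N : ℕ)
    (z : ℂ × ℂ) : generatingSeries (vertexChain ε e v (N + 1)) z
      = MvPowerSeries.C (PowerSeries.C (Complex.exp (zeroModePairing (e N) z)))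
        * (expLin (fun i => PowerSeries.C (creationCoeff (e N) i))
          * gradedTranslate (annihilationShift ε (e N))
            (generatingSeries (vertexChain ε e v N) (z + zeroModeVector (e N)))) := by
  ext m d
  rw [MvPowerSeries.coeff_C_mul, PowerSeries.coeff_C_mul, ← map_C_expLin, coeff_C_coeff_mul,
    coeff_generatingSeries, PowerSeries.coeff_mk, vertexChain, map_sum, Finset.sum_apply]
  have h1 : ∀ j : ℕ × ℕ, MvPowerSeries.coeff m
        (vertexOp ε (e N) (degreePart j.2 (vertexChain ε e v N j.1))) z
      = Complex.exp (zeroModePairing (e N) z) * ∑ p ∈ antidiagonal m,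
        MvPowerSeries.coeff p.1 (expLin (creationCoeff (e N))) *
          ∑ k ∈ states j.2, MvPowerSeries.coeff k (vertexChain ε e v N j.1)
            (z + zeroModeVector (e N)) * translateCoeff (annihilationShift ε (e N)) p.2 k := by
    intro j
    have := congrArg (MvPowerSeries.coeff m) (map_evalZeroMode_vertexOp ε (e N)
      (degreePart j.2 (vertexChain ε e v N j.1)) z)
    rw [MvPowerSeries.coeff_map, mul_assoc, MvPowerSeries.coeff_C_mul,
      MvPowerSeries.coeff_mul] at this
    refine this.trans ?_
    congr 1
    refine Finset.sum_congr rfl fun p _ => ?_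
    rw [MvPolynomial.coeff_coe, translate_map_degreePart]
  simp only [h1, coeff_gradedTranslate, coeff_generatingSeries, PowerSeries.coeff_mk]
  rw [← Finset.mul_sum, Finset.sum_comm]
  congr 1
  refine Finset.sum_congr rfl fun p _ => ?_
  rw [Finset.mul_sum]

/-! ### The closed formula for radially ordered products -/

section Closed

variable {A : Type*} [CommRing A] [Algebra ℂ A]

/-- The creation modes of a radially ordered product. -/
def chainCreation (s : A) (e : ℕ → Exponent) : ℕ → ℕ → A
  | 0 => 0
  | N + 1 => fun i => algebraMap ℂ A (creationCoeff (e N) i) + s ^ (i + 1) * chainCreation s e N i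

/-- The annihilation modes of a radially ordered product. -/
def chainAnnihilation (ε : Fin 4 → ℂ) (s : A) (e : ℕ → Exponent) (N i : ℕ) : A :=
  ∑ k ∈ range N, s ^ ((k + 1) * (i + 1)) * algebraMap ℂ A (annihilationShift ε (e k) i)

/-- The action of the annihilation half of a radially ordered product. -/
def chainTranslate (ε : Fin 4 → ℂ) (s : A) (e : ℕ → Exponent) (N : ℕ) :
    MvPolynomial ℕ ℂ →+* MvPowerSeries ℕ A :=
  MvPolynomial.eval₂Hom (MvPowerSeries.C.comp (algebraMap ℂ A)) fun i =>
    MvPowerSeries.C (s ^ (N * (i + 1))) * MvPowerSeries.X i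
      + MvPowerSeries.C (chainAnnihilation ε s e N i)

theorem chainCreation_succ (s : A) (e : ℕ → Exponent) (N i : ℕ) :
    chainCreation s e (N + 1) i
      = algebraMap ℂ A (creationCoeff (e N) i) + s ^ (i + 1) * chainCreation s e N i := rfl

/-- Naturality in the base ring lets one closed formula over `ℂ[X]` be read both as a power series
in `s` and as its value at `s = 1`. -/
theorem map_chainCreation {B : Type*} [CommRing B] [Algebra ℂ B] (f : A →ₐ[ℂ] B) (s : A)
    (e : ℕ → Exponent) (N i : ℕ) :
    f (chainCreation s e N i) = chainCreation (f s) e N i := by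
  induction N with
  | zero => simp [chainCreation]
  | succ N ih => simp [chainCreation, ih]

theorem map_chainTranslate {B : Type*} [CommRing B] [Algebra ℂ B] (f : A →ₐ[ℂ] B)
    (ε : Fin 4 → ℂ) (s : A) (e : ℕ → Exponent) (N : ℕ) (w : MvPolynomial ℕ ℂ) :
    MvPowerSeries.map (f : A →+* B) (chainTranslate ε s e N w) = chainTranslate ε (f s) e N w := by
  induction w using MvPolynomial.induction_on with
  | C a => simp [chainTranslate]
  | add p q hp hq => simp only [map_add, hp, hq]
  | mul_X p i hp =>
    rw [map_mul, map_mul, hp, map_mul]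
    congr 1
    simp [chainTranslate, chainAnnihilation]

/-- Without damping the modes of the factors simply add, as they do in the normal ordered product.
-/
theorem chainCreation_one (e : ℕ → Exponent) (N i : ℕ) :
    chainCreation (1 : ℂ) e N i = creationCoeff (∑ k ∈ range N, e k) i := by
  induction N with
  | zero => simp [chainCreation, creationCoeff]
  | succ N ih =>
    rw [Finset.sum_range_succ, chainCreation_succ, ih]
    simp [creationCoeff, add_comm]

theorem chainAnnihilation_one (ε : Fin 4 → ℂ) (e : ℕ → Exponent) (N i : ℕ) :
    chainAnnihilation ε (1 : ℂ) e N i = annihilationShift ε (∑ k ∈ range N, e k) i := by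
  simp [chainAnnihilation, annihilationShift, Prod.fst_sum, Finset.sum_mul]

theorem chainTranslate_one (ε : Fin 4 → ℂ) (e : ℕ → Exponent) (N : ℕ) (w : MvPolynomial ℕ ℂ) :
    chainTranslate ε (1 : ℂ) e N w
      = (translate (annihilationShift ε (∑ k ∈ range N, e k)) w : MvPolynomial ℕ ℂ) := by
  induction w using MvPolynomial.induction_on with
  | C a => simp [chainTranslate, translate]
  | add p q hp hq => simp only [map_add, hp, hq, MvPolynomial.coe_add]
  | mul_X p i hp =>
    rw [map_mul, hp, map_mul, MvPolynomial.coe_mul]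
    congr 1
    simp [chainTranslate, chainAnnihilation_one, translate]

end Closed

/-- The state is moved through the new operator one variable at a time. The spectator `F` is kept
arbitrary so that it can absorb the remaining variables in the induction. -/
theorem gradedTranslate_chainTranslate_mul (ε : Fin 4 → ℂ) (e : ℕ → Exponent) (N : ℕ)
    (w : MvPolynomial ℕ ℂ) (F : MvPowerSeries ℕ (PowerSeries ℂ)) :
    gradedTranslate (annihilationShift ε (e N)) (chainTranslate ε PowerSeries.X e N w * F)
      = chainTranslate ε PowerSeries.X e (N + 1) w
        * gradedTranslate (annihilationShift ε (e N)) F := by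
  induction w using MvPolynomial.induction_on generalizing F with
  | C a => simp [chainTranslate, gradedTranslate_C_mul]
  | add p q hp hq => simp only [map_add, add_mul, gradedTranslate_add, hp, hq]
  | mul_X p i hp =>
    rw [map_mul, map_mul, mul_assoc, hp, mul_assoc]
    congr 1
    have hX : ∀ N, chainTranslate ε (PowerSeries.X : PowerSeries ℂ) e N (MvPolynomial.X i)
        = MvPowerSeries.C (PowerSeries.X ^ (N * (i + 1))) * MvPowerSeries.X i
          + MvPowerSeries.C (chainAnnihilation ε PowerSeries.X e N i) := fun N => by
      simp [chainTranslate]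
    have hs : chainAnnihilation ε (PowerSeries.X : PowerSeries ℂ) e (N + 1) i
        = chainAnnihilation ε PowerSeries.X e N i
          + PowerSeries.X ^ ((N + 1) * (i + 1)) * PowerSeries.C (annihilationShift ε (e N) i) :=
      Finset.sum_range_succ _ _
    rw [hX, hX, add_mul, gradedTranslate_add, gradedTranslate_C_mul, mul_assoc,
      gradedTranslate_C_mul, gradedTranslate_X_mul, hs]
    simp only [map_add, map_mul, map_pow]
    ring

/-- Unrolls the Horner recursion: the creation modes of operator `k` meet `N - k` factors `s ^ L₀`
before operator `N` acts. This is the power of `s` in their contraction. -/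
theorem X_pow_mul_chainCreation (e : ℕ → Exponent) (N i : ℕ) :
    (PowerSeries.X : PowerSeries ℂ) ^ (i + 1) * chainCreation PowerSeries.X e N i
      = ∑ k ∈ range N, PowerSeries.X ^ ((N - k) * (i + 1))
        * PowerSeries.C (creationCoeff (e k) i) := by
  induction N with
  | zero => simp [chainCreation]
  | succ N ih =>
    rw [chainCreation_succ, mul_add, mul_left_comm, ih, Finset.sum_range_succ, Finset.mul_sum, add_comm]
    congr 1
    · refine Finset.sum_congr rfl fun k hk => ?_
      have : N + 1 - k = (N - k) + 1 := by
        have := Finset.mem_range.1 hk; omega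
      rw [this]; ring
    · simp

theorem familySum_X_pow (r : ℕ) (hr : 0 < r) (c : ℕ → ℂ) :
    familySum (fun i => PowerSeries.X ^ (r * (i + 1)) * PowerSeries.C (c (i + 1)))
      = spread r c := by
  ext d
  rw [familySum, PowerSeries.coeff_mk, spread, PowerSeries.coeff_mk]
  have hco : ∀ i, PowerSeries.coeff d (PowerSeries.X ^ (r * (i + 1)) * PowerSeries.C (c (i + 1)))
      = if d = r * (i + 1) then c (i + 1) else 0 := fun i => by
    rw [PowerSeries.coeff_mul_C, PowerSeries.coeff_X_pow, ite_mul, one_mul, zero_mul]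
  simp only [hco]
  split_ifs with h
  · obtain ⟨h0, n, rfl⟩ := h
    obtain ⟨n, rfl⟩ := Nat.exists_eq_succ_of_ne_zero (show n ≠ 0 by rintro rfl; simp at h0)
    rw [Finset.sum_eq_single n]
    · rw [if_pos rfl, Nat.mul_div_cancel_left _ hr]
    · intro i _ hi
      rw [if_neg]
      intro h
      have := Nat.eq_of_mul_eq_mul_left hr h
      omega
    · intro hn
      exfalso; apply hn
      rw [Finset.mem_range]
      nlinarith
  · refine Finset.sum_eq_zero fun i _ => if_neg fun hd => h ⟨?_, ?_⟩
    · rw [hd]; positivity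
    · exact ⟨_, hd⟩

theorem familySum_sum {ι : Type*} (s : Finset ι) (f : ι → ℕ → PowerSeries ℂ) :
    familySum (fun i => ∑ k ∈ s, f k i) = ∑ k ∈ s, familySum (f k) := by
  ext d
  rw [map_sum, familySum, PowerSeries.coeff_mk]
  simp only [map_sum, familySum, PowerSeries.coeff_mk]
  exact Finset.sum_comm

/-- The coefficient of degree `n` in the logarithm of the contraction of two exponentials. -/
def contraction (ε : Fin 4 → ℂ) (e e' : Exponent) (n : ℕ) : ℂ :=
  heis ε n * (e.1 n * e'.1 (-n))

/-- The exponent of the factor by which zero modes fail to be normal ordered. -/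
def zeroModeCross (e : ℕ → Exponent) (N : ℕ) : ℂ :=
  ∑ j ∈ range N, zeroModePairing (∑ i ∈ range j, e i) (zeroModeVector (e j))

theorem zeroModePairing_add_right (e : Exponent) (z z' : ℂ × ℂ) :
    zeroModePairing e (z + z') = zeroModePairing e z + zeroModePairing e z' := by
  simp [zeroModePairing]; ring

theorem zeroModePairing_add_left (e e' : Exponent) (z : ℂ × ℂ) :
    zeroModePairing (e + e') z = zeroModePairing e z + zeroModePairing e' z := by
  simp [zeroModePairing]; ring

theorem zeroModeVector_add (e e' : Exponent) :
    zeroModeVector (e + e') = zeroModeVector e + zeroModeVector e' := rfl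

/-- Wick's theorem, by induction on the number of factors. The annihilation half of the new factor
passes the accumulated creation exponential and yields one contraction with each earlier factor; its
zero-mode translation yields one more term of `zeroModeCross`. The factor `K` is chosen before the
state and the point `z`. -/
theorem generatingSeries_vertexChain (ε : Fin 4 → ℂ) (e : ℕ → Exponent) (N : ℕ) :
    ∃ K, HasLog K (∑ j ∈ range N, ∑ i ∈ range j, spread (j - i) (contraction ε (e j) (e i))) ∧
      ∀ v z, generatingSeries (vertexChain ε e v N) z
        = MvPowerSeries.C (K * PowerSeries.C (Complex.exp
            (zeroModePairing (∑ k ∈ range N, e k) z + zeroModeCross e N)))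
          * (chainTranslate ε PowerSeries.X e N (MvPolynomial.map
              (evalZeroMode (z + zeroModeVector (∑ k ∈ range N, e k))) v)
            * expLin (chainCreation PowerSeries.X e N)) := by
  induction N with
  | zero =>
    refine ⟨1, by simpa using HasLog.one, fun v z => ?_⟩
    have h0 : expLin (chainCreation (PowerSeries.X : PowerSeries ℂ) e 0) = 1 := by
      refine MvPowerSeries.ext fun m => ?_
      rw [coeff_expLin, MvPowerSeries.coeff_one]
      split_ifs with h
      · simp [h]
      · obtain ⟨i, hi⟩ := Finsupp.support_nonempty_iff.2 h
        refine Finset.prod_eq_zero hi ?_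
        simp [chainCreation, Finsupp.mem_support_iff.1 hi]
    have h1 : ∀ w : MvPolynomial ℕ ℂ, chainTranslate ε (PowerSeries.X : PowerSeries ℂ) e 0 w
        = MvPowerSeries.map PowerSeries.C (w : MvPowerSeries ℕ ℂ) := fun w => by
      induction w using MvPolynomial.induction_on with
      | C a => simp [chainTranslate]
      | add p q hp hq => simp only [map_add, hp, hq, MvPolynomial.coe_add]
      | mul_X p i hp =>
        rw [map_mul, hp, MvPolynomial.coe_mul, map_mul]
        congr 1
        simp [chainTranslate, chainAnnihilation]
    rw [h0, h1]
    ext m d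
    rw [coeff_generatingSeries, PowerSeries.coeff_mk]
    simp only [zeroModeCross, zeroModePairing, Finset.range_zero, Finset.sum_empty, Prod.snd_zero,
      Pi.zero_apply, zero_mul, add_zero, Complex.exp_zero, map_one, mul_one, one_mul,
      MvPowerSeries.coeff_map, MvPolynomial.coeff_coe, MvPolynomial.coeff_map, vertexChain,
      PowerSeries.coeff_C]
    split_ifs <;> simp [zeroModeVector, Prod.mk_zero_zero]
  | succ N ih =>
    obtain ⟨K, hK, h⟩ := ih
    obtain ⟨Z, hZ, hZ'⟩ := gradedTranslate_expLin (annihilationShift ε (e N))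
      (chainCreation PowerSeries.X e N)
    have hlog : (familySum fun i => PowerSeries.C (annihilationShift ε (e N) i)
          * (PowerSeries.X ^ (i + 1) * chainCreation PowerSeries.X e N i))
        = ∑ i ∈ range N, spread (N - i) (contraction ε (e N) (e i)) := by
      have : ∀ k ∈ range N, spread (N - k) (contraction ε (e N) (e k))
          = familySum fun i => PowerSeries.C (annihilationShift ε (e N) i)
            * (PowerSeries.X ^ ((N - k) * (i + 1)) * PowerSeries.C (creationCoeff (e k) i)) := by
        intro k hk
        rw [← familySum_X_pow _ (by have := Finset.mem_range.1 hk; omega)]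
        congr 1
        funext i
        simp only [contraction, annihilationShift, creationCoeff, Nat.cast_succ, map_mul]
        ring
      rw [Finset.sum_congr rfl this, ← familySum_sum]
      congr 1
      funext i
      rw [X_pow_mul_chainCreation, Finset.mul_sum]
    refine ⟨K * Z, ?_, fun v z => ?_⟩
    · rw [Finset.sum_range_succ, ← hlog]
      exact hK.mul hZ
    · rw [generatingSeries_vertexChain_succ, h, gradedTranslate_C_mul,
        gradedTranslate_chainTranslate_mul, hZ']
      have h1 : expLin (chainCreation (PowerSeries.X : PowerSeries ℂ) e (N + 1))
          = expLin (fun i => PowerSeries.C (creationCoeff (e N) i))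
            * expLin fun i => PowerSeries.X ^ (i + 1) * chainCreation PowerSeries.X e N i :=
        expLin_add _ _
      have h2 : zeroModePairing (∑ k ∈ range (N + 1), e k) z + zeroModeCross e (N + 1)
          = zeroModePairing (e N) z + (zeroModePairing (∑ k ∈ range N, e k)
            (z + zeroModeVector (e N)) + zeroModeCross e N) := by
        rw [zeroModeCross, Finset.sum_range_succ, Finset.sum_range_succ, ← zeroModeCross,
          zeroModePairing_add_left, zeroModePairing_add_right]
        ring
      have h3 : z + zeroModeVector (∑ k ∈ range (N + 1), e k)
          = z + zeroModeVector (e N) + zeroModeVector (∑ k ∈ range N, e k) := by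
        rw [Finset.sum_range_succ, zeroModeVector_add]; ring
      rw [h1, h2, h3, Complex.exp_add (zeroModePairing (e N) z)]
      simp only [map_mul]
      ring

/-- Matrix elements of a radially ordered product: the product of the contractions, the zero mode
factor, and a polynomial in `s` which interpolates to the normal ordered product. -/
theorem coeff_vertexChain (ε : Fin 4 → ℂ) (e : ℕ → Exponent) (N : ℕ) :
    ∃ K, HasLog K (∑ j ∈ range N, ∑ i ∈ range j, spread (j - i) (contraction ε (e j) (e i))) ∧
      ∀ v m z, ∃ q : Polynomial ℂ,
        PowerSeries.mk (fun d => MvPowerSeries.coeff m (vertexChain ε e v N d) z)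
          = K * PowerSeries.C (Complex.exp (zeroModeCross e N)) * (q : PowerSeries ℂ) ∧
        q.eval 1 = MvPowerSeries.coeff m (vertexOp ε (∑ k ∈ range N, e k) v) z := by
  obtain ⟨K, hK, h⟩ := generatingSeries_vertexChain ε e N
  refine ⟨K, hK, fun v m z => ?_⟩
  set w := MvPolynomial.map (evalZeroMode (z + zeroModeVector (∑ k ∈ range N, e k))) v with hw
  set a := Complex.exp (zeroModePairing (∑ k ∈ range N, e k) z) with ha
  set q := MvPowerSeries.coeff m (chainTranslate ε (Polynomial.X : Polynomial ℂ) e N w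
    * expLin (chainCreation (Polynomial.X : Polynomial ℂ) e N)) with hq
  -- Each coefficient of the closed formula is a finite algebraic expression in `s`, so it exists
  -- over `ℂ[X]`; it is specialized below to `ℂ⟦X⟧` and to `s = 1`.
  have hmap : ∀ {B : Type} [CommRing B] [Algebra ℂ B] (f : Polynomial ℂ →ₐ[ℂ] B), f q
      = MvPowerSeries.coeff m (chainTranslate ε (f Polynomial.X) e N w
        * expLin (chainCreation (f Polynomial.X) e N)) := by
    intro B _ _ f
    have h1 : (fun i => f (chainCreation Polynomial.X e N i))
        = chainCreation (f Polynomial.X) e N := funext fun i => map_chainCreation f _ e N i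
    rw [← h1, ← map_expLin, ← map_chainTranslate, ← map_mul, MvPowerSeries.coeff_map]
    rfl
  refine ⟨Polynomial.C a * q, ?_, ?_⟩
  · have h1 := congrArg (MvPowerSeries.coeff m) (h v z)
    rw [coeff_generatingSeries, MvPowerSeries.coeff_C_mul] at h1
    have h2 := hmap (Polynomial.coeToPowerSeries.algHom (R := ℂ) ℂ)
    simp only [Polynomial.coeToPowerSeries.algHom_apply, Algebra.algebraMap_self,
      PowerSeries.map_id, Polynomial.coe_X, id_eq] at h2
    rw [h1, ← h2, Complex.exp_add, ← ha, map_mul, Polynomial.coe_mul, Polynomial.coe_C]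
    ring
  · have h1 := congrArg (MvPowerSeries.coeff m) (map_evalZeroMode_vertexOp ε
      (∑ k ∈ range N, e k) v z)
    rw [MvPowerSeries.coeff_map] at h1
    refine Eq.trans ?_ h1.symm
    have h2 := hmap (Polynomial.aeval (1 : ℂ))
    rw [Polynomial.aeval_X, chainTranslate_one] at h2
    have h3 : chainCreation (1 : ℂ) e N = creationCoeff (∑ k ∈ range N, e k) :=
      funext fun i => chainCreation_one e N i
    rw [h3, Polynomial.coe_aeval_eq_eval] at h2
    rw [Polynomial.eval_mul, Polynomial.eval_C, h2, mul_assoc, MvPowerSeries.coeff_C_mul, mul_comm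
      (expLin _)]
/-! ### Expansion of the products of qq-characters -/

theorem mem_youngDiagrams (n : ℕ) (rho : YoungDiagram) :
    rho ∈ youngDiagrams n ↔ rho.card = n := by
  simp [youngDiagrams]

open Classical in
/-- The sequences of Young diagrams with `n` boxes in total which are empty from the index `N`
on. -/
def layerings : ℕ → ℕ → Finset (ℕ → YoungDiagram)
  | 0 => fun n => if n = 0 then {fun _ => ⊥} else ∅
  | N + 1 => fun n => ((antidiagonal n).sigma fun i =>
      youngDiagrams i.1 ×ˢ layerings N i.2).image fun p => Function.update p.2.2 N p.2.1

theorem mem_layerings (N n : ℕ) (rho : ℕ → YoungDiagram) :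
    rho ∈ layerings N n ↔ (∀ k, N ≤ k → rho k = ⊥) ∧ ∑ k ∈ range N, (rho k).card = n := by
  classical
  induction N generalizing n rho with
  | zero =>
    simp only [layerings]
    split_ifs with h
    · rw [Finset.mem_singleton]
      exact ⟨fun hr => by simp [hr, h], fun hr => funext fun k => hr.1 k (Nat.zero_le k)⟩
    · simp [Ne.symm h]
  | succ N ih =>
    rw [layerings, Finset.mem_image]
    constructor
    · rintro ⟨⟨⟨a, b⟩, lam, sig⟩, hp, rfl⟩
      simp only [Finset.mem_sigma, Finset.mem_product, HasAntidiagonal.mem_antidiagonal, ih,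
        mem_youngDiagrams] at hp
      obtain ⟨hab, hl, hs, hn⟩ := hp
      refine ⟨fun k hk => ?_, ?_⟩
      · rw [Function.update_of_ne (by omega)]
        exact hs k (by omega)
      · rw [Finset.sum_range_succ, Function.update_self, hl, ← hab, ← hn, add_comm]
        congr 1
        refine Finset.sum_congr rfl fun k hk => ?_
        rw [Function.update_of_ne (Finset.mem_range.1 hk).ne]
    · rintro ⟨hs, hn⟩
      refine ⟨⟨((rho N).card, ∑ k ∈ range N, (rho k).card), rho N,
        Function.update rho N ⊥⟩, ?_, ?_⟩
      · simp only [Finset.mem_sigma, Finset.mem_product, HasAntidiagonal.mem_antidiagonal, ih,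
          mem_youngDiagrams, true_and]
        refine ⟨by rw [← hn, Finset.sum_range_succ, add_comm], fun k hk => ?_, ?_⟩
        · rcases hk.eq_or_lt with rfl | hk
          · rw [Function.update_self]
          · rw [Function.update_of_ne hk.ne']; exact hs k hk
        · refine Finset.sum_congr rfl fun k hk => ?_
          rw [Function.update_of_ne (Finset.mem_range.1 hk).ne]
      · simp

theorem sum_layerings_succ {M : Type*} [AddCommMonoid M] (N n : ℕ)
    (f : (ℕ → YoungDiagram) → M) :
    ∑ rho ∈ layerings (N + 1) n, f rho = ∑ i ∈ antidiagonal n, ∑ lam ∈ youngDiagrams i.1,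
      ∑ rho ∈ layerings N i.2, f (Function.update rho N lam) := by
  classical
  rw [layerings, Finset.sum_image]
  · rw [Finset.sum_sigma]
    exact Finset.sum_congr rfl fun i _ => Finset.sum_product _ _ _
  · rintro ⟨⟨a, b⟩, lam, sig⟩ hp ⟨⟨a', b'⟩, lam', sig'⟩ hp' h
    simp only [Finset.mem_coe, Finset.mem_sigma, Finset.mem_product, HasAntidiagonal.mem_antidiagonal,
      mem_layerings, mem_youngDiagrams] at hp hp'
    obtain ⟨hab, hl, hs, hn⟩ := hp
    obtain ⟨hab', hl', hs', hn'⟩ := hp'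
    dsimp only at h
    have h1 : lam = lam' := by simpa using congrFun h N
    subst h1
    -- Both lower sequences are empty at index `N`, so overwriting that entry lost no information.
    have h2 : sig = sig' := by
      funext k
      by_cases hk : k = N
      · rw [hk, hs N le_rfl, hs' N le_rfl]
      · simpa [hk] using congrFun h k
    subst h2
    obtain rfl : a = a' := by rw [← hl, ← hl']
    obtain rfl : b = b' := by rw [← hn, ← hn']
    rfl

/-- The scalars of the completed Fock space. -/
def scalar (c : ℂ) : FockHat := MvPowerSeries.C fun _ => c

theorem scalar_mul (c c' : ℂ) : scalar (c * c') = scalar c * scalar c' := by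
  rw [scalar, scalar, scalar, ← map_mul]; rfl

theorem scalar_one : scalar 1 = 1 := map_one MvPowerSeries.C

theorem coeff_scalar_mul (c : ℂ) (F : FockHat) (m : ℕ →₀ ℕ) (z : ℂ × ℂ) :
    MvPowerSeries.coeff m (scalar c * F) z = c * MvPowerSeries.coeff m F z := by
  rw [scalar, MvPowerSeries.coeff_C_mul]; rfl

theorem symbolOp_sum_single {ι : Type*} (ε : Fin 4 → ℂ) (s : Finset ι) (e : ι → Exponent)
    (c : ι → ℂ) (v : Fock) :
    symbolOp ε (∑ i ∈ s, AddMonoidAlgebra.single (e i) (c i)) v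
      = ∑ i ∈ s, scalar (c i) * vertexOp ε (e i) v := by
  classical
  have h0 : ∀ e : Exponent, (MvPowerSeries.C fun _ => 0 : FockHat) * vertexOp ε e v = 0 :=
    fun e => by
      have : (fun _ => 0 : ZeroModeFun) = 0 := rfl
      rw [this, map_zero, zero_mul]
  induction s using Finset.induction_on with
  | empty => simp [symbolOp]
  | insert a s ha ih =>
    rw [Finset.sum_insert ha, Finset.sum_insert ha, ← ih, symbolOp, AddMonoidAlgebra.coeff_add,
      Finsupp.sum_add_index']
    · rw [AddMonoidAlgebra.coeff_single, Finsupp.sum_single_index (h0 _)]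
      rfl
    · exact h0
    · intro e b b'
      rw [← add_mul, ← map_add]; rfl

theorem degreePart_sum {ι : Type*} (b : ℕ) (s : Finset ι) (F : ι → FockHat) :
    degreePart b (∑ i ∈ s, F i) = ∑ i ∈ s, degreePart b (F i) := by
  simp only [degreePart, map_sum]
  exact Finset.sum_comm

theorem degreePart_scalar_mul (b : ℕ) (c : ℂ) (F : FockHat) :
    degreePart b (scalar c * F) = MvPolynomial.C (fun _ => c) * degreePart b F := by
  simp only [degreePart, scalar, MvPowerSeries.coeff_C_mul, Finset.mul_sum,
    MvPolynomial.C_mul_monomial]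

theorem vertexOp_sum {ι : Type*} (ε : Fin 4 → ℂ) (e : Exponent) (s : Finset ι) (v : ι → Fock) :
    vertexOp ε e (∑ i ∈ s, v i) = ∑ i ∈ s, vertexOp ε e (v i) := by
  rw [vertexOp, map_sum, ← MvPolynomial.coeToMvPowerSeries.ringHom_apply, map_sum, Finset.mul_sum]
  rfl

theorem vertexOp_C_mul (ε : Fin 4 → ℂ) (e : Exponent) (c : ℂ) (v : Fock) :
    vertexOp ε e (MvPolynomial.C (fun _ => c) * v) = scalar c * vertexOp ε e v := by
  have : annihilationPart ε e (MvPolynomial.C fun _ => c) = MvPolynomial.C fun _ => c := by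
    rw [annihilationPart, MvPolynomial.coe_eval₂Hom, MvPolynomial.eval₂_C]; rfl
  rw [vertexOp, vertexOp, map_mul, this, MvPolynomial.coe_mul, MvPolynomial.coe_C, scalar]
  ring

theorem vertexChain_congr (ε : Fin 4 → ℂ) (e e' : ℕ → Exponent) (v : Fock) (N : ℕ)
    (h : ∀ k < N, e k = e' k) : vertexChain ε e v N = vertexChain ε e' v N := by
  induction N with
  | zero => rfl
  | succ N ih =>
    funext d
    rw [vertexChain, vertexChain, ih fun k hk => h k (by omega), h N (by omega)]

theorem vertexOp_degreePart_sum {ι : Type*} (ε : Fin 4 → ℂ) (e : Exponent) (b : ℕ)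
    (s : Finset ι) (c : ι → ℂ) (F : ι → FockHat) :
    vertexOp ε e (degreePart b (∑ i ∈ s, scalar (c i) * F i))
      = ∑ i ∈ s, scalar (c i) * vertexOp ε e (degreePart b (F i)) := by
  rw [degreePart_sum, vertexOp_sum]
  exact Finset.sum_congr rfl fun i _ => by rw [degreePart_scalar_mul, vertexOp_C_mul]

/-- Multilinearity: choosing one term in every factor is choosing a sequence of diagrams. It reduces
the theorem to chains of single exponentials. -/
theorem orderedProduct_eq (ε : Fin 4 → ℂ) (y : ℕ → ℂ) (v : Fock) (N n d : ℕ) :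
    orderedProduct ε y v N n d = ∑ rho ∈ layerings N n, scalar (∏ k ∈ range N, Z4 ε (rho k))
      * vertexChain ε (fun k => Lambda4 ε (y k) (rho k)) v N d := by
  induction N generalizing n d with
  | zero =>
    rw [orderedProduct, layerings]
    by_cases hn : n = 0
    · simp [hn, vertexChain, scalar_one]
    · simp [hn]
  | succ N ih =>
    rw [orderedProduct, applyOp, sum_layerings_succ]
    refine Finset.sum_congr rfl fun i _ => ?_
    rw [T4, PowerSeries.coeff_mk]
    simp only [symbolOp_sum_single, ih, vertexOp_degreePart_sum]
    rw [Finset.sum_comm]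
    refine Finset.sum_congr rfl fun lam _ => ?_
    simp only [Finset.mul_sum]
    rw [Finset.sum_comm]
    refine Finset.sum_congr rfl fun rho _ => ?_
    have hne : ∀ k ∈ range N, Function.update rho N lam k = rho k := fun k hk =>
      Function.update_of_ne (Finset.mem_range.1 hk).ne _ _
    have hprod : ∏ k ∈ range N, Z4 ε (Function.update rho N lam k)
        = ∏ k ∈ range N, Z4 ε (rho k) :=
      Finset.prod_congr rfl fun k hk => by rw [hne k hk]
    have hchain : vertexChain ε (fun k => Lambda4 ε (y k) (Function.update rho N lam k)) v N
        = vertexChain ε (fun k => Lambda4 ε (y k) (rho k)) v N :=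
      vertexChain_congr _ _ _ _ _ fun k hk => by rw [hne k (Finset.mem_range.2 hk)]
    rw [Finset.prod_range_succ, Function.update_self, hprod, vertexChain, Finset.mul_sum, hchain]
    refine Finset.sum_congr rfl fun j _ => ?_
    rw [Function.update_self, mul_comm (∏ k ∈ range N, _), scalar_mul]
    ring

/-- The exponents of the factors of `completedProduct` for a sequence of Young diagrams. -/
def layerExponent (ε : Fin 4 → ℂ) (u : ℂ) (y : ℕ → ℂ) (N : ℕ) (rho : ℕ → YoungDiagram) (k : ℕ) :
    Exponent :=
  if k < N then Lambda4 ε (y k) (rho k) else currentW ε (u + N * ε 2)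

theorem completedProduct_eq (ε : Fin 4 → ℂ) (u : ℂ) (y : ℕ → ℂ) (v : Fock) (N n d : ℕ) :
    completedProduct ε u y N v n d
      = ∑ rho ∈ layerings N n, scalar (∏ k ∈ range N, Z4 ε (rho k))
        * vertexChain ε (layerExponent ε u y N rho) v (N + 1) d := by
  -- The tail operator is constant in `𝔮`, so only its coefficient of order zero contributes.
  rw [completedProduct, applyOp, Finset.sum_eq_single (0, n)]
  · have h1 : ∀ w, symbolOp ε (PowerSeries.coeff (0, n).1
          (PowerSeries.C (AddMonoidAlgebra.single (currentW ε (u + N * ε 2)) 1))) w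
        = vertexOp ε (currentW ε (u + N * ε 2)) w := fun w => by
      have := symbolOp_sum_single ε {()} (fun _ => currentW ε (u + N * ε 2)) (fun _ => 1) w
      simpa [scalar_one] using this
    simp only [h1, orderedProduct_eq, vertexOp_degreePart_sum]
    rw [Finset.sum_comm]
    refine Finset.sum_congr rfl fun rho _ => ?_
    rw [vertexChain, Finset.mul_sum]
    refine Finset.sum_congr rfl fun j _ => ?_
    rw [vertexChain_congr ε (layerExponent ε u y N rho) (fun k => Lambda4 ε (y k) (rho k)) v N
      fun k hk => if_pos hk, layerExponent, if_neg (lt_irrefl N)]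
  · rintro ⟨a, b⟩ hab hne
    have ha : a ≠ 0 := by
      rintro rfl
      simp only [HasAntidiagonal.mem_antidiagonal, zero_add] at hab
      exact hne (by rw [hab])
    refine Finset.sum_eq_zero fun j _ => ?_
    rw [PowerSeries.coeff_C, if_neg ha]
    simp [symbolOp]
  · simp

/-! ### Continuation of power series -/

theorem ContinuesTo.zero : ContinuesTo 0 0 := ⟨0, 1, by simp, by simp, by simp⟩

theorem ContinuesTo.add {f g : PowerSeries ℂ} {a b : ℂ} (hf : ContinuesTo f a)
    (hg : ContinuesTo g b) : ContinuesTo (f + g) (a + b) := by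
  obtain ⟨p, r, hr, h, rfl⟩ := hf
  obtain ⟨p', r', hr', h', rfl⟩ := hg
  refine ⟨p * r' + p' * r, r * r', ?_, ?_, ?_⟩
  · rw [Polynomial.eval_mul]; exact mul_ne_zero hr hr'
  · rw [Polynomial.coe_mul, Polynomial.coe_add, Polynomial.coe_mul, Polynomial.coe_mul, ← h, ← h']
    ring
  · rw [Polynomial.eval_mul, Polynomial.eval_add, Polynomial.eval_mul, Polynomial.eval_mul]
    field_simp

theorem ContinuesTo.C_mul {f : PowerSeries ℂ} {a : ℂ} (c : ℂ) (hf : ContinuesTo f a) :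
    ContinuesTo (PowerSeries.C c * f) (c * a) := by
  obtain ⟨p, r, hr, h, rfl⟩ := hf
  refine ⟨Polynomial.C c * p, r, hr, ?_, ?_⟩
  · rw [Polynomial.coe_mul, Polynomial.coe_C, ← h]; ring
  · rw [Polynomial.eval_mul, Polynomial.eval_C, mul_div_assoc]

theorem ContinuesTo.sum {ι : Type*} (s : Finset ι) (f : ι → PowerSeries ℂ) (a : ι → ℂ)
    (h : ∀ i ∈ s, ContinuesTo (f i) (a i)) : ContinuesTo (∑ i ∈ s, f i) (∑ i ∈ s, a i) := by
  classical
  induction s using Finset.induction_on with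
  | empty => simpa using ContinuesTo.zero
  | insert i s hi ih =>
    rw [Finset.sum_insert hi, Finset.sum_insert hi]
    exact (h i (Finset.mem_insert_self _ _)).add
      (ih fun j hj => h j (Finset.mem_insert_of_mem hj))
/-! ### Evaluation of characters -/

/-- The logarithm of the monomial with exponents `m`. -/
def weight (ε : Fin 4 → ℂ) (m : ℤ × ℤ × ℤ) : ℂ := m.1 * ε 0 + m.2.1 * ε 1 + m.2.2 * ε 2

theorem weight_add (ε : Fin 4 → ℂ) (m k : ℤ × ℤ × ℤ) :
    weight ε (m + k) = weight ε m + weight ε k := by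
  simp [weight]; ring

theorem weight_neg (ε : Fin 4 → ℂ) (m : ℤ × ℤ × ℤ) : weight ε (-m) = -weight ε m := by
  simp [weight]; ring

/-- The value of a character at `q_a ^ n`. -/
def ev (ε : Fin 4 → ℂ) (n : ℤ) : Character →ₐ[ℤ] ℂ :=
  AddMonoidAlgebra.lift ℤ ℂ (ℤ × ℤ × ℤ)
    { toFun := fun m => Complex.exp (n * weight ε m.toAdd)
      map_one' := by simp [weight]
      map_mul' := fun m k => by rw [toAdd_mul, weight_add, mul_add, Complex.exp_add] }

theorem ev_apply (ε : Fin 4 → ℂ) (n : ℤ) (X : Character) :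
    ev ε n X = X.coeff.sum fun m k => (k : ℂ) * Complex.exp (n * weight ε m) := by
  rw [ev, AddMonoidAlgebra.lift_apply']; rfl

theorem ev_mon (ε : Fin 4 → ℂ) (n i j k : ℤ) :
    ev ε n (mon i j k) = Complex.exp (n * weight ε (i, j, k)) := by
  rw [ev, mon, AddMonoidAlgebra.lift_single]; simp

theorem mon_mul (i j k i' j' k' : ℤ) :
    mon i j k * mon i' j' k' = mon (i + i') (j + j') (k + k') := by
  simp [mon, AddMonoidAlgebra.single_mul_single]

theorem mon_zero : mon 0 0 0 = 1 := rfl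

/-- The dual as a ring homomorphism. -/
def dualHom : Character →+* Character :=
  AddMonoidAlgebra.mapDomainRingHom ℤ (negAddMonoidHom (α := ℤ × ℤ × ℤ))

theorem dual_eq (X : Character) : dual X = dualHom X := rfl

theorem dualHom_mon (i j k : ℤ) : dualHom (mon i j k) = mon (-i) (-j) (-k) := by
  rw [← dual_eq, dual, mon, AddMonoidAlgebra.mapDomain_single]; rfl

theorem character_induction {p : Character → Prop} (X : Character)
    (h0 : ∀ i j k, p (mon i j k)) (hadd : ∀ X Y, p X → p Y → p (X + Y))
    (hneg : ∀ X, p X → p (-X)) : p X := by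
  have hz : p 0 := by
    have := hadd _ _ (h0 0 0 0) (hneg _ (h0 0 0 0))
    rwa [add_neg_cancel] at this
  induction X using AddMonoidAlgebra.induction_linear with
  | zero => exact hz
  | add X Y hX hY => exact hadd X Y hX hY
  | single m n =>
    have hnat : ∀ k : ℕ, p (AddMonoidAlgebra.single m (k : ℤ)) := fun k => by
      induction k with
      | zero => simpa using hz
      | succ k ih =>
        rw [Nat.cast_succ, AddMonoidAlgebra.single_add]
        exact hadd _ _ ih (h0 m.1 m.2.1 m.2.2)
    obtain ⟨k, rfl | rfl⟩ := n.eq_nat_or_neg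
    · exact hnat k
    · rw [AddMonoidAlgebra.single_neg]; exact hneg _ (hnat k)

theorem dualHom_dualHom (X : Character) : dualHom (dualHom X) = X := by
  induction X using character_induction with
  | h0 i j k => simp [dualHom_mon]
  | hadd X Y hX hY => rw [map_add, map_add, hX, hY]
  | hneg X hX => rw [map_neg, map_neg, hX]

theorem ev_dualHom (ε : Fin 4 → ℂ) (n : ℤ) (X : Character) : ev ε n (dualHom X) = ev ε (-n) X := by
  induction X using character_induction with
  | h0 i j k => rw [dualHom_mon, ev_mon, ev_mon]; congr 1; simp [weight]; ring
  | hadd X Y hX hY => rw [map_add, map_add, map_add, hX, hY]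
  | hneg X hX => rw [map_neg, map_neg, map_neg, hX]

theorem ev_chq {ε : Fin 4 → ℂ} (hε : Generic ε) (n : ℤ) (a : Fin 4) :
    ev ε n (chq a) = qpow ε a n := by
  have h := hε.1
  rw [Fin.sum_univ_four] at h
  fin_cases a
  · simp [chq, ev_mon, qpow, weight]
  · simp [chq, ev_mon, qpow, weight]
  · simp [chq, ev_mon, qpow, weight]
  · change ev ε n (mon (-1) (-1) (-1)) = Complex.exp (n * ε 3)
    rw [ev_mon]
    congr 1
    simp only [weight]
    push_cast
    linear_combination (-n : ℂ) * h

theorem ev_chP {ε : Fin 4 → ℂ} (hε : Generic ε) (n : ℤ) (S : Finset (Fin 4)) :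
    ev ε n (chP S) = P ε S n := by
  rw [chP, P, map_prod]
  exact Finset.prod_congr rfl fun a _ => by rw [map_sub, map_one, ev_chq hε]

theorem Generic.exp_weight_ne_one {ε : Fin 4 → ℂ} (hε : Generic ε) {m : ℤ × ℤ × ℤ} (hm : m ≠ 0) :
    Complex.exp (weight ε m) ≠ 1 := fun h => by
  obtain ⟨h1, h2, h3⟩ := hε.2 _ _ _ h
  exact hm (Prod.ext h1 (Prod.ext h2 h3))

theorem Generic.P_ne_zero {ε : Fin 4 → ℂ} (hε : Generic ε) (S : Finset (Fin 4)) {n : ℤ}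
    (hn : n ≠ 0) : P ε S n ≠ 0 := by
  have h := hε.1
  rw [Fin.sum_univ_four] at h
  refine Finset.prod_ne_zero_iff.2 fun a _ h0 => ?_
  have h1 : qpow ε a n = 1 := (sub_eq_zero.1 h0).symm
  have key : ∃ m : ℤ × ℤ × ℤ, m ≠ 0 ∧ weight ε m = n * ε a := by
    fin_cases a
    · exact ⟨(n, 0, 0), by simp [hn], by simp [weight]⟩
    · exact ⟨(0, n, 0), by simp [hn], by simp [weight]⟩
    · exact ⟨(0, 0, n), by simp [hn], by simp [weight]⟩
    · refine ⟨(-n, -n, -n), by simp [hn], ?_⟩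
      simp [weight]
      linear_combination (-n : ℂ) * h
  obtain ⟨m, hm, hw⟩ := key
  exact hε.exp_weight_ne_one hm (by rw [hw]; exact h1)

/-! ### The index -/

/-- The index without its factor at the trivial weight. -/
def reducedIndex (ε : Fin 4 → ℂ) (X : Character) : ℂ :=
  X.coeff.prod fun m k => (if m = 0 then 1 else 1 - Complex.exp (-weight ε m)) ^ k

theorem reducedIndex_factor_ne_zero {ε : Fin 4 → ℂ} (hε : Generic ε) (m : ℤ × ℤ × ℤ) :
    (if m = 0 then 1 else 1 - Complex.exp (-weight ε m)) ≠ 0 := by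
  split_ifs with h
  · exact one_ne_zero
  · rw [← weight_neg]
    exact fun h0 => hε.exp_weight_ne_one (neg_ne_zero.2 h) (sub_eq_zero.1 h0).symm

theorem index_eq_reducedIndex (ε : Fin 4 → ℂ) {X : Character} (hX : X.coeff 0 = 0) :
    index ε X = reducedIndex ε X := by
  refine Finset.prod_congr rfl fun m hm => ?_
  have : m ≠ 0 := by
    rintro rfl
    exact Finsupp.mem_support_iff.1 hm hX
  simp only [if_neg this]
  rfl

/-- The trivial weight contributes a nonzero power of `1 - 1`. A negative power is also zero by the
convention `0⁻¹ = 0`. -/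
theorem index_eq_zero (ε : Fin 4 → ℂ) {X : Character} (hX : X.coeff 0 ≠ 0) : index ε X = 0 := by
  refine Finset.prod_eq_zero (Finsupp.mem_support_iff.2 hX) ?_
  simp [zero_zpow _ hX]

theorem prod_coeff_add (f : ℤ × ℤ × ℤ → ℂ) (hf : ∀ m, f m ≠ 0) (X Y : Character) :
    ((X + Y).coeff.prod fun m k => f m ^ k)
      = (X.coeff.prod fun m k => f m ^ k) * Y.coeff.prod fun m k => f m ^ k := by
  rw [AddMonoidAlgebra.coeff_add]
  exact Finsupp.prod_add_index' (by simp) fun m k l => zpow_add₀ (hf m) k l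

theorem prod_coeff_neg (f : ℤ × ℤ × ℤ → ℂ) (X : Character) :
    ((-X).coeff.prod fun m k => f m ^ k) = (X.coeff.prod fun m k => f m ^ k)⁻¹ := by
  rw [AddMonoidAlgebra.coeff_neg, Finsupp.prod_neg_index (by simp)]
  simp [Finsupp.prod, zpow_neg]

/-- For generic parameters no factor of the reduced index vanishes, so it is multiplicative without
exception. This can fail for `index`, where trivial weights may cancel in a sum. -/
theorem reducedIndex_add {ε : Fin 4 → ℂ} (hε : Generic ε) (X Y : Character) :
    reducedIndex ε (X + Y) = reducedIndex ε X * reducedIndex ε Y :=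
  prod_coeff_add _ (reducedIndex_factor_ne_zero hε) X Y

theorem reducedIndex_sum {ι : Type*} {ε : Fin 4 → ℂ} (hε : Generic ε) (s : Finset ι)
    (X : ι → Character) : reducedIndex ε (∑ i ∈ s, X i) = ∏ i ∈ s, reducedIndex ε (X i) := by
  classical
  induction s using Finset.induction_on with
  | empty => simp [reducedIndex]
  | insert a s ha ih => rw [Finset.sum_insert ha, Finset.prod_insert ha, reducedIndex_add hε, ih]

/-- The determinant of a character, with a sign for each weight. -/
def signedDet (ε : Fin 4 → ℂ) (X : Character) : ℂ :=
  X.coeff.prod fun m k => (-Complex.exp (weight ε m)) ^ k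

theorem signedDet_add (ε : Fin 4 → ℂ) (X Y : Character) :
    signedDet ε (X + Y) = signedDet ε X * signedDet ε Y :=
  prod_coeff_add _ (fun _ => neg_ne_zero.2 (Complex.exp_ne_zero _)) X Y

theorem signedDet_neg (ε : Fin 4 → ℂ) (X : Character) :
    signedDet ε (-X) = (signedDet ε X)⁻¹ := prod_coeff_neg _ X

theorem signedDet_sub (ε : Fin 4 → ℂ) (X Y : Character) :
    signedDet ε (X - Y) = signedDet ε X / signedDet ε Y := by
  rw [sub_eq_add_neg, signedDet_add, signedDet_neg, div_eq_mul_inv]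

theorem signedDet_mon (ε : Fin 4 → ℂ) (i j k : ℤ) :
    signedDet ε (mon i j k) = -Complex.exp (weight ε (i, j, k)) := by
  rw [signedDet, mon, AddMonoidAlgebra.coeff_single, Finsupp.prod_single_index (by simp), zpow_one]

theorem coeff_dualHom (X : Character) (m : ℤ × ℤ × ℤ) : (dualHom X).coeff m = X.coeff (-m) := by
  have h : dualHom X = AddMonoidAlgebra.mapDomain (fun m => -m) X := rfl
  rw [h, AddMonoidAlgebra.coeff_mapDomain]
  conv_lhs => rw [← neg_neg m]
  exact Finsupp.mapDomain_apply neg_injective _ _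

/-- Weight by weight this is `1 - x = -x (1 - x⁻¹)`. -/
theorem reducedIndex_dualHom (ε : Fin 4 → ℂ) {X : Character} (hX : X.coeff 0 = 0) :
    reducedIndex ε (dualHom X) = signedDet ε X * reducedIndex ε X := by
  have h : dualHom X = AddMonoidAlgebra.mapDomain (fun m => -m) X := rfl
  rw [reducedIndex, h, AddMonoidAlgebra.coeff_mapDomain,
    Finsupp.prod_mapDomain_index_inj neg_injective, signedDet, reducedIndex, ← Finsupp.prod_mul]
  refine Finset.prod_congr rfl fun m hm => ?_
  have hm0 : m ≠ 0 := by
    rintro rfl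
    exact Finsupp.mem_support_iff.1 hm hX
  simp only [if_neg hm0, if_neg (neg_ne_zero.2 hm0), weight_neg, neg_neg, ← mul_zpow]
  congr 1
  rw [mul_sub, neg_mul, neg_mul, ← Complex.exp_add]
  simp
  ring

/-! ### The index with a formal parameter -/

/-- The numerator of `∏ (1 - x_i⁻¹ s ^ r) ^ {n_i}`. -/
def indexNum (ε : Fin 4 → ℂ) (r : ℕ) (X : Character) : Polynomial ℂ :=
  ∏ m ∈ X.coeff.support,
    (1 - Polynomial.C (Complex.exp (-weight ε m)) * Polynomial.X ^ r) ^ (X.coeff m).toNat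

/-- The denominator of `∏ (1 - x_i⁻¹ s ^ r) ^ {n_i}`. -/
def indexDen (ε : Fin 4 → ℂ) (r : ℕ) (X : Character) : Polynomial ℂ :=
  ∏ m ∈ X.coeff.support,
    (1 - Polynomial.C (Complex.exp (-weight ε m)) * Polynomial.X ^ r) ^ (-X.coeff m).toNat

/-- At `s = 1` only the factor `1 - s ^ r` of the trivial weight vanishes, and a nonnegative
multiplicity keeps it out of the denominator. -/
theorem indexDen_eval_ne_zero {ε : Fin 4 → ℂ} (hε : Generic ε) (r : ℕ) {X : Character}
    (hX : 0 ≤ X.coeff 0) : (indexDen ε r X).eval 1 ≠ 0 := by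
  rw [indexDen, Polynomial.eval_prod]
  refine Finset.prod_ne_zero_iff.2 fun m _ => ?_
  by_cases hm : m = 0
  · have : (-X.coeff m).toNat = 0 := by rw [hm]; omega
    simp [this]
  · have := reducedIndex_factor_ne_zero hε m
    rw [if_neg hm] at this
    rw [Polynomial.eval_pow]
    refine pow_ne_zero _ ?_
    simpa using this

theorem indexNum_div_indexDen (ε : Fin 4 → ℂ) (r : ℕ) (X : Character) :
    (indexNum ε r X).eval 1 / (indexDen ε r X).eval 1 = index ε X := by
  rw [indexNum, indexDen, Polynomial.eval_prod, Polynomial.eval_prod, ← Finset.prod_div_distrib]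
  refine Finset.prod_congr rfl fun m _ => ?_
  have hw : weight ε m = m.1 * ε 0 + m.2.1 * ε 1 + m.2.2 * ε 2 := rfl
  simp only [Polynomial.eval_pow, Polynomial.eval_sub, Polynomial.eval_one, Polynomial.eval_mul,
    Polynomial.eval_C, Polynomial.eval_X, one_pow, mul_one, ← hw]
  rcases le_total 0 (X.coeff m) with h | h
  · have h1 : (-X.coeff m).toNat = 0 := by omega
    obtain ⟨k, hk⟩ := Int.eq_ofNat_of_zero_le h
    rw [h1, hk]; simp
  · have h1 : (X.coeff m).toNat = 0 := by omega
    obtain ⟨k, hk⟩ := Int.eq_ofNat_of_zero_le (neg_nonneg.2 h)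
    have h2 : X.coeff m = -(k : ℤ) := by omega
    rw [h1, h2]; simp

theorem spread_smul (r : ℕ) (a : ℂ) (c : ℕ → ℂ) :
    spread r (fun n => a * c n) = a • spread r c := by
  ext d
  simp [spread]

theorem spread_add (r : ℕ) (c c' : ℕ → ℂ) :
    spread r (fun n => c n + c' n) = spread r c + spread r c' := by
  ext d
  simp only [spread, PowerSeries.coeff_mk, map_add]
  split_ifs <;> simp

theorem spread_sum {ι : Type*} (s : Finset ι) (r : ℕ) (c : ι → ℕ → ℂ) :
    spread r (fun n => ∑ i ∈ s, c i n) = ∑ i ∈ s, spread r (c i) := by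
  ext d
  simp only [spread, PowerSeries.coeff_mk, map_sum]
  split_ifs <;> simp

theorem spread_congr {r : ℕ} (hr : 0 < r) {c c' : ℕ → ℂ} (h : ∀ n, 0 < n → c n = c' n) :
    spread r c = spread r c' := by
  ext d
  simp only [spread, PowerSeries.coeff_mk]
  split_ifs with hd
  · exact h _ (Nat.div_pos (Nat.le_of_dvd (Nat.pos_of_ne_zero hd.1) hd.2) hr)
  · rfl

theorem constantCoeff_spread (r : ℕ) (c : ℕ → ℂ) :
    PowerSeries.constantCoeff (spread r c) = 0 := by
  rw [← PowerSeries.coeff_zero_eq_constantCoeff_apply, spread, PowerSeries.coeff_mk]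
  simp

/-- The Mercator series for `log (1 - w X ^ r)`; after differentiation, the product with `1 - w X ^
r` telescopes. -/
theorem hasLog_one_sub (r : ℕ) (hr : 0 < r) (w : ℂ) :
    HasLog (1 - PowerSeries.C w * PowerSeries.X ^ r) (spread r fun n => -(1 / (n : ℂ)) * w ^ n) := by
  refine ⟨by simp [hr.ne'], ?_⟩
  ext d
  have hg : ∀ d, PowerSeries.coeff d (PowerSeries.derivative ℂ
      (spread r fun n => -(1 / (n : ℂ)) * w ^ n))
        = if r ∣ d + 1 then -(r : ℂ) * w ^ ((d + 1) / r) else 0 := fun d => by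
    rw [PowerSeries.coeff_derivative, spread, PowerSeries.coeff_mk]
    by_cases h : r ∣ d + 1
    · rw [if_pos h, if_pos ⟨Nat.succ_ne_zero d, h⟩]
      obtain ⟨k, hk⟩ := h
      have hk0 : (k : ℂ) ≠ 0 := by
        rintro h0
        have : k = 0 := by exact_mod_cast h0
        simp [this] at hk
      have h2 : ((d : ℂ) + 1) = r * k := by exact_mod_cast hk
      rw [hk, Nat.mul_div_cancel_left _ hr, h2]
      field_simp
    · rw [if_neg h, if_neg fun h' => h h'.2, zero_mul]
  rw [PowerSeries.coeff_derivative, mul_sub, mul_one, map_sub, map_sub, hg, mul_left_comm,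
    PowerSeries.coeff_C_mul, PowerSeries.coeff_C_mul, PowerSeries.coeff_mul_X_pow',
    PowerSeries.coeff_X_pow, PowerSeries.coeff_one, if_neg (Nat.succ_ne_zero d)]
  by_cases h : r ∣ d + 1
  · obtain ⟨k, hk⟩ := h
    obtain ⟨k, rfl⟩ := Nat.exists_eq_succ_of_ne_zero (show k ≠ 0 by rintro rfl; simp at hk)
    simp only [hk, dvd_mul_right, if_true, Nat.mul_div_cancel_left _ hr]
    have h2 : ((d : ℂ) + 1) = r * (k + 1) := by exact_mod_cast hk
    rcases Nat.eq_zero_or_pos k with rfl | hk0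
    · have h3 : ¬ r ≤ d := by simp at hk; omega
      simp [h3, h2, mul_comm]
    · have h3 : r ≤ d := by
        have : r * 1 ≤ r * k := Nat.mul_le_mul_left r hk0
        rw [Nat.succ_eq_add_one, mul_add] at hk; omega
      have h4 : d - r + 1 = r * k := by
        rw [Nat.succ_eq_add_one, mul_add] at hk; omega
      have h5 : r * k.succ ≠ r := by
        rw [Nat.succ_eq_add_one, mul_add]
        have := Nat.mul_pos hr hk0
        omega
      rw [if_neg h5, if_pos h3, hg, h4, if_pos (dvd_mul_right _ _), Nat.mul_div_cancel_left _ hr,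
        h2, Nat.succ_eq_add_one, pow_succ]
      ring
  · have h1 : d + 1 ≠ r := fun h' => h (by rw [h'])
    rw [if_neg h, if_neg h1]
    split_ifs with h2
    · have h3 : ¬ r ∣ d - r + 1 := fun h' => h (by
        have := Nat.dvd_add h' (dvd_refl r)
        rwa [show d - r + 1 + r = d + 1 by omega] at this)
      rw [hg, if_neg h3]; simp
    · simp

/-- Here `∏ (1 - x⁻¹ s ^ r) ^ n_x` has logarithm `-∑ s ^ (r n) X(q ^ (-n)) / n`. Keeping the
logarithm `g` of the denominator separate avoids inverting polynomials. -/
theorem hasLog_index {ε : Fin 4 → ℂ} (r : ℕ) (hr : 0 < r) (X : Character) :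
    ∃ g, HasLog (indexDen ε r X : PowerSeries ℂ) g ∧ HasLog (indexNum ε r X : PowerSeries ℂ)
      (g + spread r fun n => -(1 / (n : ℂ)) * ev ε (-n) X) := by
  have hpow : ∀ (k : ℤ × ℤ × ℤ → ℕ), HasLog
      ((∏ m ∈ X.coeff.support, (1 - Polynomial.C (Complex.exp (-weight ε m)) * Polynomial.X ^ r)
        ^ k m : Polynomial ℂ) : PowerSeries ℂ)
      (∑ m ∈ X.coeff.support, (k m : ℂ) •
        spread r fun n => -(1 / (n : ℂ)) * Complex.exp (-weight ε m) ^ n) := fun k => by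
    rw [← Polynomial.coeToPowerSeries.ringHom_apply, map_prod]
    refine HasLog.prod _ _ _ fun m _ => ?_
    rw [Polynomial.coeToPowerSeries.ringHom_apply, Polynomial.coe_pow, Polynomial.coe_sub,
      Polynomial.coe_one, Polynomial.coe_mul, Polynomial.coe_C, Polynomial.coe_pow,
      Polynomial.coe_X]
    exact (hasLog_one_sub r hr _).pow _
  refine ⟨_, hpow _, ?_⟩
  have h1 : (spread r fun n => -(1 / (n : ℂ)) * ev ε (-n) X)
      = ∑ m ∈ X.coeff.support, ((X.coeff m : ℤ) : ℂ) •
        spread r fun n => -(1 / (n : ℂ)) * Complex.exp (-weight ε m) ^ n := by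
    simp only [← spread_smul, ← spread_sum]
    congr 1
    funext n
    rw [ev_apply, Finsupp.sum, Finset.mul_sum]
    refine Finset.sum_congr rfl fun m _ => ?_
    rw [← Complex.exp_nat_mul]
    push_cast
    ring_nf
  have h2 := hpow fun m => (X.coeff m).toNat
  rw [← indexNum] at h2
  convert h2 using 1
  rw [h1, ← Finset.sum_add_distrib]
  refine Finset.sum_congr rfl fun m _ => ?_
  rw [← add_smul]
  congr 1
  have : ((-X.coeff m).toNat : ℤ) + X.coeff m = (X.coeff m).toNat := by omega
  exact_mod_cast this

theorem HasLog.inv {f g : PowerSeries ℂ} (h : HasLog f g) : HasLog f⁻¹ (-g) := by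
  have hc : PowerSeries.constantCoeff f ≠ 0 := by rw [h.1]; exact one_ne_zero
  refine ⟨by simp [h.1], ?_⟩
  rw [PowerSeries.derivative_inv', h.2, map_neg]
  linear_combination (-f⁻¹ * PowerSeries.derivative ℂ g) * PowerSeries.mul_inv_cancel f hc
/-! ### Second differences of Young diagrams -/

theorem sum_cells (rho : YoungDiagram) {M : Type*} [AddCommMonoid M] (F : ℕ × ℕ → M) :
    ∑ b ∈ rho.cells, F b = ∑ j ∈ range (rho.rowLen 0), ∑ i ∈ range (rho.colLen j), F (i, j) := by
  rw [Finset.sum_sigma']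
  refine Finset.sum_nbij' (fun b => ⟨b.2, b.1⟩) (fun b => (b.2, b.1)) ?_ ?_ ?_ ?_ ?_
  · rintro ⟨i, j⟩ h
    have h' : (i, j) ∈ rho := h
    rw [Finset.mem_sigma, Finset.mem_range, Finset.mem_range]
    refine ⟨YoungDiagram.mem_iff_lt_rowLen.1 (rho.up_left_mem (Nat.zero_le i) le_rfl h'),
      YoungDiagram.mem_iff_lt_colLen.1 h'⟩
  · rintro ⟨j, i⟩ h
    rw [Finset.mem_sigma, Finset.mem_range, Finset.mem_range] at h
    exact YoungDiagram.mem_iff_lt_colLen.2 h.2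
  · intro _ _; rfl
  · intro _ _; rfl
  · intro _ _; rfl

/-- The indicator function of the diagram `rho` shifted by `(a, b)`. -/
def shiftedIndicator (a b : ℕ) (rho : YoungDiagram) (s t : ℤ) : ℤ :=
  ∑ x ∈ rho.cells, if (x.1 : ℤ) + a = s ∧ (x.2 : ℤ) + b = t then 1 else 0

open Classical in
/-- The indicator function of the complement of the shifted diagram in its quadrant. -/
def complementIndicator (a b : ℕ) (rho : YoungDiagram) (s t : ℤ) : ℤ :=
  if (a : ℤ) ≤ s ∧ (b : ℤ) ≤ t ∧ ((s - a).toNat, (t - b).toNat) ∉ rho then 1 else 0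

theorem shiftedIndicator_add_complementIndicator (a b : ℕ) (rho : YoungDiagram) (s t : ℤ) :
    shiftedIndicator a b rho s t + complementIndicator a b rho s t
      = if (a : ℤ) ≤ s ∧ (b : ℤ) ≤ t then 1 else 0 := by
  classical
  rw [shiftedIndicator, complementIndicator]
  by_cases hq : (a : ℤ) ≤ s ∧ (b : ℤ) ≤ t
  · rw [if_pos hq]
    obtain ⟨i, rfl⟩ := Int.eq_ofNat_of_zero_le (sub_nonneg.2 hq.1) |>.imp fun i h =>
      (sub_eq_iff_eq_add.1 h)
    obtain ⟨j, rfl⟩ := Int.eq_ofNat_of_zero_le (sub_nonneg.2 hq.2) |>.imp fun i h =>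
      (sub_eq_iff_eq_add.1 h)
    have h1 : ∀ x : ℕ × ℕ, ((x.1 : ℤ) + a = i + a ∧ (x.2 : ℤ) + b = j + b) ↔ x = (i, j) := by
      rintro ⟨x, y⟩
      simp
    simp only [h1, Finset.sum_ite_eq', add_sub_cancel_right, Int.toNat_natCast,
      YoungDiagram.mem_cells]
    by_cases hm : (i, j) ∈ rho <;> simp [hm]
  · rw [if_neg hq, if_neg fun h => hq ⟨h.1, h.2.1⟩, add_zero]
    refine Finset.sum_eq_zero fun x _ => if_neg fun h => hq ⟨by omega, by omega⟩

theorem complementIndicator_nonneg (a b : ℕ) (rho : YoungDiagram) (s t : ℤ) :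
    0 ≤ complementIndicator a b rho s t := by
  rw [complementIndicator]; split_ifs <;> simp

/-- The complement of a Young diagram in its quadrant is an upper set. This monotonicity is the
source of all positivity below. -/
theorem complementIndicator_mono (a b : ℕ) (rho : YoungDiagram) {s t s' t' : ℤ} (hs : s ≤ s')
    (ht : t ≤ t') : complementIndicator a b rho s t ≤ complementIndicator a b rho s' t' := by
  by_cases h : (a : ℤ) ≤ s ∧ (b : ℤ) ≤ t ∧ ((s - a).toNat, (t - b).toNat) ∉ rho
  · have h' : (a : ℤ) ≤ s' ∧ (b : ℤ) ≤ t' ∧ ((s' - a).toNat, (t' - b).toNat) ∉ rho := by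
      refine ⟨by omega, by omega, fun hm => h.2.2 (rho.up_left_mem ?_ ?_ hm)⟩ <;> omega
    rw [complementIndicator, complementIndicator, if_pos h, if_pos h']
  · rw [complementIndicator, if_neg h]
    exact complementIndicator_nonneg _ _ _ _ _

theorem complementIndicator_of_neg (a b : ℕ) (rho : YoungDiagram) {s t : ℤ}
    (h : s < 0 ∨ t < 0) : complementIndicator a b rho s t = 0 := by
  rw [complementIndicator, if_neg]
  rintro ⟨h1, h2, -⟩
  omega

/-- The sum over `rho'` of the corner of the quadrant minus the second difference of `rho`. -/
def interlacing (a b : ℕ) (rho rho' : YoungDiagram) : ℤ :=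
  ∑ x ∈ rho'.cells, ((if (x.1 : ℤ) = a ∧ (x.2 : ℤ) = b then 1 else 0)
    - (shiftedIndicator a b rho x.1 x.2 - shiftedIndicator a b rho (x.1 - 1) x.2
      - shiftedIndicator a b rho x.1 (x.2 - 1) + shiftedIndicator a b rho (x.1 - 1) (x.2 - 1)))

/-- A point mass at the corner is the mixed second difference of the quadrant, so each summand is
the mixed second difference of the complement. Summing it down a column of `rho'` telescopes. -/
theorem interlacing_eq (a b : ℕ) (rho rho' : YoungDiagram) :
    interlacing a b rho rho' = ∑ j ∈ range (rho'.rowLen 0),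
      (complementIndicator a b rho ((rho'.colLen j : ℤ) - 1) j
        - complementIndicator a b rho ((rho'.colLen j : ℤ) - 1) ((j : ℤ) - 1)) := by
  have hx : ∀ s t : ℤ, (if s = a ∧ t = b then (1 : ℤ) else 0)
      - (shiftedIndicator a b rho s t - shiftedIndicator a b rho (s - 1) t
        - shiftedIndicator a b rho s (t - 1) + shiftedIndicator a b rho (s - 1) (t - 1))
      = (complementIndicator a b rho s t - complementIndicator a b rho s (t - 1))
        - (complementIndicator a b rho (s - 1) t
          - complementIndicator a b rho (s - 1) (t - 1)) := fun s t => by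
    have h1 := shiftedIndicator_add_complementIndicator a b rho s t
    have h2 := shiftedIndicator_add_complementIndicator a b rho (s - 1) t
    have h3 := shiftedIndicator_add_complementIndicator a b rho s (t - 1)
    have h4 := shiftedIndicator_add_complementIndicator a b rho (s - 1) (t - 1)
    have h5 : (if s = a ∧ t = b then (1 : ℤ) else 0)
        = (if (a : ℤ) ≤ s ∧ (b : ℤ) ≤ t then 1 else 0)
          - (if (a : ℤ) ≤ s - 1 ∧ (b : ℤ) ≤ t then 1 else 0)
          - (if (a : ℤ) ≤ s ∧ (b : ℤ) ≤ t - 1 then 1 else 0)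
          + (if (a : ℤ) ≤ s - 1 ∧ (b : ℤ) ≤ t - 1 then 1 else 0) := by
      split_ifs <;> omega
    rw [h5]
    linarith
  rw [interlacing]
  simp only [hx]
  rw [sum_cells]
  refine Finset.sum_congr rfl fun j _ => ?_
  have h := Finset.sum_range_sub (fun i : ℕ => complementIndicator a b rho ((i : ℤ) - 1) j
    - complementIndicator a b rho ((i : ℤ) - 1) ((j : ℤ) - 1)) (rho'.colLen j)
  rw [complementIndicator_of_neg a b rho (s := ((0 : ℕ) : ℤ) - 1) (t := (j : ℤ)) (by simp),
    complementIndicator_of_neg a b rho (s := ((0 : ℕ) : ℤ) - 1) (t := (j : ℤ) - 1) (by simp),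
    sub_zero, sub_zero] at h
  rw [← h]
  exact Finset.sum_congr rfl fun i _ => by push_cast; simp

theorem interlacing_nonneg (a b : ℕ) (rho rho' : YoungDiagram) :
    0 ≤ interlacing a b rho rho' := by
  rw [interlacing_eq]
  exact Finset.sum_nonneg fun j _ =>
    sub_nonneg.2 (complementIndicator_mono a b rho le_rfl (by omega))

/-- The diagram `rho'` is contained in the union of `rho`, shifted by `(a, b)`, with the
complement of the quadrant at `(a, b)`. -/
def Interlaced (a b : ℕ) (rho rho' : YoungDiagram) : Prop :=
  ∀ i j, (i, j) ∈ rho' → a ≤ i → b ≤ j → (i - a, j - b) ∈ rho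

theorem complementIndicator_natCast_eq_zero_iff (a b : ℕ) (rho : YoungDiagram) (i j : ℕ) :
    complementIndicator a b rho i j = 0 ↔ (a ≤ i → b ≤ j → (i - a, j - b) ∈ rho) := by
  have h1 : ((i : ℤ) - a).toNat = i - a := by omega
  have h2 : ((j : ℤ) - b).toNat = j - b := by omega
  rw [complementIndicator, h1, h2]
  constructor
  · intro h ha hb
    by_contra hn
    rw [if_pos ⟨by omega, by omega, hn⟩] at h
    exact one_ne_zero h
  · intro h
    refine if_neg fun hn => hn.2.2 (h ?_ ?_) <;> omega

/-- The sum of nonnegative column terms vanishes only if each does. It then follows from left to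
right that the complement misses the last cell of every column of `rho'`, hence by monotonicity the
whole of `rho'`. -/
theorem interlacing_eq_zero_iff (a b : ℕ) (rho rho' : YoungDiagram) :
    interlacing a b rho rho' = 0 ↔ Interlaced a b rho rho' := by
  have hpos : ∀ j ∈ range (rho'.rowLen 0), 1 ≤ rho'.colLen j := fun j hj =>
    YoungDiagram.mem_iff_lt_colLen.1 (YoungDiagram.mem_iff_lt_rowLen.2 (Finset.mem_range.1 hj))
  rw [interlacing_eq, Finset.sum_eq_zero_iff_of_nonneg fun j _ =>
    sub_nonneg.2 (complementIndicator_mono a b rho le_rfl (by omega))]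
  constructor
  · intro h i j hij
    have key : ∀ j ∈ range (rho'.rowLen 0),
        complementIndicator a b rho ((rho'.colLen j : ℤ) - 1) j = 0 := by
      intro j
      induction j with
      | zero =>
        intro hj
        have := h 0 hj
        rwa [complementIndicator_of_neg a b rho (t := ((0 : ℕ) : ℤ) - 1) (by simp), sub_zero]
          at this
      | succ j ih =>
        intro hj
        have hj' : j ∈ range (rho'.rowLen 0) := by
          rw [Finset.mem_range] at hj ⊢; omega
        have h1 := h (j + 1) hj
        -- Columns shrink to the right, so the subtracted term in column `j + 1` is bounded by the
        -- value already known to vanish in column `j`.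
        have h2 : complementIndicator a b rho ((rho'.colLen (j + 1) : ℤ) - 1)
            (((j + 1 : ℕ) : ℤ) - 1)
            ≤ complementIndicator a b rho ((rho'.colLen j : ℤ) - 1) j :=
          complementIndicator_mono a b rho
            (by have := rho'.colLen_anti j (j + 1) (by omega); omega) (by push_cast; omega)
        have h3 := complementIndicator_nonneg a b rho ((rho'.colLen (j + 1) : ℤ) - 1)
          (((j + 1 : ℕ) : ℤ))
        rw [ih hj'] at h2
        linarith
    rw [← complementIndicator_natCast_eq_zero_iff]
    have hj : j ∈ range (rho'.rowLen 0) := Finset.mem_range.2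
      (YoungDiagram.mem_iff_lt_rowLen.1 (rho'.up_left_mem (Nat.zero_le i) le_rfl hij))
    refine le_antisymm ?_ (complementIndicator_nonneg _ _ _ _ _)
    rw [← key j hj]
    exact complementIndicator_mono a b rho
      (by have := YoungDiagram.mem_iff_lt_colLen.1 hij; omega) le_rfl
  · intro h j hj
    have h1 : complementIndicator a b rho ((rho'.colLen j : ℤ) - 1) j = 0 := by
      have h2 := hpos j hj
      have h3 : ((rho'.colLen j : ℤ) - 1) = ((rho'.colLen j - 1 : ℕ) : ℤ) := by omega
      rw [h3, complementIndicator_natCast_eq_zero_iff]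
      exact h _ _ (YoungDiagram.mem_iff_lt_colLen.2 (by omega))
    have h2 := complementIndicator_mono a b rho (le_refl ((rho'.colLen j : ℤ) - 1))
      (show (j : ℤ) - 1 ≤ j by omega)
    have h3 := complementIndicator_nonneg a b rho ((rho'.colLen j : ℤ) - 1) ((j : ℤ) - 1)
    omega

theorem interlaced_self (rho : YoungDiagram) : Interlaced 0 0 rho rho :=
  fun _ _ h _ _ => h

/-! ### The characters of pairs of layers -/

/-- The contribution of a pair of layers to the D6 character, for layers with diagrams `rho` and
`rho'` whose corners differ by the weight `p`. -/
def layerChar (p : ℤ × ℤ × ℤ) (rho rho' : YoungDiagram) : Character :=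
  -(dualHom (chP {2, 3}) * (mon p.1 p.2.1 p.2.2 * chK4 rho'))
    + dualHom (chP {0, 1, 2}) * (mon p.1 p.2.1 p.2.2 * (dualHom (chK4 rho) * chK4 rho'))

theorem chq_zero : chq 0 = mon 1 0 0 := rfl
theorem chq_one : chq 1 = mon 0 1 0 := rfl
theorem chq_two : chq 2 = mon 0 0 1 := rfl
theorem chq_three : chq 3 = mon (-1) (-1) (-1) := rfl

theorem chP_01 : chP {0, 1} = (1 - mon 1 0 0) * (1 - mon 0 1 0) := by
  simp [chP, chq_zero, chq_one]

theorem chP_23 : chP {2, 3} = (1 - mon 0 0 1) * (1 - mon (-1) (-1) (-1)) := by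
  simp [chP, chq_two, chq_three]

theorem chP_012 : chP {0, 1, 2} = (1 - mon 1 0 0) * (1 - mon 0 1 0) * (1 - mon 0 0 1) := by
  simp [chP, chq_zero, chq_one, chq_two, mul_assoc]

theorem chP_3 : chP {3} = 1 - mon (-1) (-1) (-1) := by
  simp [chP, chq_three]

/-- The indicator function of the trivial weight. -/
def trivialWeight (i j k : ℤ) : ℤ := if i = 0 ∧ j = 0 ∧ k = 0 then 1 else 0

theorem coeff_mon_zero (i j k : ℤ) : (mon i j k).coeff 0 = trivialWeight i j k := by
  rw [mon, AddMonoidAlgebra.coeff_single, Finsupp.single_apply, trivialWeight]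
  simp [Prod.ext_iff]

theorem trivialWeight_of_left {i j k : ℤ} (h : i ≠ 0) : trivialWeight i j k = 0 :=
  if_neg fun h' => h h'.1

theorem trivialWeight_of_right {i j k : ℤ} (h : k ≠ 0) : trivialWeight i j k = 0 :=
  if_neg fun h' => h h'.2.2

theorem mon_mul_chK4 (i j k : ℤ) (rho : YoungDiagram) :
    mon i j k * chK4 rho = ∑ x ∈ rho.cells, mon (i + x.1) (j + x.2) k := by
  simp [chK4, Finset.mul_sum, mon_mul]

theorem mon_mul_dualHom_chK4 (i j k : ℤ) (rho : YoungDiagram) :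
    mon i j k * dualHom (chK4 rho) = ∑ x ∈ rho.cells, mon (i - x.1) (j - x.2) k := by
  simp [chK4, Finset.mul_sum, mon_mul, dualHom_mon, map_sum, sub_eq_add_neg]

/-- The fully expanded form, from which each relative position is settled by seeing which weights
can be trivial. -/
theorem coeff_layerChar (p : ℤ × ℤ × ℤ) (rho rho' : YoungDiagram) :
    (layerChar p rho rho').coeff 0 = ∑ y ∈ rho'.cells,
      (-(trivialWeight (p.1 + y.1) (p.2.1 + y.2) p.2.2
          - trivialWeight (p.1 + y.1) (p.2.1 + y.2) (p.2.2 - 1)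
          - trivialWeight (p.1 + y.1 + 1) (p.2.1 + y.2 + 1) (p.2.2 + 1)
          + trivialWeight (p.1 + y.1 + 1) (p.2.1 + y.2 + 1) p.2.2)
        + ∑ x ∈ rho.cells,
          (trivialWeight (p.1 + y.1 - x.1) (p.2.1 + y.2 - x.2) p.2.2
          - trivialWeight (p.1 + y.1 - x.1 - 1) (p.2.1 + y.2 - x.2) p.2.2
          - trivialWeight (p.1 + y.1 - x.1) (p.2.1 + y.2 - x.2 - 1) p.2.2
          + trivialWeight (p.1 + y.1 - x.1 - 1) (p.2.1 + y.2 - x.2 - 1) p.2.2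
          - trivialWeight (p.1 + y.1 - x.1) (p.2.1 + y.2 - x.2) (p.2.2 - 1)
          + trivialWeight (p.1 + y.1 - x.1 - 1) (p.2.1 + y.2 - x.2) (p.2.2 - 1)
          + trivialWeight (p.1 + y.1 - x.1) (p.2.1 + y.2 - x.2 - 1) (p.2.2 - 1)
          - trivialWeight (p.1 + y.1 - x.1 - 1) (p.2.1 + y.2 - x.2 - 1) (p.2.2 - 1))) := by
  have h1 : layerChar p rho rho' = ∑ y ∈ rho'.cells,
      (-(mon (p.1 + y.1) (p.2.1 + y.2) p.2.2
          - mon (p.1 + y.1) (p.2.1 + y.2) (p.2.2 - 1)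
          - mon (p.1 + y.1 + 1) (p.2.1 + y.2 + 1) (p.2.2 + 1)
          + mon (p.1 + y.1 + 1) (p.2.1 + y.2 + 1) p.2.2)
        + ∑ x ∈ rho.cells,
          (mon (p.1 + y.1 - x.1) (p.2.1 + y.2 - x.2) p.2.2
          - mon (p.1 + y.1 - x.1 - 1) (p.2.1 + y.2 - x.2) p.2.2
          - mon (p.1 + y.1 - x.1) (p.2.1 + y.2 - x.2 - 1) p.2.2
          + mon (p.1 + y.1 - x.1 - 1) (p.2.1 + y.2 - x.2 - 1) p.2.2
          - mon (p.1 + y.1 - x.1) (p.2.1 + y.2 - x.2) (p.2.2 - 1)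
          + mon (p.1 + y.1 - x.1 - 1) (p.2.1 + y.2 - x.2) (p.2.2 - 1)
          + mon (p.1 + y.1 - x.1) (p.2.1 + y.2 - x.2 - 1) (p.2.2 - 1)
          - mon (p.1 + y.1 - x.1 - 1) (p.2.1 + y.2 - x.2 - 1) (p.2.2 - 1))) := by
    have h2 : mon p.1 p.2.1 p.2.2 * (dualHom (chK4 rho) * chK4 rho')
        = ∑ y ∈ rho'.cells, ∑ x ∈ rho.cells, mon (p.1 + y.1 - x.1) (p.2.1 + y.2 - x.2) p.2.2 := by
      rw [mul_left_comm, mon_mul_chK4, Finset.mul_sum]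
      refine Finset.sum_congr rfl fun y _ => ?_
      rw [mul_comm, mon_mul_dualHom_chK4]
    rw [layerChar, h2, mon_mul_chK4, Finset.sum_add_distrib, Finset.sum_neg_distrib, chP_23,
      chP_012]
    simp only [Finset.mul_sum, map_mul, map_sub, map_one, dualHom_mon, neg_zero, neg_neg]
    congr 1
    · congr 1
      refine Finset.sum_congr rfl fun y _ => ?_
      simp only [sub_mul, mul_sub, one_mul, mul_one, mon_mul]
      ring_nf
    · refine Finset.sum_congr rfl fun y _ => Finset.sum_congr rfl fun x _ => ?_
      simp only [sub_mul, mul_sub, one_mul, mul_one, mon_mul]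
      ring_nf
  rw [h1]
  simp only [AddMonoidAlgebra.coeff_sum, AddMonoidAlgebra.coeff_add, AddMonoidAlgebra.coeff_sub,
    AddMonoidAlgebra.coeff_neg, Finsupp.coe_finsetSum, Finset.sum_apply, Finsupp.coe_add,
    Finsupp.coe_sub, Finsupp.coe_neg, Pi.add_apply, Pi.sub_apply, Pi.neg_apply, coeff_mon_zero]

theorem coeff_layerChar_of_two_le {p : ℤ × ℤ × ℤ} (hp : 2 ≤ p.2.2) (rho rho' : YoungDiagram) :
    (layerChar p rho rho').coeff 0 = 0 := by
  rw [coeff_layerChar]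
  refine Finset.sum_eq_zero fun y _ => ?_
  simp (disch := omega) only [trivialWeight_of_right]
  simp

/-- The only weights that can reach height zero come from the term with `p.2.2 + 1`, and these have
positive first exponent. -/
theorem coeff_layerChar_of_neg {p : ℤ × ℤ × ℤ} (h0 : 0 ≤ p.1) (hp : p.2.2 < 0)
    (rho rho' : YoungDiagram) : (layerChar p rho rho').coeff 0 = 0 := by
  rw [coeff_layerChar]
  refine Finset.sum_eq_zero fun y _ => ?_
  rw [trivialWeight_of_left (i := p.1 + y.1 + 1) (k := p.2.2 + 1) (by omega)]
  simp (disch := omega) only [trivialWeight_of_right]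
  simp

/-- Only the terms shifted down by one survive: a point mass at the corner of the lower layer, and
minus the mixed second difference of its diagram. -/
theorem coeff_layerChar_one (a b : ℕ) (rho rho' : YoungDiagram) :
    (layerChar (-a, -b, 1) rho rho').coeff 0 = interlacing a b rho rho' := by
  rw [coeff_layerChar, interlacing]
  refine Finset.sum_congr rfl fun y _ => ?_
  simp (disch := omega) only [trivialWeight_of_right]
  have h1 : ∀ s t : ℤ, shiftedIndicator a b rho s t
      = ∑ x ∈ rho.cells, trivialWeight (-a + s - x.1) (-b + t - x.2) (1 - 1) := fun s t => by
    refine Finset.sum_congr rfl fun x _ => if_congr ?_ rfl rfl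
    omega
  have h2 : (if (y.1 : ℤ) = a ∧ (y.2 : ℤ) = b then (1 : ℤ) else 0)
      = trivialWeight (-a + y.1) (-b + y.2) (1 - 1) := if_congr (by omega) rfl rfl
  simp only [h1, h2, ← Finset.sum_sub_distrib, ← Finset.sum_add_distrib]
  rw [sub_eq_add_neg (trivialWeight _ _ _) (Finset.sum _ _), ← Finset.sum_neg_distrib]
  congr 1
  · ring
  · refine Finset.sum_congr rfl fun x _ => ?_
    ring_nf

/-- The multiplicity is minus the interlacing number of a diagram with itself, which vanishes. -/
theorem coeff_layerChar_zero (rho : YoungDiagram) : (layerChar 0 rho rho).coeff 0 = 0 := by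
  have h0 := (interlacing_eq_zero_iff 0 0 rho rho).2 (interlaced_self rho)
  rw [← neg_eq_zero, ← h0, coeff_layerChar, interlacing, ← Finset.sum_neg_distrib]
  refine Finset.sum_congr rfl fun y _ => ?_
  simp only [Prod.fst_zero, Prod.snd_zero]
  rw [trivialWeight_of_left (i := 0 + y.1 + 1) (k := 0) (by omega)]
  simp (disch := omega) only [trivialWeight_of_right]
  have h1 : ∀ s t : ℤ, shiftedIndicator 0 0 rho s t
      = ∑ x ∈ rho.cells, trivialWeight (0 + s - x.1) (0 + t - x.2) 0 := fun s t => by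
    refine Finset.sum_congr rfl fun x _ => if_congr ?_ rfl rfl
    omega
  have h2 : (if (y.1 : ℤ) = (0 : ℕ) ∧ (y.2 : ℤ) = (0 : ℕ) then (1 : ℤ) else 0)
      = trivialWeight (0 + y.1) (0 + y.2) 0 := if_congr (by omega) rfl rfl
  simp only [h1, h2, ← Finset.sum_sub_distrib, ← Finset.sum_add_distrib]
  rw [neg_add, sub_eq_add_neg (trivialWeight _ _ _) (Finset.sum _ _)]
  congr 1
  · ring
  · congr 1
    refine Finset.sum_congr rfl fun x _ => ?_
    ring_nf

/-- The contribution of a layer and the tail to the D6 character. -/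
def tailChar (p : ℤ × ℤ × ℤ) (rho : YoungDiagram) : Character :=
  -(dualHom (chP {3}) * (mon p.1 p.2.1 p.2.2 * chK4 rho))

theorem tailChar_eq (p : ℤ × ℤ × ℤ) (rho : YoungDiagram) :
    tailChar p rho = ∑ y ∈ rho.cells, (mon (p.1 + y.1 + 1) (p.2.1 + y.2 + 1) (p.2.2 + 1)
      - mon (p.1 + y.1) (p.2.1 + y.2) p.2.2) := by
  rw [tailChar, mon_mul_chK4, chP_3, Finset.mul_sum, ← Finset.sum_neg_distrib]
  refine Finset.sum_congr rfl fun y _ => ?_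
  simp only [map_sub, map_one, dualHom_mon, neg_neg, sub_mul, one_mul, mon_mul]
  ring_nf

theorem coeff_tailChar {p : ℤ × ℤ × ℤ} (h0 : 0 ≤ p.1) (hp : p.2.2 < 0) (rho : YoungDiagram) :
    (tailChar p rho).coeff 0 = 0 := by
  rw [tailChar_eq]
  simp only [AddMonoidAlgebra.coeff_sum, AddMonoidAlgebra.coeff_sub, Finsupp.coe_finsetSum,
    Finset.sum_apply, Finsupp.coe_sub, Pi.sub_apply, coeff_mon_zero]
  refine Finset.sum_eq_zero fun y _ => ?_
  rw [trivialWeight_of_left (by omega), trivialWeight_of_right (by omega), sub_self]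

theorem signedDet_zero (ε : Fin 4 → ℂ) : signedDet ε 0 = 1 := by simp [signedDet]

/-- Each box contributes a difference of two weights whose ratio is `q_1 q_2 q_3`; the signs cancel.
-/
theorem signedDet_tailChar (ε : Fin 4 → ℂ) (p : ℤ × ℤ × ℤ) (rho : YoungDiagram) :
    signedDet ε (tailChar p rho) = Complex.exp (ε 0 + ε 1 + ε 2) ^ rho.card := by
  have h : ∀ s : Finset (ℕ × ℕ), signedDet ε (∑ y ∈ s,
      (mon (p.1 + y.1 + 1) (p.2.1 + y.2 + 1) (p.2.2 + 1) - mon (p.1 + y.1) (p.2.1 + y.2) p.2.2))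
      = Complex.exp (ε 0 + ε 1 + ε 2) ^ s.card := fun s => by
    classical
    induction s using Finset.induction_on with
    | empty => simp [signedDet_zero]
    | insert y s hy ih =>
      rw [Finset.sum_insert hy, Finset.card_insert_of_notMem hy, signedDet_add, ih, signedDet_sub,
        signedDet_mon, signedDet_mon, neg_div_neg_eq, ← Complex.exp_sub, pow_succ, mul_comm]
      congr 2
      simp [weight]
      ring
  rw [tailChar_eq, h]

/-- The four corners of a parallelogram with alternating signs have trivial determinant and rank
zero. This applies to `layerChar`, since both of its terms contain two factors `1 - x`. -/
theorem signedDet_eq_one_of_square (ε : Fin 4 → ℂ) (i j k i' j' k' : ℤ) (X : Character) :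
    signedDet ε ((1 - mon i j k) * (1 - mon i' j' k') * X) = 1 := by
  induction X using character_induction with
  | h0 a b c =>
    have : (1 - mon i j k) * (1 - mon i' j' k') * mon a b c
        = mon a b c - mon (i + a) (j + b) (k + c)
          - (mon (i' + a) (j' + b) (k' + c) - mon (i + i' + a) (j + j' + b) (k + k' + c)) := by
      simp only [sub_mul, mul_sub, one_mul, mul_one, mon_mul]
    rw [this]
    simp only [signedDet_sub, signedDet_mon, neg_div_neg_eq, ← Complex.exp_sub]
    rw [← Complex.exp_zero]
    congr 1
    simp [weight]
    ring
  | hadd X Y hX hY => rw [mul_add, signedDet_add, hX, hY, one_mul]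
  | hneg X hX => rw [mul_neg, signedDet_neg, hX, inv_one]

theorem signedDet_layerChar (ε : Fin 4 → ℂ) (p : ℤ × ℤ × ℤ) (rho rho' : YoungDiagram) :
    signedDet ε (layerChar p rho rho') = 1 := by
  have h : ∀ X, dualHom (chP {0, 1, 2}) * X = (1 - mon (-1) (-0) (-0)) * (1 - mon (-0) (-1) (-0))
      * (dualHom (1 - mon 0 0 1) * X) := fun X => by
    rw [chP_012, map_mul, map_mul, map_sub, map_sub, map_one, dualHom_mon, dualHom_mon, mul_assoc]
  rw [layerChar, signedDet_add, signedDet_neg, chP_23, map_mul, map_sub, map_sub, map_one,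
    dualHom_mon, dualHom_mon, signedDet_eq_one_of_square, h, signedDet_eq_one_of_square]
  simp
/-! ### Contractions of layers -/

theorem Lambda4_fst (ε : Fin 4 → ℂ) (u : ℂ) (c : ℤ × ℤ × ℤ) (rho : YoungDiagram)
    {n : ℤ} (hn : n ≠ 0) : (Lambda4 ε (u + weight ε c) rho).1 n
      = Complex.exp (-(n * u)) * Complex.exp (-(n * weight ε c))
        * (1 / P ε {0, 1} (-n) - ev ε (-n) (chK4 rho)) := by
  have h1 : ∀ w, Complex.exp (-(n * (u + w))) = Complex.exp (-(n * u)) * Complex.exp (-(n * w)) :=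
    fun w => by rw [← Complex.exp_add]; congr 1; ring
  have h2 : ∀ x : ℕ × ℕ, Complex.exp (-(n * (u + weight ε c + x.1 * ε 0 + x.2 * ε 1)))
      = Complex.exp (-(n * u)) * Complex.exp (-(n * weight ε c)) * ev ε (-n) (mon x.1 x.2 0) :=
    fun x => by
      rw [ev_mon, ← Complex.exp_add, ← Complex.exp_add]; congr 1; simp [weight]; ring
  simp only [Lambda4, currentX, currentA, Prod.fst_sub, Prod.fst_sum, Pi.sub_apply,
    Finset.sum_apply, osc, if_neg hn, h1, h2, P, Finset.prod_empty, div_one, chK4, map_sum,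
    ← Finset.mul_sum]
  ring

theorem P_univ (ε : Fin 4 → ℂ) (n : ℤ) : P ε univ n = P ε {0, 1} n * P ε {2, 3} n := by
  simp [P, Fin.prod_univ_four, mul_assoc]

theorem P_univ' (ε : Fin 4 → ℂ) (n : ℤ) : P ε univ n = P ε {0, 1, 2} n * P ε {3} n := by
  simp [P, Fin.prod_univ_four, mul_assoc]

theorem qpow_neg (ε : Fin 4 → ℂ) (a : Fin 4) (n : ℤ) : qpow ε a (-n) = (qpow ε a n)⁻¹ := by
  rw [qpow, qpow, ← Complex.exp_neg]; congr 1; push_cast; ring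

theorem qpow_ne_zero (ε : Fin 4 → ℂ) (a : Fin 4) (n : ℤ) : qpow ε a n ≠ 0 :=
  Complex.exp_ne_zero _

theorem Generic.qpow_three {ε : Fin 4 → ℂ} (hε : Generic ε) (n : ℤ) :
    qpow ε 3 n = (qpow ε 0 n * qpow ε 1 n * qpow ε 2 n)⁻¹ := by
  have h := hε.1
  rw [Fin.sum_univ_four] at h
  rw [qpow, qpow, qpow, qpow, ← Complex.exp_add, ← Complex.exp_add, ← Complex.exp_neg]
  congr 1
  linear_combination (n : ℂ) * h

theorem Generic.P_univ_neg {ε : Fin 4 → ℂ} (hε : Generic ε) (n : ℤ) :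
    P ε univ (-n) = P ε univ n := by
  have h0 := qpow_ne_zero ε 0 n
  have h1 := qpow_ne_zero ε 1 n
  have h2 := qpow_ne_zero ε 2 n
  simp only [P, Fin.prod_univ_four, qpow_neg, hε.qpow_three]
  field_simp
  ring

/-- Since `q_1 q_2 q_3 q_4 = 1`, one has `P_123^{[-n]} = -q_4^n P_123^{[n]}`. The contraction of two
boxes, governed by `P_1234`, thus splits into two dual halves governed by `P_123`, as in the D6
character. -/
theorem Generic.P_add_P_neg {ε : Fin 4 → ℂ} (hε : Generic ε) (n : ℤ) :
    P ε {0, 1, 2} n + P ε {0, 1, 2} (-n) = P ε univ n := by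
  have h0 := qpow_ne_zero ε 0 n
  have h1 := qpow_ne_zero ε 1 n
  have h2 := qpow_ne_zero ε 2 n
  rw [P_univ']
  simp [P, qpow_neg, hε.qpow_three]
  field_simp
  ring

theorem ev_mon_weight (ε : Fin 4 → ℂ) (n : ℤ) (c : ℤ × ℤ × ℤ) :
    ev ε n (mon c.1 c.2.1 c.2.2) = Complex.exp (n * weight ε c) := ev_mon ε n _ _ _

/-- The character of the contraction of two layers, relative to their highest weights. -/
def pairChar (c c' : ℤ × ℤ × ℤ) (rho rho' : YoungDiagram) : Character :=
  layerChar (c' - c) rho rho' + dualHom (layerChar (c - c') rho' rho)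

theorem ev_pairChar {ε : Fin 4 → ℂ} (hε : Generic ε) (n : ℤ) (c c' : ℤ × ℤ × ℤ)
    (rho rho' : YoungDiagram) : ev ε (-n) (pairChar c c' rho rho')
      = Complex.exp (n * weight ε c) * Complex.exp (-(n * weight ε c'))
        * (-(P ε {2, 3} n * ev ε (-n) (chK4 rho')) - P ε {2, 3} (-n) * ev ε n (chK4 rho)
          + P ε univ n * (ev ε n (chK4 rho) * ev ε (-n) (chK4 rho'))) := by
  have h1 : Complex.exp (((-n : ℤ) : ℂ) * weight ε (c' - c))
      = Complex.exp (n * weight ε c) * Complex.exp (-(n * weight ε c')) := by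
    rw [← Complex.exp_add, sub_eq_add_neg, weight_add, weight_neg]
    congr 1; push_cast; ring
  have h2 : Complex.exp ((n : ℂ) * weight ε (c - c'))
      = Complex.exp (n * weight ε c) * Complex.exp (-(n * weight ε c')) := by
    rw [← Complex.exp_add, sub_eq_add_neg, weight_add, weight_neg]
    congr 1; ring
  rw [← hε.P_add_P_neg]
  simp only [pairChar, layerChar, map_add, map_neg, map_mul, ev_dualHom, neg_neg, ev_chP hε,
    dualHom_dualHom, ev_mon_weight, h1, h2]
  ring

/-- Each layer has modes proportional to `1 / P_12 - K`. The product of the two vacuum parts is the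
one-loop term; the cross terms and the box-box term make up `pairChar`. -/
theorem contraction_Lambda4 {ε : Fin 4 → ℂ} (hε : Generic ε) (u : ℂ) (c c' : ℤ × ℤ × ℤ)
    (rho rho' : YoungDiagram) {n : ℕ} (hn : 0 < n) :
    contraction ε (Lambda4 ε (u + weight ε c') rho') (Lambda4 ε (u + weight ε c) rho) n
      = loopLog ε {0, 1} {0, 1} (u + weight ε c) (u + weight ε c') n
        + -(1 / (n : ℂ)) * ev ε (-n) (pairChar c c' rho rho') := by
  have hn' : (n : ℤ) ≠ 0 := by exact_mod_cast hn.ne'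
  have hS : ({0, 1} : Finset (Fin 4))ᶜ = {2, 3} := by decide
  have he : Complex.exp (n * (u + weight ε c - (u + weight ε c')))
      = Complex.exp (n * weight ε c) * Complex.exp (-(n * weight ε c')) := by
    rw [← Complex.exp_add]; congr 1; ring
  have hu : Complex.exp (-(((-n : ℤ) : ℂ) * u)) = (Complex.exp (-(((n : ℤ) : ℂ) * u)))⁻¹ := by
    rw [← Complex.exp_neg]; congr 1; push_cast; ring
  have h1 := hε.P_ne_zero {0, 1} hn'
  have h2 := hε.P_ne_zero {0, 1} (neg_ne_zero.2 hn')
  have h3 := hε.P_ne_zero {2, 3} hn'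
  have h4 := hε.P_univ_neg n
  rw [P_univ, P_univ] at h4
  rw [contraction, Lambda4_fst ε _ _ _ hn', Lambda4_fst ε _ _ _ (neg_ne_zero.2 hn'), loopLog,
    hS, he, ev_pairChar hε, heis, hu, P_univ]
  have h5 := Complex.exp_ne_zero (-(((n : ℤ) : ℂ) * u))
  have h6 : Complex.exp (-(((-n : ℤ) : ℂ) * weight ε c)) = Complex.exp (n * weight ε c) := by
    congr 1; push_cast; ring
  have h7 : Complex.exp (-(((n : ℤ) : ℂ) * weight ε c')) = Complex.exp (-(n * weight ε c')) := by
    congr 1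
  have hnc : (n : ℂ) ≠ 0 := by exact_mod_cast hn.ne'
  rw [h6, h7, neg_neg]
  have h8 : P ε {2, 3} (-n) = P ε {0, 1} n * P ε {2, 3} n / P ε {0, 1} (-n) := by
    rw [eq_div_iff h2, ← h4]; ring
  rw [h8]
  push_cast
  field_simp
  ring

theorem ev_tailChar {ε : Fin 4 → ℂ} (hε : Generic ε) (n : ℤ) (c c' : ℤ × ℤ × ℤ)
    (rho : YoungDiagram) : ev ε (-n) (dualHom (tailChar (c - c') rho))
      = -(Complex.exp (n * weight ε c) * Complex.exp (-(n * weight ε c'))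
        * (P ε {3} (-n) * ev ε n (chK4 rho))) := by
  have h2 : Complex.exp ((n : ℂ) * weight ε (c - c'))
      = Complex.exp (n * weight ε c) * Complex.exp (-(n * weight ε c')) := by
    rw [← Complex.exp_add, sub_eq_add_neg, weight_add, weight_neg]
    congr 1; ring
  simp only [tailChar, map_neg, map_mul, ev_dualHom, neg_neg, ev_chP hε, ev_mon_weight, h2]
  ring

/-- The tail carries no boxes, so beyond the one-loop term only one cross term remains. -/
theorem contraction_currentW {ε : Fin 4 → ℂ} (hε : Generic ε) (u : ℂ) (c c' : ℤ × ℤ × ℤ)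
    (rho : YoungDiagram) {n : ℕ} (hn : 0 < n) :
    contraction ε (currentW ε (u + weight ε c')) (Lambda4 ε (u + weight ε c) rho) n
      = loopLog ε {0, 1} {0, 1, 2} (u + weight ε c) (u + weight ε c') n
        + -(1 / (n : ℂ)) * ev ε (-n) (dualHom (tailChar (c - c') rho)) := by
  have hn' : (n : ℤ) ≠ 0 := by exact_mod_cast hn.ne'
  have hS : ({0, 1} : Finset (Fin 4))ᶜ = {2, 3} := by decide
  have hS' : ({0, 1, 2} : Finset (Fin 4))ᶜ = {3} := by decide
  have he : Complex.exp (n * (u + weight ε c - (u + weight ε c')))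
      = Complex.exp (n * weight ε c) * Complex.exp (-(n * weight ε c')) := by
    rw [← Complex.exp_add]; congr 1; ring
  have hu : Complex.exp (-(((-n : ℤ) : ℂ) * u)) = (Complex.exp (-(((n : ℤ) : ℂ) * u)))⁻¹ := by
    rw [← Complex.exp_neg]; congr 1; push_cast; ring
  have hw : (currentW ε (u + weight ε c')).1 n = Complex.exp (-(((n : ℤ) : ℂ) * u))
      * Complex.exp (-(n * weight ε c')) / P ε {0, 1, 2} (-n) := by
    simp only [currentW, osc, if_neg hn']
    rw [← Complex.exp_add]
    congr 2; push_cast; ring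
  have h1 := hε.P_ne_zero {0, 1} hn'
  have h2 := hε.P_ne_zero {0, 1, 2} (neg_ne_zero.2 hn')
  have h3 := hε.P_ne_zero {2, 3} hn'
  have h4 := hε.P_univ_neg n
  rw [P_univ', P_univ] at h4
  rw [contraction, hw, Lambda4_fst ε _ _ _ (neg_ne_zero.2 hn'), loopLog,
    hS, hS', he, ev_tailChar hε, heis, hu, P_univ]
  have h5 := Complex.exp_ne_zero (-(((n : ℤ) : ℂ) * u))
  have h6 : Complex.exp (-(((-n : ℤ) : ℂ) * weight ε c)) = Complex.exp (n * weight ε c) := by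
    congr 1; push_cast; ring
  have hnc : (n : ℂ) ≠ 0 := by exact_mod_cast hn.ne'
  rw [h6, neg_neg]
  have h8 : P ε {3} (-n) = P ε {0, 1} n * P ε {2, 3} n / P ε {0, 1, 2} (-n) := by
    rw [eq_div_iff h2, ← h4]; ring
  rw [h8]
  push_cast
  field_simp
  ring

/-! ### Zero modes -/

theorem zeroModeVector_Lambda4 (ε : Fin 4 → ℂ) (u : ℂ) (rho : YoungDiagram) :
    zeroModeVector (Lambda4 ε u rho) = 0 := by
  simp [zeroModeVector, Lambda4, currentX, currentA, Prod.snd_sum]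

theorem Lambda4_snd (ε : Fin 4 → ℂ) (u : ℂ) (rho : YoungDiagram) :
    (Lambda4 ε u rho).2 = ![-(rho.card : ℂ), ε 2 * ε 3, 0, 0] := by
  funext i
  fin_cases i <;> simp [Lambda4, currentX, currentA, Prod.snd_sum]

/-- Only the tail translates `t`, by `-ε 3`, and every box to its right carries `exp (-t)`. The
result is `q_4` per box after exponentiation. -/
theorem zeroModeCross_layerExponent (ε : Fin 4 → ℂ) (u : ℂ) (y : ℕ → ℂ) (N : ℕ)
    (rho : ℕ → YoungDiagram) : zeroModeCross (layerExponent ε u y N rho) (N + 1)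
      = ε 3 * (∑ k ∈ range N, (rho k).card : ℕ) := by
  rw [zeroModeCross, Finset.sum_range_succ, Finset.sum_eq_zero, zero_add]
  · rw [layerExponent, if_neg (lt_irrefl N), zeroModePairing, zeroModeVector]
    have h : ∀ k ∈ range N, layerExponent ε u y N rho k = Lambda4 ε (y k) (rho k) :=
      fun k hk => if_pos (Finset.mem_range.1 hk)
    rw [Finset.sum_congr rfl h, Prod.snd_sum]
    simp only [Lambda4_snd, Finset.sum_apply, currentW]
    simp [Finset.mul_sum, mul_comm]
  · intro j hj
    rw [layerExponent, if_pos (Finset.mem_range.1 hj), zeroModeVector_Lambda4]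
    simp [zeroModePairing]

/-! ### The continuation of the matrix elements of a layering -/

theorem hasLog_oneLoop (ε : Fin 4 → ℂ) (u : ℂ) (y : ℕ → ℂ) (N : ℕ) :
    HasLog (oneLoop ε u y N)
      ((∑ j ∈ range N, ∑ i ∈ range j, spread (j - i) (loopLog ε {0, 1} {0, 1} (y i) (y j)))
        + ∑ i ∈ range N, spread (N - i) (loopLog ε {0, 1} {0, 1, 2} (y i) (u + N * ε 2))) := by
  refine hasLog_exp_subst ?_
  simp [constantCoeff_spread]

/-- After division by the one-loop factor the contractions become explicit rational functions of
`s`. The two sign hypotheses say that none has a pole at `s = 1`; their values there are indices,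
possibly zero. -/
theorem continuesTo_vertexChain {ε : Fin 4 → ℂ} (hε : Generic ε) (u : ℂ) (c : ℕ → ℤ × ℤ × ℤ)
    (N : ℕ) (rho : ℕ → YoungDiagram)
    (hpair : ∀ j < N, ∀ i < j, 0 ≤ (pairChar (c i) (c j) (rho i) (rho j)).coeff 0)
    (htail : ∀ i < N, 0 ≤ (dualHom (tailChar (c i - (0, 0, (N : ℤ))) (rho i))).coeff 0)
    (v : Fock) (m : ℕ →₀ ℕ) (z : ℂ × ℂ) :
    ContinuesTo (PowerSeries.mk (fun d => MvPowerSeries.coeff m (vertexChain ε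
          (layerExponent ε u (fun k => u + weight ε (c k)) N rho) v (N + 1) d) z)
        * (oneLoop ε u (fun k => u + weight ε (c k)) N)⁻¹)
      ((∏ j ∈ range N, ∏ i ∈ range j, index ε (pairChar (c i) (c j) (rho i) (rho j)))
        * (∏ i ∈ range N, index ε (dualHom (tailChar (c i - (0, 0, (N : ℤ))) (rho i))))
        * Complex.exp (ε 3 * (∑ k ∈ range N, (rho k).card : ℕ))
        * MvPowerSeries.coeff m (vertexOp ε (∑ k ∈ range (N + 1),
            layerExponent ε u (fun k => u + weight ε (c k)) N rho k) v) z) := by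
  set y : ℕ → ℂ := fun k => u + weight ε (c k) with hy
  set e := layerExponent ε u y N rho with he
  obtain ⟨K, hK, hchain⟩ := coeff_vertexChain ε e (N + 1)
  obtain ⟨q, hq, hq1⟩ := hchain v m z
  have hW : u + N * ε 2 = u + weight ε (0, 0, (N : ℤ)) := by simp [weight]
  choose g hg hg' using fun (r : {r : ℕ // 0 < r}) (X : Character) => hasLog_index (ε := ε) r.1 r.2 X
  have hg0 : ∀ r : ℕ, 0 < r → ∀ X, ∃ g, HasLog (indexDen ε r X : PowerSeries ℂ) g ∧
      HasLog (indexNum ε r X : PowerSeries ℂ)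
        (g + spread r fun n => -(1 / (n : ℂ)) * ev ε (-n) X) :=
    fun r hr X => ⟨g ⟨r, hr⟩ X, hg ⟨r, hr⟩ X, hg' ⟨r, hr⟩ X⟩
  clear hg hg' g
  choose! g hg using hg0
  set C : ℕ → ℕ → Character := fun i j => pairChar (c i) (c j) (rho i) (rho j) with hC
  set T : ℕ → Character := fun i => dualHom (tailChar (c i - (0, 0, (N : ℤ))) (rho i)) with hT
  set num : Polynomial ℂ := (∏ j ∈ range N, ∏ i ∈ range j, indexNum ε (j - i) (C i j))
    * ∏ i ∈ range N, indexNum ε (N - i) (T i) with hnum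
  set den : Polynomial ℂ := (∏ j ∈ range N, ∏ i ∈ range j, indexDen ε (j - i) (C i j))
    * ∏ i ∈ range N, indexDen ε (N - i) (T i) with hden
  have hcoe : ∀ f : ℕ → Character → Polynomial ℂ,
      (((∏ j ∈ range N, ∏ i ∈ range j, f (j - i) (C i j)) * ∏ i ∈ range N, f (N - i) (T i) :
        Polynomial ℂ) : PowerSeries ℂ)
      = (∏ j ∈ range N, ∏ i ∈ range j, (f (j - i) (C i j) : PowerSeries ℂ))
        * ∏ i ∈ range N, (f (N - i) (T i) : PowerSeries ℂ) := fun f => by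
    simp only [← Polynomial.coeToPowerSeries.ringHom_apply, map_mul, map_prod]
  have hsub : ∀ {i j : ℕ}, i ∈ range j → 0 < j - i := fun h => by
    have := Finset.mem_range.1 h; omega
  have hlogden : HasLog (den : PowerSeries ℂ)
      ((∑ j ∈ range N, ∑ i ∈ range j, g (j - i) (C i j)) + ∑ i ∈ range N, g (N - i) (T i)) := by
    rw [hden, hcoe]
    exact (HasLog.prod _ _ _ fun j _ => HasLog.prod _ _ _ fun i hi => (hg _ (hsub hi) _).1).mul
      (HasLog.prod _ _ _ fun i hi => (hg _ (hsub hi) _).1)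
  have hlognum : HasLog (num : PowerSeries ℂ)
      ((∑ j ∈ range N, ∑ i ∈ range j, (g (j - i) (C i j)
          + spread (j - i) fun n => -(1 / (n : ℂ)) * ev ε (-n) (C i j)))
        + ∑ i ∈ range N, (g (N - i) (T i)
          + spread (N - i) fun n => -(1 / (n : ℂ)) * ev ε (-n) (T i))) := by
    rw [hnum, hcoe]
    exact (HasLog.prod _ _ _ fun j _ => HasLog.prod _ _ _ fun i hi => (hg _ (hsub hi) _).2).mul
      (HasLog.prod _ _ _ fun i hi => (hg _ (hsub hi) _).2)
  have hKlog : (∑ j ∈ range (N + 1), ∑ i ∈ range j, spread (j - i) (contraction ε (e j) (e i)))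
      = (∑ j ∈ range N, ∑ i ∈ range j, (spread (j - i) (loopLog ε {0, 1} {0, 1} (y i) (y j))
          + spread (j - i) fun n => -(1 / (n : ℂ)) * ev ε (-n) (C i j)))
        + ∑ i ∈ range N, (spread (N - i) (loopLog ε {0, 1} {0, 1, 2} (y i) (u + N * ε 2))
          + spread (N - i) fun n => -(1 / (n : ℂ)) * ev ε (-n) (T i)) := by
    rw [Finset.sum_range_succ]
    congr 1
    · refine Finset.sum_congr rfl fun j hj => Finset.sum_congr rfl fun i hi => ?_
      have hj' := Finset.mem_range.1 hj
      have hi' := Finset.mem_range.1 hi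
      rw [← spread_add]
      refine spread_congr (hsub hi) fun n hn => ?_
      rw [he, layerExponent, layerExponent, if_pos hj', if_pos (hi'.trans hj')]
      exact contraction_Lambda4 hε u _ _ _ _ hn
    · refine Finset.sum_congr rfl fun i hi => ?_
      have hi' := Finset.mem_range.1 hi
      rw [← spread_add]
      refine spread_congr (hsub hi) fun n hn => ?_
      rw [he, layerExponent, layerExponent, if_neg (lt_irrefl N), if_pos hi', hW]
      exact contraction_currentW hε u _ _ _ hn
  -- Both sides have the same logarithm, the one-loop terms cancelling.
  have hratio : (den : PowerSeries ℂ) * (K * (oneLoop ε u y N)⁻¹) = num := by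
    refine (hlogden.mul (hK.mul (hasLog_oneLoop ε u y N).inv)).unique ?_
    convert hlognum using 1
    rw [hKlog]
    simp only [Finset.sum_add_distrib]
    ring
  clear_value num den
  refine ⟨num * Polynomial.C (Complex.exp (zeroModeCross e (N + 1))) * q, den, ?_, ?_, ?_⟩
  · rw [hden, Polynomial.eval_mul, Polynomial.eval_prod, Polynomial.eval_prod]
    refine mul_ne_zero (Finset.prod_ne_zero_iff.2 fun j hj => ?_)
      (Finset.prod_ne_zero_iff.2 fun i hi => ?_)
    · rw [Polynomial.eval_prod]
      exact Finset.prod_ne_zero_iff.2 fun i hi => indexDen_eval_ne_zero hε _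
        (hpair j (Finset.mem_range.1 hj) i (Finset.mem_range.1 hi))
    · exact indexDen_eval_ne_zero hε _ (htail i (Finset.mem_range.1 hi))
  · rw [hq, Polynomial.coe_mul, Polynomial.coe_mul, Polynomial.coe_C, ← hratio]
    ring
  · have hdiv : num.eval 1 / den.eval 1
        = (∏ j ∈ range N, ∏ i ∈ range j, index ε (C i j)) * ∏ i ∈ range N, index ε (T i) := by
      simp only [hnum, hden, Polynomial.eval_mul, Polynomial.eval_prod]
      rw [mul_div_mul_comm]
      simp only [← Finset.prod_div_distrib, indexNum_div_indexDen]
    rw [← hdiv, Polynomial.eval_mul, Polynomial.eval_mul, Polynomial.eval_C, hq1,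
      zeroModeCross_layerExponent]
    ring
/-! ### Sums over Young diagrams and legs -/

theorem rowLen_zero_le_of_colLen {rho : YoungDiagram} {j : ℕ} (h : rho.rowLen 0 ≤ j) :
    rho.colLen j = 0 := by
  by_contra h0
  have := YoungDiagram.mem_iff_lt_rowLen.1
    (YoungDiagram.mem_iff_lt_colLen.2 (Nat.pos_of_ne_zero h0) : (0, j) ∈ rho)
  omega

theorem sum_cells_columns (rho : YoungDiagram) {N : ℕ} (hN : rho.rowLen 0 ≤ N) {M : Type*}
    [AddCommMonoid M] (F : ℕ × ℕ → M) :
    ∑ b ∈ rho.cells, F b = ∑ j ∈ range N, ∑ i ∈ range (rho.colLen j), F (i, j) := by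
  rw [sum_cells]
  refine Finset.sum_subset (Finset.range_subset_range.2 hN) fun j _ hj => ?_
  rw [rowLen_zero_le_of_colLen (by simpa using hj), Finset.range_zero, Finset.sum_empty]

theorem sum_cells_rows (rho : YoungDiagram) {N : ℕ} (hN : rho.colLen 0 ≤ N) {M : Type*}
    [AddCommMonoid M] (F : ℕ × ℕ → M) :
    ∑ b ∈ rho.cells, F b = ∑ i ∈ range N, ∑ j ∈ range (rho.rowLen i), F (i, j) := by
  have h := sum_cells_columns rho.transpose (N := N) (by simpa using hN) (fun b => F b.swap)
  simp only [YoungDiagram.colLen_transpose, Prod.swap_prod_mk] at h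
  rw [← h]
  refine Finset.sum_nbij' Prod.swap Prod.swap ?_ ?_ ?_ ?_ ?_
  · intro b hb
    rw [YoungDiagram.mem_cells, YoungDiagram.mem_transpose, Prod.swap_swap]
    exact hb
  · intro b hb
    rw [YoungDiagram.mem_cells, YoungDiagram.mem_transpose] at hb
    exact hb
  · intro b _; simp
  · intro b _; simp
  · intro b _; simp

theorem mem_legIntersection (lam mu : YoungDiagram) (a b c : ℕ) :
    (a, b, c) ∈ legIntersection lam mu ↔ (b, c) ∈ lam ∧ (c, a) ∈ mu := by
  simp only [legIntersection, Finset.mem_image, Finset.mem_filter, Finset.mem_product,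
    YoungDiagram.mem_cells, Prod.mk.injEq]
  constructor
  · rintro ⟨⟨⟨b', c'⟩, ⟨c'', a'⟩⟩, ⟨⟨h1, h2⟩, h3⟩, rfl, rfl, rfl⟩
    simp only at h3
    subst h3
    exact ⟨h1, h2⟩
  · rintro ⟨h1, h2⟩
    exact ⟨((b, c), (c, a)), ⟨⟨h1, h2⟩, rfl⟩, rfl, rfl, rfl⟩

theorem sum_legIntersection (lam mu : YoungDiagram) {N : ℕ} (hN : lam.rowLen 0 ≤ N) {M : Type*}
    [AddCommMonoid M] (F : ℕ × ℕ × ℕ → M) :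
    ∑ x ∈ legIntersection lam mu, F x = ∑ c ∈ range N, ∑ b ∈ range (lam.colLen c),
      ∑ a ∈ range (mu.rowLen c), F (a, b, c) := by
  have h1 := sum_cells_columns lam hN fun b => ∑ a ∈ range (mu.rowLen b.2), F (a, b.1, b.2)
  rw [← h1, Finset.sum_sigma']
  refine Finset.sum_nbij' (fun x => ⟨(x.2.1, x.2.2), x.1⟩) (fun x => (x.2, x.1.1, x.1.2))
    ?_ ?_ ?_ ?_ ?_
  · rintro ⟨a, b, c⟩ h
    rw [mem_legIntersection] at h
    rw [Finset.mem_sigma, Finset.mem_range]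
    exact ⟨h.1, YoungDiagram.mem_iff_lt_rowLen.1 h.2⟩
  · rintro ⟨⟨b, c⟩, a⟩ h
    rw [Finset.mem_sigma, Finset.mem_range] at h
    rw [mem_legIntersection]
    exact ⟨h.1, YoungDiagram.mem_iff_lt_rowLen.2 h.2⟩
  · intro _ _; rfl
  · intro _ _; rfl
  · intro _ _; rfl

theorem geom_sum_mon (i j k : ℤ) (n : ℕ) :
    (1 - mon i j k) * ∑ l ∈ range n, mon (l * i) (l * j) (l * k)
      = 1 - mon (n * i) (n * j) (n * k) := by
  induction n with
  | zero => simp [mon_zero]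
  | succ n ih =>
    rw [Finset.sum_range_succ, mul_add, ih, sub_mul, one_mul, mon_mul]
    push_cast
    rw [show i + n * i = (n + 1) * i by ring, show j + n * j = (n + 1) * j by ring,
      show k + n * k = (n + 1) * k by ring]
    ring

/-- The weight of the corner of a layer. -/
def corner (lam mu : YoungDiagram) (k : ℕ) : ℤ × ℤ × ℤ := (mu.rowLen k, lam.colLen k, k)

/-- At each height the legs fill the quadrant at the origin minus the quadrant at the corner. With
`x`, `y` the two leg extents as monomials, this is `(1 - y) + (1 - x) - (1 - x)(1 - y) = 1 - x y`.
-/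
theorem chP12N_eq (lam mu : YoungDiagram) {N : ℕ} (h1 : lam.rowLen 0 ≤ N)
    (h2 : mu.colLen 0 ≤ N) : chP12N lam mu
      = ∑ k ∈ range N, (mon 0 0 k - mon (mu.rowLen k) (lam.colLen k) k) := by
  rw [chP12N, sum_cells_columns lam h1 fun b => mon 0 b.1 b.2,
    sum_cells_rows mu h2 fun b => mon b.2 0 b.1, sum_legIntersection lam mu h1,
    Finset.mul_sum, Finset.mul_sum, Finset.mul_sum, ← Finset.sum_add_distrib,
    ← Finset.sum_sub_distrib]
  refine Finset.sum_congr rfl fun k _ => ?_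
  have e1 : chP {1} = 1 - mon 0 1 0 := by simp [chP, chq_one]
  have e0 : chP {0} = 1 - mon 1 0 0 := by simp [chP, chq_zero]
  have g1 := geom_sum_mon 0 1 0 (lam.colLen k)
  have g0 := geom_sum_mon 1 0 0 (mu.rowLen k)
  simp only [mul_zero, mul_one] at g0 g1
  have s1 : ∑ b ∈ range (lam.colLen k), mon 0 b k
      = (∑ b ∈ range (lam.colLen k), mon 0 b 0) * mon 0 0 k := by
    rw [Finset.sum_mul]; simp [mon_mul]
  have s0 : ∑ a ∈ range (mu.rowLen k), mon a 0 k
      = (∑ a ∈ range (mu.rowLen k), mon a 0 0) * mon 0 0 k := by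
    rw [Finset.sum_mul]; simp [mon_mul]
  have s2 : ∑ b ∈ range (lam.colLen k), ∑ a ∈ range (mu.rowLen k), mon a b k
      = (∑ b ∈ range (lam.colLen k), mon 0 b 0) * (∑ a ∈ range (mu.rowLen k), mon a 0 0)
        * mon 0 0 k := by
    rw [Finset.sum_mul_sum, Finset.sum_mul]; simp [Finset.sum_mul, mon_mul]
  have s3 : mon (mu.rowLen k) (lam.colLen k) k
      = mon (mu.rowLen k) 0 0 * mon 0 (lam.colLen k) 0 * mon 0 0 k := by simp [mon_mul]
  rw [e1, e0, chP_01, s1, s0, s2, s3]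
  set A := mon (mu.rowLen k) 0 0
  set B := mon 0 (lam.colLen k) 0
  linear_combination (mon 0 0 k * (1 - (1 - mon 1 0 0) * ∑ a ∈ range (mu.rowLen k), mon a 0 0))
    * g1 + B * mon 0 0 k * g0

/-! ### The D6 partition function as a product over layers -/

theorem Z4_eq (ε : Fin 4 → ℂ) (rho : YoungDiagram) :
    Z4 ε rho = reducedIndex ε (layerChar 0 rho rho) := by
  rw [← index_eq_reducedIndex ε (coeff_layerChar_zero rho), Z4, layerChar]
  simp only [Prod.fst_zero, Prod.snd_zero, mon_zero, one_mul, ← dual_eq]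
  rw [mul_assoc]

/-- The dual half never contributes, since corners move inwards with height. The other half
contributes only for adjacent layers. -/
theorem coeff_pairChar_corner (lam mu : YoungDiagram) {i j : ℕ} (hij : i < j)
    (rho rho' : YoungDiagram) :
    (pairChar (corner lam mu i) (corner lam mu j) rho rho').coeff 0
      = if j = i + 1 then interlacing (mu.rowLen i - mu.rowLen j)
          (lam.colLen i - lam.colLen j) rho rho' else 0 := by
  have hm := mu.rowLen_anti i j hij.le
  have hl := lam.colLen_anti i j hij.le
  have h2 : (layerChar (corner lam mu i - corner lam mu j) rho' rho).coeff 0 = 0 :=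
    coeff_layerChar_of_neg (by simp [corner, hm]) (by simp [corner, hij]) _ _
  rw [pairChar, AddMonoidAlgebra.coeff_add, Finsupp.add_apply, coeff_dualHom, neg_zero, h2,
    add_zero]
  split_ifs with h
  · subst h
    rw [← coeff_layerChar_one]
    congr 3
    simp [corner, Nat.cast_sub hm, Nat.cast_sub hl]
  · exact coeff_layerChar_of_two_le (by simp [corner]; omega) _ _

theorem reducedIndex_pairChar {ε : Fin 4 → ℂ} (hε : Generic ε) (lam mu : YoungDiagram) {i j : ℕ}
    (hij : i < j) (rho rho' : YoungDiagram) :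
    reducedIndex ε (pairChar (corner lam mu i) (corner lam mu j) rho rho')
      = reducedIndex ε (layerChar (corner lam mu j - corner lam mu i) rho rho')
        * reducedIndex ε (layerChar (corner lam mu i - corner lam mu j) rho' rho) := by
  have hm := mu.rowLen_anti i j hij.le
  have h2 : (layerChar (corner lam mu i - corner lam mu j) rho' rho).coeff 0 = 0 :=
    coeff_layerChar_of_neg (by simp [corner, hm]) (by simp [corner, hij]) _ _
  rw [pairChar, reducedIndex_add hε, reducedIndex_dualHom ε h2, signedDet_layerChar, one_mul]

theorem coeff_tailChar_corner (lam mu : YoungDiagram) {i N : ℕ} (hi : i < N)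
    (rho : YoungDiagram) : (tailChar (corner lam mu i - (0, 0, (N : ℤ))) rho).coeff 0 = 0 :=
  coeff_tailChar (by simp [corner]) (by simp [corner, hi]) _

theorem prod_prod_range_eq (N : ℕ) (f : ℕ → ℕ → ℂ) :
    (∏ j ∈ range N, f j j) * ∏ j ∈ range N, ∏ i ∈ range j, f i j * f j i
      = ∏ i ∈ range N, ∏ j ∈ range N, f i j := by
  induction N with
  | zero => simp
  | succ N ih =>
    rw [Finset.prod_range_succ, Finset.prod_range_succ, Finset.prod_range_succ,
      Finset.prod_range_succ, Finset.prod_congr rfl fun i _ => Finset.prod_range_succ (f i) N,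
      Finset.prod_mul_distrib, Finset.prod_mul_distrib, ← ih]
    ring

/-- The condition for the layers to form a plane partition together with the legs. -/
def IsStacked (lam mu : YoungDiagram) (N : ℕ) (rho : ℕ → YoungDiagram) : Prop :=
  ∀ k, k + 1 < N → Interlaced (mu.rowLen k - mu.rowLen (k + 1))
    (lam.colLen k - lam.colLen (k + 1)) (rho k) (rho (k + 1))

/-- The product of the partition functions of the layers and of their contractions. -/
def layeringWeight (ε : Fin 4 → ℂ) (lam mu : YoungDiagram) (N : ℕ) (rho : ℕ → YoungDiagram) : ℂ :=
  (∏ k ∈ range N, Z4 ε (rho k))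
    * ((∏ j ∈ range N, ∏ i ∈ range j,
        index ε (pairChar (corner lam mu i) (corner lam mu j) (rho i) (rho j)))
      * (∏ i ∈ range N, index ε (dualHom (tailChar (corner lam mu i - (0, 0, (N : ℤ))) (rho i))))
      * Complex.exp (ε 3 * (∑ k ∈ range N, (rho k).card : ℕ)))

/-- One adjacent pair that fails to stack already gives a vanishing contraction. -/
theorem layeringWeight_eq_zero (ε : Fin 4 → ℂ) (lam mu : YoungDiagram) (N : ℕ)
    (rho : ℕ → YoungDiagram) (h : ¬ IsStacked lam mu N rho) :
    layeringWeight ε lam mu N rho = 0 := by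
  simp only [IsStacked, not_forall] at h
  obtain ⟨k, hk, h⟩ := h
  have h0 : ∏ j ∈ range N, ∏ i ∈ range j,
      index ε (pairChar (corner lam mu i) (corner lam mu j) (rho i) (rho j)) = 0 := by
    refine Finset.prod_eq_zero (Finset.mem_range.2 hk)
      (Finset.prod_eq_zero (Finset.mem_range.2 (Nat.lt_succ_self k)) (index_eq_zero ε ?_))
    rw [coeff_pairChar_corner lam mu (Nat.lt_succ_self k), if_pos rfl]
    exact fun h0 => h ((interlacing_eq_zero_iff _ _ _ _).1 h0)
  rw [layeringWeight, h0]
  simp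

theorem coeff_pairChar_corner_nonneg (lam mu : YoungDiagram) {i j : ℕ} (hij : i < j)
    (rho rho' : YoungDiagram) :
    0 ≤ (pairChar (corner lam mu i) (corner lam mu j) rho rho').coeff 0 := by
  rw [coeff_pairChar_corner lam mu hij]
  split_ifs
  · exact interlacing_nonneg _ _ _ _
  · exact le_rfl

theorem coeff_pairChar_of_isStacked {lam mu : YoungDiagram} {N : ℕ} {rho : ℕ → YoungDiagram}
    (h : IsStacked lam mu N rho) {i j : ℕ} (hij : i < j) (hj : j < N) :
    (pairChar (corner lam mu i) (corner lam mu j) (rho i) (rho j)).coeff 0 = 0 := by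
  rw [coeff_pairChar_corner lam mu hij]
  split_ifs with h1
  · subst h1
    exact (interlacing_eq_zero_iff _ _ _ _).2 (h i hj)
  · rfl

theorem layeringWeight_eq_reducedIndex {ε : Fin 4 → ℂ} (hε : Generic ε) (lam mu : YoungDiagram)
    (N : ℕ) (rho : ℕ → YoungDiagram) (h : IsStacked lam mu N rho) :
    layeringWeight ε lam mu N rho = reducedIndex ε
      (∑ i ∈ range N, ∑ j ∈ range N,
          layerChar (corner lam mu j - corner lam mu i) (rho i) (rho j)
        + ∑ i ∈ range N, tailChar (corner lam mu i - (0, 0, (N : ℤ))) (rho i)) := by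
  have h1 : ∏ j ∈ range N, ∏ i ∈ range j,
        index ε (pairChar (corner lam mu i) (corner lam mu j) (rho i) (rho j))
      = ∏ j ∈ range N, ∏ i ∈ range j,
        (reducedIndex ε (layerChar (corner lam mu j - corner lam mu i) (rho i) (rho j))
          * reducedIndex ε (layerChar (corner lam mu i - corner lam mu j) (rho j) (rho i))) := by
    refine Finset.prod_congr rfl fun j hj => Finset.prod_congr rfl fun i hi => ?_
    have hij := Finset.mem_range.1 hi
    rw [index_eq_reducedIndex ε (coeff_pairChar_of_isStacked h hij (Finset.mem_range.1 hj)),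
      reducedIndex_pairChar hε lam mu hij]
  -- Dualizing the tail characters costs `q_1 q_2 q_3 = q_4⁻¹` per box, which the zero-mode factor
  -- of `layeringWeight` cancels.
  have h2 : ∏ i ∈ range N,
        index ε (dualHom (tailChar (corner lam mu i - (0, 0, (N : ℤ))) (rho i)))
      = (∏ i ∈ range N, reducedIndex ε (tailChar (corner lam mu i - (0, 0, (N : ℤ))) (rho i)))
        * Complex.exp (-(ε 3 * (∑ k ∈ range N, (rho k).card : ℕ))) := by
    have h3 : Complex.exp (-(ε 3 * (∑ k ∈ range N, (rho k).card : ℕ)))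
        = ∏ k ∈ range N, Complex.exp (ε 0 + ε 1 + ε 2) ^ (rho k).card := by
      have hs := hε.1
      rw [Fin.sum_univ_four] at hs
      rw [Finset.prod_pow_eq_pow_sum, ← Complex.exp_nat_mul]
      congr 1
      linear_combination (-((∑ k ∈ range N, (rho k).card : ℕ) : ℂ)) * hs
    rw [h3, ← Finset.prod_mul_distrib]
    refine Finset.prod_congr rfl fun i hi => ?_
    have h0 := coeff_tailChar_corner lam mu (Finset.mem_range.1 hi) (rho i)
    have h0' : (dualHom (tailChar (corner lam mu i - (0, 0, (N : ℤ))) (rho i))).coeff 0 = 0 := by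
      rw [coeff_dualHom, neg_zero, h0]
    rw [index_eq_reducedIndex ε h0', reducedIndex_dualHom ε h0, signedDet_tailChar, mul_comm]
  have h3 : ∏ k ∈ range N, Z4 ε (rho k) = ∏ k ∈ range N,
      reducedIndex ε (layerChar (corner lam mu k - corner lam mu k) (rho k) (rho k)) :=
    Finset.prod_congr rfl fun k _ => by rw [Z4_eq, sub_self]
  rw [layeringWeight, h1, h2, h3, reducedIndex_add hε, reducedIndex_sum hε, reducedIndex_sum hε]
  simp only [reducedIndex_sum hε]
  rw [← prod_prod_range_eq N fun i j =>
    reducedIndex ε (layerChar (corner lam mu j - corner lam mu i) (rho i) (rho j))]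
  rw [mul_assoc _ _ (Complex.exp (ε 3 * _)), mul_assoc (∏ i ∈ range N, _) _ (Complex.exp (ε 3 * _)),
    ← Complex.exp_add, neg_add_cancel, Complex.exp_zero, mul_one, mul_assoc]

theorem coeff_sum_layerChar {lam mu : YoungDiagram} {N : ℕ} {rho : ℕ → YoungDiagram}
    (h : IsStacked lam mu N rho) :
    (∑ i ∈ range N, ∑ j ∈ range N,
          layerChar (corner lam mu j - corner lam mu i) (rho i) (rho j)
        + ∑ i ∈ range N, tailChar (corner lam mu i - (0, 0, (N : ℤ))) (rho i)).coeff 0 = 0 := by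
  simp only [AddMonoidAlgebra.coeff_add, AddMonoidAlgebra.coeff_sum, Finsupp.add_apply,
    Finsupp.coe_finsetSum, Finset.sum_apply]
  have hneg : ∀ {i j : ℕ}, i < j →
      (layerChar (corner lam mu i - corner lam mu j) (rho j) (rho i)).coeff 0 = 0 := fun {i j} hij =>
    coeff_layerChar_of_neg (by simp [corner, mu.rowLen_anti i j hij.le])
      (by simp [corner, hij]) _ _
  rw [Finset.sum_eq_zero fun i hi => coeff_tailChar_corner lam mu (Finset.mem_range.1 hi) (rho i),
    add_zero]
  refine Finset.sum_eq_zero fun i _ => Finset.sum_eq_zero fun j hj => ?_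
  rcases lt_trichotomy i j with hij | rfl | hij
  · have h1 := coeff_pairChar_of_isStacked h hij (Finset.mem_range.1 hj)
    rwa [pairChar, AddMonoidAlgebra.coeff_add, Finsupp.add_apply, coeff_dualHom, neg_zero,
      hneg hij, add_zero] at h1
  · rw [sub_self]; exact coeff_layerChar_zero _
  · exact hneg hij

/-- The double sum produces the quadratic term and the interaction of `K` with the corners. The
corners differ from the legs by `∑ q_3^k`, which with the tail term reconstitutes `-P_4^∨ K`. -/
theorem Z6_character_eq {lam mu : YoungDiagram} {N : ℕ} (h1 : lam.rowLen 0 ≤ N)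
    (h2 : mu.colLen 0 ≤ N) (rho : ℕ → YoungDiagram) (K : Character)
    (hK : K = ∑ k ∈ range N, mon (mu.rowLen k) (lam.colLen k) k * chK4 (rho k)) :
    -(dual (chP {3}) * K) + dual (chP {2, 3} * chP12N lam mu) * K
        + dual (chP {0, 1, 2}) * dual K * K
      = ∑ i ∈ range N, ∑ j ∈ range N,
          layerChar (corner lam mu j - corner lam mu i) (rho i) (rho j)
        + ∑ i ∈ range N, tailChar (corner lam mu i - (0, 0, (N : ℤ))) (rho i) := by
  set c : ℕ → Character := fun k => mon (mu.rowLen k) (lam.colLen k) k with hc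
  have hpair : ∀ i j, layerChar (corner lam mu j - corner lam mu i) (rho i) (rho j)
      = -(dualHom (chP {2, 3}) * (dualHom (c i) * (c j * chK4 (rho j))))
        + dualHom (chP {0, 1, 2}) * (dualHom (c i * chK4 (rho i)) * (c j * chK4 (rho j))) := by
    intro i j
    have : mon (corner lam mu j - corner lam mu i).1 (corner lam mu j - corner lam mu i).2.1
        (corner lam mu j - corner lam mu i).2.2 = dualHom (c i) * c j := by
      rw [hc, dualHom_mon, mon_mul]
      simp only [corner, Prod.fst_sub, Prod.snd_sub]
      ring_nf
    rw [layerChar, this, map_mul]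
    ring
  have htail : ∀ i, tailChar (corner lam mu i - (0, 0, (N : ℤ))) (rho i)
      = -(dualHom (chP {3}) * (dualHom (mon 0 0 N) * (c i * chK4 (rho i)))) := by
    intro i
    have : mon (corner lam mu i - (0, 0, (N : ℤ))).1 (corner lam mu i - (0, 0, (N : ℤ))).2.1
        (corner lam mu i - (0, 0, (N : ℤ))).2.2 = dualHom (mon 0 0 N) * c i := by
      rw [hc, dualHom_mon, mon_mul]
      simp only [corner, Prod.fst_sub, Prod.snd_sub]
      ring_nf
    rw [tailChar, this]
    ring
  have hg := geom_sum_mon 0 0 1 N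
  simp only [mul_zero, mul_one] at hg
  have hN : chP12N lam mu = ∑ k ∈ range N, mon 0 0 k - ∑ k ∈ range N, c k := by
    rw [chP12N_eq lam mu h1 h2, Finset.sum_sub_distrib]
  have hP : chP {2, 3} * (∑ k ∈ range N, mon 0 0 k) = chP {3} * (1 - mon 0 0 N) := by
    rw [chP_23, chP_3, ← hg]; ring
  have hP' := congrArg dualHom hP
  rw [map_mul, map_mul, map_sub, map_one] at hP'
  have hK' : ∑ i ∈ range N, c i * chK4 (rho i) = K := hK.symm
  have hS : ∑ i ∈ range N, ∑ j ∈ range N,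
        layerChar (corner lam mu j - corner lam mu i) (rho i) (rho j)
      = -(dualHom (chP {2, 3}) * (dualHom (∑ i ∈ range N, c i) * K))
        + dualHom (chP {0, 1, 2}) * (dualHom K * K) := by
    simp only [hpair, Finset.sum_add_distrib, Finset.sum_neg_distrib, ← Finset.mul_sum]
    simp only [← Finset.sum_mul, ← map_sum, hK']
  have hT : ∑ i ∈ range N, tailChar (corner lam mu i - (0, 0, (N : ℤ))) (rho i)
      = -(dualHom (chP {3}) * (dualHom (mon 0 0 N) * K)) := by
    simp only [htail, Finset.sum_neg_distrib, ← Finset.mul_sum]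
    rw [← hK]
  rw [hS, hT, hN]
  simp only [dual_eq, map_mul, map_sub]
  linear_combination K * hP'

theorem layeringWeight_eq_Z6 {ε : Fin 4 → ℂ} (hε : Generic ε) {lam mu : YoungDiagram} {N : ℕ}
    (h1 : lam.rowLen 0 ≤ N) (h2 : mu.colLen 0 ≤ N) {rho : ℕ → YoungDiagram}
    (h : IsStacked lam mu N rho) (π : Finset (ℕ × ℕ × ℕ))
    (hK : chK6 π = ∑ k ∈ range N, mon (mu.rowLen k) (lam.colLen k) k * chK4 (rho k)) :
    layeringWeight ε lam mu N rho = Z6 ε lam mu π := by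
  rw [layeringWeight_eq_reducedIndex hε lam mu N rho h,
    ← index_eq_reducedIndex ε (coeff_sum_layerChar h), Z6, Z6_character_eq h1 h2 rho _ hK]
/-! ### Plane partitions with legs as sequences of layers -/

theorem mem_boundaryBoxes (lam mu : YoungDiagram) (a b c : ℕ) :
    (a, b, c) ∈ boundaryBoxes lam mu ↔ b < lam.colLen c ∨ a < mu.rowLen c := by
  rw [← YoungDiagram.mem_iff_lt_colLen, ← YoungDiagram.mem_iff_lt_rowLen]
  rfl

/-- The set of boxes with given layers, each translated to its corner. -/
def fromLayers (lam mu : YoungDiagram) (N : ℕ) (rho : ℕ → YoungDiagram) : Finset (ℕ × ℕ × ℕ) :=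
  (range N).biUnion fun k => (rho k).cells.image fun x => (x.1 + mu.rowLen k, x.2 + lam.colLen k, k)

theorem sum_fromLayers (lam mu : YoungDiagram) (N : ℕ) (rho : ℕ → YoungDiagram) {M : Type*}
    [AddCommMonoid M] (F : ℕ × ℕ × ℕ → M) : ∑ x ∈ fromLayers lam mu N rho, F x
      = ∑ k ∈ range N, ∑ x ∈ (rho k).cells, F (x.1 + mu.rowLen k, x.2 + lam.colLen k, k) := by
  rw [fromLayers, Finset.sum_biUnion]
  · refine Finset.sum_congr rfl fun k _ => Finset.sum_image fun x _ y _ h => ?_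
    simp only [Prod.mk.injEq, add_left_inj, and_true] at h
    exact Prod.ext h.1 h.2
  · intro k _ l _ hkl
    rw [Function.onFun, Finset.disjoint_left]
    intro x hx hy
    obtain ⟨_, _, rfl⟩ := Finset.mem_image.1 hx
    obtain ⟨_, _, h⟩ := Finset.mem_image.1 hy
    simp only [Prod.mk.injEq] at h
    exact hkl h.2.2.symm

theorem mem_fromLayers (lam mu : YoungDiagram) (N : ℕ) (rho : ℕ → YoungDiagram) (a b c : ℕ) :
    (a, b, c) ∈ fromLayers lam mu N rho ↔ c < N ∧ mu.rowLen c ≤ a ∧ lam.colLen c ≤ b ∧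
      (a - mu.rowLen c, b - lam.colLen c) ∈ rho c := by
  simp only [fromLayers, Finset.mem_biUnion, Finset.mem_range, Finset.mem_image,
    YoungDiagram.mem_cells, Prod.mk.injEq]
  constructor
  · rintro ⟨k, hk, x, hx, rfl, rfl, rfl⟩
    refine ⟨hk, Nat.le_add_left _ _, Nat.le_add_left _ _, ?_⟩
    rwa [Nat.add_sub_cancel, Nat.add_sub_cancel]
  · rintro ⟨hc, ha, hb, h⟩
    exact ⟨c, hc, _, h, Nat.sub_add_cancel ha, Nat.sub_add_cancel hb, rfl⟩

theorem chK6_fromLayers (lam mu : YoungDiagram) (N : ℕ) (rho : ℕ → YoungDiagram) :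
    chK6 (fromLayers lam mu N rho)
      = ∑ k ∈ range N, mon (mu.rowLen k) (lam.colLen k) k * chK4 (rho k) := by
  rw [chK6, sum_fromLayers]
  refine Finset.sum_congr rfl fun k _ => ?_
  rw [mon_mul_chK4]
  refine Finset.sum_congr rfl fun x _ => ?_
  push_cast
  rw [add_comm (x.1 : ℤ), add_comm (x.2 : ℤ)]

theorem card_fromLayers (lam mu : YoungDiagram) (N : ℕ) (rho : ℕ → YoungDiagram) :
    (fromLayers lam mu N rho).card = ∑ k ∈ range N, (rho k).card := by
  rw [Finset.card_eq_sum_ones, sum_fromLayers]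
  exact Finset.sum_congr rfl fun k _ => (Finset.card_eq_sum_ones _).symm

/-- Stacking is iterated downwards in absolute coordinates. Corners recede with height, so a
position beyond the lowest corner is beyond all intermediate ones and the subtractions are genuine.
-/
theorem IsStacked.mem_of_le {lam mu : YoungDiagram} {N : ℕ} {rho : ℕ → YoungDiagram}
    (h : IsStacked lam mu N rho) {a b c' c : ℕ} (hc : c' ≤ c) (ha : mu.rowLen c' ≤ a)
    (hb : lam.colLen c' ≤ b) (hN : c < N)
    (hmem : (a - mu.rowLen c, b - lam.colLen c) ∈ rho c) :
    (a - mu.rowLen c', b - lam.colLen c') ∈ rho c' := by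
  induction c, hc using Nat.le_induction with
  | base => exact hmem
  | succ c hc ih =>
    have h1 := mu.rowLen_anti c' c hc
    have h2 := lam.colLen_anti c' c hc
    have h3 := mu.rowLen_anti c (c + 1) c.le_succ
    have h4 := lam.colLen_anti c (c + 1) c.le_succ
    refine ih (by omega) ?_
    have h5 := h c hN _ _ hmem (by omega) (by omega)
    rwa [show a - mu.rowLen (c + 1) - (mu.rowLen c - mu.rowLen (c + 1)) = a - mu.rowLen c by omega,
      show b - lam.colLen (c + 1) - (lam.colLen c - lam.colLen (c + 1)) = b - lam.colLen c by
        omega] at h5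

theorem isLegConfig_fromLayers {lam mu : YoungDiagram} {N : ℕ} {rho : ℕ → YoungDiagram}
    (h : IsStacked lam mu N rho) : IsLegConfig lam mu (fromLayers lam mu N rho) := by
  refine ⟨?_, ?_⟩
  · rintro ⟨a, b, c⟩ hx
    rw [mem_fromLayers] at hx
    rw [mem_boundaryBoxes]
    omega
  · rintro ⟨a, b, c⟩ ⟨a', b', c'⟩ ⟨ha, hb, hc⟩ hx
    simp only at ha hb hc
    by_cases hbd : (a', b', c') ∈ boundaryBoxes lam mu
    · exact Or.inl hbd
    rw [mem_boundaryBoxes] at hbd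
    rcases hx with hx | hx
    · rw [mem_boundaryBoxes] at hx
      have h1 := mu.rowLen_anti c' c hc
      have h2 := lam.colLen_anti c' c hc
      omega
    · refine Or.inr ?_
      rw [Finset.mem_coe, mem_fromLayers] at hx ⊢
      refine ⟨by omega, by omega, by omega, ?_⟩
      have h1 := h.mem_of_le hc (a := a) (b := b) (by omega) (by omega) hx.1 hx.2.2.2
      exact (rho c').isLowerSet (show (a' - mu.rowLen c', b' - lam.colLen c')
        ≤ (a - mu.rowLen c', b - lam.colLen c') from
          ⟨Nat.sub_le_sub_right ha _, Nat.sub_le_sub_right hb _⟩) h1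

theorem IsLegConfig.mem_of_le {lam mu : YoungDiagram} {π : Finset (ℕ × ℕ × ℕ)}
    (h : IsLegConfig lam mu π) {a b c a' b' c' : ℕ} (hx : (a, b, c) ∈ π) (ha : a' ≤ a)
    (hb : b' ≤ b) (hc : c' ≤ c) (ha' : mu.rowLen c' ≤ a') (hb' : lam.colLen c' ≤ b') :
    (a', b', c') ∈ π := by
  rcases h.2 (show (a', b', c') ≤ (a, b, c) from ⟨ha, hb, hc⟩) (Or.inr hx) with h1 | h1
  · rw [mem_boundaryBoxes] at h1
    omega
  · exact h1

theorem injective_translate (a b k : ℕ) :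
    Function.Injective fun x : ℕ × ℕ => (x.1 + a, x.2 + b, k) := fun x y h => by
  simp only [Prod.mk.injEq, add_left_inj, and_true] at h
  exact Prod.ext h.1 h.2

/-- A layer of a plane partition with legs, translated to the origin. -/
def layer {lam mu : YoungDiagram} {π : Finset (ℕ × ℕ × ℕ)} (h : IsLegConfig lam mu π) (k : ℕ) :
    YoungDiagram where
  cells := π.preimage (fun x => (x.1 + mu.rowLen k, x.2 + lam.colLen k, k))
    (injective_translate _ _ _).injOn
  isLowerSet := by
    rintro ⟨i, j⟩ ⟨i', j'⟩ ⟨hi, hj⟩ hx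
    rw [Finset.mem_coe, Finset.mem_preimage] at hx ⊢
    simp only at hi hj
    exact h.mem_of_le hx (by omega) (by omega) le_rfl (by omega) (by omega)

theorem mem_layer {lam mu : YoungDiagram} {π : Finset (ℕ × ℕ × ℕ)} (h : IsLegConfig lam mu π)
    (k i j : ℕ) : (i, j) ∈ layer h k ↔ (i + mu.rowLen k, j + lam.colLen k, k) ∈ π := by
  rw [← YoungDiagram.mem_cells, layer, Finset.mem_preimage]

theorem isStacked_layer {lam mu : YoungDiagram} {π : Finset (ℕ × ℕ × ℕ)}
    (h : IsLegConfig lam mu π) (N : ℕ) : IsStacked lam mu N (layer h) := by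
  intro k _ i j hx hi hj
  rw [mem_layer] at hx ⊢
  exact h.mem_of_le hx (by omega) (by omega) k.le_succ (by omega) (by omega)

/-- Above height `lam.rowLen 0 + mu.colLen 0` there are no legs, so the whole column from there up
to the given box lies in `π`; counting it bounds the height. -/
theorem IsLegConfig.height_lt {lam mu : YoungDiagram} {π : Finset (ℕ × ℕ × ℕ)}
    (h : IsLegConfig lam mu π) {a b c : ℕ} (hx : (a, b, c) ∈ π) :
    c < π.card + (lam.rowLen 0 + mu.colLen 0) := by
  have hcard : (Finset.Icc (lam.rowLen 0 + mu.colLen 0) c).card ≤ π.card := by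
    refine Finset.card_le_card_of_injOn (fun i => (a, b, i)) (fun i hi => ?_)
      fun i _ j _ hij => by simpa using hij
    obtain ⟨h1, h2⟩ := Finset.mem_Icc.1 hi
    refine h.mem_of_le hx le_rfl le_rfl h2 ?_ ?_
    · by_contra h3
      have h4 := YoungDiagram.mem_iff_lt_colLen.1
        (YoungDiagram.mem_iff_lt_rowLen.2 (not_le.1 h3) : (i, a) ∈ mu)
      have := mu.colLen_anti 0 a (Nat.zero_le _)
      omega
    · by_contra h3
      have h4 := YoungDiagram.mem_iff_lt_rowLen.1
        (YoungDiagram.mem_iff_lt_colLen.2 (not_le.1 h3) : (b, i) ∈ lam)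
      have := lam.rowLen_anti 0 b (Nat.zero_le _)
      omega
  rw [Nat.card_Icc] at hcard
  omega

theorem fromLayers_layer {lam mu : YoungDiagram} {π : Finset (ℕ × ℕ × ℕ)}
    (h : IsLegConfig lam mu π) {N : ℕ} (hN : π.card + (lam.rowLen 0 + mu.colLen 0) ≤ N) :
    fromLayers lam mu N (layer h) = π := by
  ext ⟨a, b, c⟩
  rw [mem_fromLayers, mem_layer]
  constructor
  · rintro ⟨-, ha, hb, hx⟩
    rwa [Nat.sub_add_cancel ha, Nat.sub_add_cancel hb] at hx
  · intro hx
    have h1 := h.1 _ hx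
    rw [mem_boundaryBoxes] at h1
    have ha : mu.rowLen c ≤ a := by omega
    have hb : lam.colLen c ≤ b := by omega
    rw [Nat.sub_add_cancel ha, Nat.sub_add_cancel hb]
    exact ⟨(h.height_lt hx).trans_le hN, ha, hb, hx⟩

theorem mem_legConfigs (lam mu : YoungDiagram) (n : ℕ) (π : Finset (ℕ × ℕ × ℕ)) :
    π ∈ legConfigs lam mu n ↔ IsLegConfig lam mu π ∧ π.card = n := by
  rw [legConfigs, Set.Finite.mem_toFinset]; rfl

/-- The bound on `N` is needed for surjectivity: no configuration with `n` boxes reaches height `N`.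
-/
theorem bijOn_fromLayers (lam mu : YoungDiagram) {N n : ℕ}
    (hN : n + (lam.rowLen 0 + mu.colLen 0) ≤ N) :
    Set.BijOn (fromLayers lam mu N) {rho | rho ∈ layerings N n ∧ IsStacked lam mu N rho}
      (legConfigs lam mu n) := by
  refine ⟨?_, ?_, ?_⟩
  · rintro rho ⟨h1, h2⟩
    rw [Finset.mem_coe, mem_legConfigs, card_fromLayers]
    exact ⟨isLegConfig_fromLayers h2, ((mem_layerings _ _ _).1 h1).2⟩
  · rintro rho ⟨h1, -⟩ rho' ⟨h1', -⟩ he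
    funext k
    by_cases hk : k < N
    · have key : ∀ (r : ℕ → YoungDiagram) (i j : ℕ), (i, j) ∈ r k ↔
          (i + mu.rowLen k, j + lam.colLen k, k) ∈ fromLayers lam mu N r := fun r i j => by
        rw [mem_fromLayers]; simp [hk]
      refine YoungDiagram.ext (Finset.ext ?_)
      rintro ⟨i, j⟩
      rw [YoungDiagram.mem_cells, YoungDiagram.mem_cells, key, key, he]
    · rw [((mem_layerings _ _ _).1 h1).1 k (not_lt.1 hk),
        ((mem_layerings _ _ _).1 h1').1 k (not_lt.1 hk)]
  · intro π hπ
    rw [Finset.mem_coe, mem_legConfigs] at hπ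
    obtain ⟨h, rfl⟩ := hπ
    have hl := fromLayers_layer h hN
    refine ⟨layer h, ⟨(mem_layerings _ _ _).2 ⟨fun k hk => ?_, ?_⟩, isStacked_layer h N⟩, hl⟩
    · refine YoungDiagram.ext (Finset.eq_empty_of_forall_notMem ?_)
      rintro ⟨i, j⟩ hx
      rw [YoungDiagram.mem_cells, mem_layer] at hx
      have := h.height_lt hx
      omega
    · rw [← card_fromLayers lam mu, hl]

/-! ### The normal ordered product of the layers -/

theorem osc_add_weight (ε : Fin 4 → ℂ) (S : Finset (Fin 4)) (u : ℂ) (i j k : ℤ) {n : ℤ}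
    (hn : n ≠ 0) : osc ε S (u + weight ε (i, j, k)) n
      = Complex.exp (-(n * u)) * ev ε (-n) (mon i j k) / P ε S (-n) := by
  rw [osc, if_neg hn, ev_mon, ← Complex.exp_add]
  congr 2
  push_cast
  ring

theorem boundaryExp_fst {ε : Fin 4 → ℂ} (hε : Generic ε) (u : ℂ) (lam mu : YoungDiagram) {n : ℤ}
    (hn : n ≠ 0) : (boundaryExp ε u lam mu).1 n
      = -(Complex.exp (-(n * u)) * ev ε (-n) (chP12N lam mu) / P ε {0, 1} (-n)) := by
  have hA : ∀ x : ℕ × ℕ × ℕ, (currentA ε (u + x.1 * ε 0 + x.2.1 * ε 1 + x.2.2 * ε 2)).1 n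
      = Complex.exp (-(n * u)) * ev ε (-n) (mon x.1 x.2.1 x.2.2) := fun x => by
    have h := osc_add_weight ε ∅ u x.1 x.2.1 x.2.2 hn
    rw [P, Finset.prod_empty, div_one] at h
    rw [← h, currentA]
    simp [weight, add_assoc]
  have hS0 : ∀ x : ℕ × ℕ, (currentS ε 0 (u + x.1 * ε 1 + x.2 * ε 2)).1 n
      = Complex.exp (-(n * u)) * ev ε (-n) (mon 0 x.1 x.2) / P ε {0} (-n) := fun x => by
    rw [← osc_add_weight ε {0} u 0 x.1 x.2 hn, currentS]
    simp [weight, add_assoc]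
  have hS1 : ∀ x : ℕ × ℕ, (currentS ε 1 (u + x.2 * ε 0 + x.1 * ε 2)).1 n
      = Complex.exp (-(n * u)) * ev ε (-n) (mon x.2 0 x.1) / P ε {1} (-n) := fun x => by
    rw [← osc_add_weight ε {1} u x.2 0 x.1 hn, currentS]
    simp [weight, add_assoc]
  have hP : P ε {0, 1} (-n) = P ε {0} (-n) * P ε {1} (-n) := by simp [P]
  have h0 := hε.P_ne_zero {0} (neg_ne_zero.2 hn)
  have h1 := hε.P_ne_zero {1} (neg_ne_zero.2 hn)
  simp only [boundaryExp, chP12N, Prod.fst_add, Prod.fst_sub, Prod.fst_neg, Prod.fst_sum,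
    Pi.add_apply, Pi.sub_apply, Pi.neg_apply, Finset.sum_apply, hA, hS0, hS1, ← Finset.mul_sum,
    ← Finset.sum_div, map_sub, map_add, map_mul, map_sum, ev_chP hε, hP]
  field_simp
  ring

/-- The oscillator parts agree because moving the quadrants from the axis to the corners is the
boundary factor, while the quadrants on the axis and the tail telescope to the full `W`. -/
theorem sum_layerExponent {ε : Fin 4 → ℂ} (hε : Generic ε) (u : ℂ) {lam mu : YoungDiagram}
    {N : ℕ} (h1 : lam.rowLen 0 ≤ N) (h2 : mu.colLen 0 ≤ N) (rho : ℕ → YoungDiagram) :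
    ∑ k ∈ range (N + 1), layerExponent ε u (fun k => u + weight ε (corner lam mu k)) N rho k
      = -zeroModePart (boundaryExp ε u lam mu)
        + Lambda6 ε u lam mu (fromLayers lam mu N rho) := by
  have hL : ∑ k ∈ range (N + 1),
        layerExponent ε u (fun k => u + weight ε (corner lam mu k)) N rho k
      = ∑ k ∈ range N, Lambda4 ε (u + weight ε (corner lam mu k)) (rho k)
        + currentW ε (u + N * ε 2) := by
    rw [Finset.sum_range_succ, layerExponent, if_neg (lt_irrefl N)]
    refine congrArg (· + _) (Finset.sum_congr rfl fun k hk => ?_)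
    rw [layerExponent, if_pos (Finset.mem_range.1 hk)]
  rw [hL]
  refine Prod.ext ?_ ?_
  · funext n
    by_cases hn : n = 0
    · subst hn
      simp [Lambda4, Lambda6, zeroModePart, currentW, currentX, currentA, boundaryExp, currentS,
        osc, Prod.fst_sum, Finset.sum_apply]
    have hA : ∀ x : ℕ × ℕ × ℕ, (currentA ε (u + x.1 * ε 0 + x.2.1 * ε 1 + x.2.2 * ε 2)).1 n
        = Complex.exp (-(n * u)) * ev ε (-n) (mon x.1 x.2.1 x.2.2) := fun x => by
      have h := osc_add_weight ε ∅ u x.1 x.2.1 x.2.2 hn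
      rw [P, Finset.prod_empty, div_one] at h
      rw [← h, currentA]
      simp [weight, add_assoc]
    have hK : ∑ x ∈ fromLayers lam mu N rho, ev ε (-n) (mon x.1 x.2.1 x.2.2)
        = ∑ k ∈ range N, ev ε (-n) (mon (mu.rowLen k) (lam.colLen k) k)
          * ev ε (-n) (chK4 (rho k)) := by
      rw [← map_sum, ← chK6, chK6_fromLayers, map_sum]
      simp only [map_mul]
    have hc : ∀ k : ℕ, Complex.exp (-(n * weight ε (corner lam mu k)))
        = ev ε (-n) (mon (mu.rowLen k) (lam.colLen k) k) := fun k => by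
      rw [ev_mon, corner]; congr 1; push_cast; ring
    have hN := osc_add_weight ε {0, 1, 2} u 0 0 N hn
    have h0 := osc_add_weight ε {0, 1, 2} u 0 0 0 hn
    rw [mon_zero, map_one, mul_one] at h0
    simp only [weight, Int.cast_zero, zero_mul, zero_add, add_zero, Int.cast_natCast] at hN h0
    have hg := congrArg (ev ε (-n)) (congrArg (chP {0, 1} * ·) (geom_sum_mon 0 0 1 N))
    have hP : chP {0, 1} * (1 - mon 0 0 1) = chP {0, 1, 2} := by rw [chP_01, chP_012]
    simp only [mul_zero, mul_one, ← mul_assoc, hP] at hg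
    simp only [map_mul, map_sub, map_one, map_sum, ev_chP hε] at hg
    have hP1 := hε.P_ne_zero {0, 1} (neg_ne_zero.2 hn)
    have hP2 := hε.P_ne_zero {0, 1, 2} (neg_ne_zero.2 hn)
    simp only [Prod.fst_add, Prod.fst_sum, Pi.add_apply, Finset.sum_apply, Lambda4_fst ε u _ _ hn,
      Lambda6, Prod.fst_sub, Pi.sub_apply, boundaryExp_fst hε u lam mu hn, hA,
      ← Finset.mul_sum, hK, hc, zeroModePart, Prod.fst_neg, Pi.neg_apply, Pi.zero_apply,
      chP12N_eq lam mu h1 h2, map_sum, map_sub, Finset.sum_sub_distrib, mul_sub, currentW, hN, h0,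
      mul_assoc, ← Finset.sum_mul]
    field_simp
    linear_combination Complex.exp (-(n * u)) * hg
  -- For the zero modes the boundary cancels outright; the `N` copies of `ε 2 * ε 3` compensate the
  -- shift of the argument of the tail.
  · have hA : ∀ w, (currentA ε w).2 = ![1, 0, 0, 0] := fun w => rfl
    funext i
    simp only [Prod.snd_add, Prod.snd_sum, Lambda4_snd, Lambda6, Prod.snd_sub, hA, zeroModePart,
      Prod.snd_neg, Finset.sum_const, card_fromLayers, Pi.add_apply, Pi.sub_apply, Pi.neg_apply,
      Finset.sum_apply, currentW]
    fin_cases i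
    · simp
      ring
    · simp
      ring
    · simp
    · simp

end

end QQ

/-! ### The two-leg decomposition theorem -/

theorem mainTheorem5 (ε : Fin 4 → ℂ) (hε : QQ.Generic ε) (u : ℂ) (lam mu : YoungDiagram) :
    QQ.InfiniteProductEq ε u
      (fun k => u + k * ε 2 + mu.rowLen k * ε 0 + lam.colLen k * ε 1)
      (PowerSeries.C
          (AddMonoidAlgebra.single (-QQ.zeroModePart (QQ.boundaryExp ε u lam mu)) (1 : ℂ))
        * QQ.T6 ε u lam mu) := by
  classical
  have hy : (fun k : ℕ => u + k * ε 2 + mu.rowLen k * ε 0 + lam.colLen k * ε 1)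
      = fun k => u + QQ.weight ε (QQ.corner lam mu k) := by
    funext k
    simp only [QQ.weight, QQ.corner]
    push_cast
    ring
  rw [hy]
  intro n
  -- From this height on there are neither legs nor boxes in configurations of size `n`.
  refine ⟨n + (lam.rowLen 0 + mu.colLen 0), fun N hN v m z => ?_⟩
  have hleft : PowerSeries.mk (fun d => MvPowerSeries.coeff m (QQ.completedProduct ε u
        (fun k => u + QQ.weight ε (QQ.corner lam mu k)) N v n d) z)
        * (QQ.oneLoop ε u (fun k => u + QQ.weight ε (QQ.corner lam mu k)) N)⁻¹
      = ∑ rho ∈ QQ.layerings N n, PowerSeries.C (∏ k ∈ Finset.range N, QQ.Z4 ε (rho k))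
        * (PowerSeries.mk (fun d => MvPowerSeries.coeff m (QQ.vertexChain ε (QQ.layerExponent ε u
            (fun k => u + QQ.weight ε (QQ.corner lam mu k)) N rho) v (N + 1) d) z)
          * (QQ.oneLoop ε u (fun k => u + QQ.weight ε (QQ.corner lam mu k)) N)⁻¹) := by
    simp only [← mul_assoc, ← Finset.sum_mul]
    congr 1
    ext d
    simp only [PowerSeries.coeff_mk, QQ.completedProduct_eq, map_sum, Finset.sum_apply,
      QQ.coeff_scalar_mul, PowerSeries.coeff_C_mul]
  have hright : MvPowerSeries.coeff m (QQ.symbolOp ε (PowerSeries.coeff n (PowerSeries.C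
          (AddMonoidAlgebra.single (-QQ.zeroModePart (QQ.boundaryExp ε u lam mu)) (1 : ℂ))
        * QQ.T6 ε u lam mu)) v) z
      = ∑ π ∈ QQ.legConfigs lam mu n, QQ.Z6 ε lam mu π * MvPowerSeries.coeff m (QQ.vertexOp ε
          (-QQ.zeroModePart (QQ.boundaryExp ε u lam mu) + QQ.Lambda6 ε u lam mu π) v) z := by
    rw [PowerSeries.coeff_C_mul, QQ.T6, PowerSeries.coeff_mk, Finset.mul_sum]
    simp only [AddMonoidAlgebra.single_mul_single, one_mul]
    rw [QQ.symbolOp_sum_single, map_sum, Finset.sum_apply]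
    simp only [QQ.coeff_scalar_mul]
  have hsum : ∑ π ∈ QQ.legConfigs lam mu n, QQ.Z6 ε lam mu π * MvPowerSeries.coeff m (QQ.vertexOp ε
          (-QQ.zeroModePart (QQ.boundaryExp ε u lam mu) + QQ.Lambda6 ε u lam mu π) v) z
      = ∑ rho ∈ QQ.layerings N n, QQ.layeringWeight ε lam mu N rho
        * MvPowerSeries.coeff m (QQ.vertexOp ε (∑ k ∈ Finset.range (N + 1), QQ.layerExponent ε u
            (fun k => u + QQ.weight ε (QQ.corner lam mu k)) N rho k) v) z := by
    -- Sequences that do not stack have weight zero, so the sum may be restricted to those that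
    -- correspond to configurations.
    rw [← Finset.sum_filter_of_ne (p := QQ.IsStacked lam mu N) fun rho _ h => by
      by_contra h0
      rw [QQ.layeringWeight_eq_zero ε lam mu N rho h0, zero_mul] at h
      exact h rfl]
    have hbij := QQ.bijOn_fromLayers lam mu hN
    rw [← Finset.coe_filter] at hbij
    refine (Finset.sum_nbij (QQ.fromLayers lam mu N) hbij.mapsTo hbij.injOn hbij.surjOn
      fun rho hrho => ?_).symm
    rw [QQ.layeringWeight_eq_Z6 hε (by omega) (by omega) (Finset.mem_filter.1 hrho).2 _
      (QQ.chK6_fromLayers lam mu N rho), QQ.sum_layerExponent hε u (by omega) (by omega)]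
  rw [hleft, hright, hsum]
  refine QQ.ContinuesTo.sum _ _ _ fun rho _ => ?_
  rw [QQ.layeringWeight, mul_assoc]
  -- Continuation is done term by term, also for sequences that do not stack: nonnegativity of the
  -- interlacing numbers makes each of them regular at `s = 1`.
  refine QQ.ContinuesTo.C_mul _ (QQ.continuesTo_vertexChain hε u (QQ.corner lam mu) N rho
    (fun j _ i hij => QQ.coeff_pairChar_corner_nonneg lam mu hij _ _) (fun i hi => ?_) v m z)
  rw [QQ.coeff_dualHom, neg_zero, QQ.coeff_tailChar_corner lam mu hi]
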